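/- **Setting.** Let $\Phi:\mathbb R_{\ge0}^2\to\mathbb R$ be continuous, bounded, nonnegative and symmetric, $\Phi(r,\rho)=\Phi(\rho,r)$; it determines the collision kernel $B(\mathbf v-\mathbf v_*,\omega)=\frac{1}{(4\pi)^2}|(\mathbf v-\mathbf v_*)\cdot\omega|\,\Phi(|\mathbf v-\mathbf v'|,|\mathbf v-\mathbf v_*'|)$ with $\mathbf v'=\mathbf v-((\mathbf v-\mathbf v_*)\cdot\omega)\omega$, $\mathbf v_*'=\mathbf v_*+((\mathbf v-\mathbf v_*)\cdot\omega)\omega$, $\omega\in\mathbb S^2$. Let $\mathcal B_k^+$ be the set of positive Borel measures $F$ on $\mathbb R_{\ge0}$ with $\int(1+x)^k\,dF(x)<\infty$, and $C_b^2$ the set of functions $\varphi$ on $\mathbb R_{\ge0}$ that are bounded and continuous together with their derivatives up to order two. Write $(u)_+=\max\{u,0\}$. *Energy variables.* For $x,y,z\ge0$ put $x_*=(y+z-x)_+$, $\Delta\varphi(x,y,z)=\varphi(x)+\varphi(x_*)-\varphi(y)-\varphi(z)$, and for $s>0$ $$Y_*=\Big|\sqrt{\big(z-\tfrac{(x-y+s^2)^2}{4s^2}\big)_+}+e^{i\theta}\sqrt{\big(x-\tfrac{(x-y+s^2)^2}{4s^2}\big)_+}\Big|,$$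 with $Y_*=0$ for $s=0$. If $x_*xyz>0$ let $$W(x,y,z)=\frac1{4\pi\sqrt{xyz}}\int_{\max\{|\sqrt x-\sqrt y|,|\sqrt{x_*}-\sqrt z|\}}^{\min\{\sqrt x+\sqrt y,\sqrt{x_*}+\sqrt z\}}ds\int_0^{2\pi}\Phi(\sqrt2\,s,\sqrt2\,Y_*)\,d\theta .$$ Otherwise let $W=\frac{1}{\sqrt{yz}}\Phi(\sqrt{2y},\sqrt{2z})$ if $x=0$, $y,z>0$; $W=\frac1{\sqrt{xz}}\Phi(\sqrt{2x},\sqrt{2(z-x)})$ if $y=0$, $z>x>0$; $W=\frac1{\sqrt{xy}}\Phi(\sqrt{2(y-x)},\sqrt{2x})$ if $z=0$, $y>x>0$; and $W=0$ in all other cases. Put $\mathcal K[\varphi]=W\,\Delta\varphi$ and $\mathcal J[\varphi](y,z)=\frac12\int_0^{y+z}\mathcal K[\varphi](x,y,z)\sqrt x\,dx$. A family $(F_t)_{t\ge0}\subset\mathcal B_1^+$ is a *solution in the energy form* (with initial datum $F_0$) if $\int dF_t=\int dF_0$ and $\int x\,dF_t=\int x\,dF_0$ for all $t\ge0$, and for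 every $\varphi\in C_b^2$ the function $t\mapsto\int\varphi\,dF_t$ is in $C^1([0,\infty))$ with $$\frac{d}{dt}\int\varphi\,dF_t=\int_{\mathbb R_{\ge0}^2}\mathcal J[\varphi]\,dF_t(y)dF_t(z)+\int_{\mathbb R_{\ge0}^3}\mathcal K[\varphi]\,dF_t(x)dF_t(y)dF_t(z)\qquad\forall\,t\ge0.$$ *Speed variables.* Let $B(V,\cos\theta)=\frac{V\cos\theta}{(4\pi)^2}\Phi(V\cos\theta,V\sin\theta)$ for $V\ge 0$, $\theta\in[0,\pi/2]$. For $r,r_*\ge0$ let $$J_B[\varphi](r,r_*)=\frac{2}{(4\pi)^2}\int_{\mathbb S^2\times\mathbb S^2}d\sigma\,d\sigma_*\int_0^{\pi/2}B(|r\sigma-r_*\sigma_*|,\cos\theta)\sin\theta\,d\theta\int_0^{2\pi}\big(\varphi(|\mathbf v'|^2/2)-\varphi(r^2/2)\big)d\vartheta,$$ $$|\mathbf v'|^2=r^2\sin^2\theta+r_*^2\cos^2\theta-2rr_*\sin\theta\cos\theta\sqrt{1-\langle\sigma,\sigma_*\rangle^2}\,\cos\vartheta .$$ For $r,r',r_*'\ge0$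 let $K_B[\varphi](r,r',r_*')=0$ if $(r'-r)(r_*'-r)=0$, and otherwise $$K_B[\varphi](r,r',r_*')=\frac{4}{(4\pi)^5}\int_{\mathbb S^2\times\mathbb S^2}d\sigma\,d\sigma'\int_0^{2\pi}\mathbf 1_{\{r_*'>r|\langle\sigma,\xi\rangle|\}}\frac{\Delta\varphi(r^2/2,r'^2/2,r_*'^2/2)}{X r_*'+Y r'}\,\Phi(X,Y)\,d\vartheta,$$ where $X=|r\sigma-r'\sigma'|$, $\xi=(r\sigma-r'\sigma')/X$ if $X\ne0$, $\xi=\sigma$ if $X=0$, and $Y=\big|\sqrt{r_*'^2-\langle r\sigma,\xi\rangle^2}+e^{i\vartheta}\sqrt{r^2-\langle r\sigma,\xi\rangle^2}\big|$. A family $(\bar F_t)_{t\ge0}\subset\mathcal B_2^+$ is a *solution in the speed form* (with initial datum $\bar F_0$) if $\int d\bar F_t=\int d\bar F_0$ and $\int r^2d\bar F_t=\int r^2d\bar F_0$ for all $t\ge0$, and for every $\varphi\in C_b^2$ the function $t\mapsto\int\varphi(r^2/2)\,d\bar F_t(r)$ is in $C^1([0,\infty))$ with $$\frac{d}{dt}\int\varphi(r^2/2)\,d\bar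 F_t(r)=\int_{\mathbb R_{\ge0}^2}J_B[\varphi]\,d\bar F_t(r)d\bar F_t(r_*)+\int_{\mathbb R_{\ge0}^3}K_B[\varphi]\,d\bar F_t(r)d\bar F_t(r')d\bar F_t(r_*')\qquad\forall\,t\ge0.$$ *Correspondence.* Say that $F\in\mathcal B_1^+$ and $\bar F\in\mathcal B_2^+$ correspond if one of the following two equalities holds for all Borel sets $A\subset\mathbb R_{\ge0}$: $$F(A)=\frac1{4\pi\sqrt2}\int\mathbf 1_A(r^2/2)\,d\bar F(r),\qquad \bar F(A)=4\pi\sqrt2\int\mathbf 1_A(\sqrt{2x})\,dF(x).$$ **Statement.** (a) If $F\in\mathcal B_1^+$ and $\bar F\in\mathcal B_2^+$ correspond, then for every $\varphi\in C_b^2$ all four of the following integrals converge absolutely, and $$\int_{\mathbb R_{\ge0}^2}J_B[\varphi]\,d\bar F\,d\bar F=4\pi\sqrt2\int_{\mathbb R_{\ge0}^2}\mathcal J[\varphi]\,dF\,dF,\qquad \int_{\mathbb R_{\ge0}^3}K_B[\varphi]\,d\bar F\,d\bar F\,d\bar F=4\pi\sqrt2\int_{\mathbb R_{\ge0}^3}\mathcal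 K[\varphi]\,dF\,dF\,dF.$$ (b) If $F_t\in\mathcal B_1^+$ and $\bar F_t\in\mathcal B_2^+$ correspond for every $t\ge0$, then $(F_t)_{t\ge0}$ is a solution in the energy form if and only if $(\bar F_t)_{t\ge0}$ is a solution in the speed form. -/

import Mathlib

open MeasureTheory Set
open scoped NNReal ENNReal Real InnerProductSpace

noncomputable section

namespace BoseEinstein

/-- Velocity space `ℝ³`. -/
abbrev R3 : Type := EuclideanSpace ℝ (Fin 3)

/-- The unit sphere `𝕊²` in velocity space. -/
abbrev S2 : Type := Metric.sphere (0 : R3) 1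

/-- The surface measure `dσ` on `𝕊²` (total mass `4π`). -/
def surf : Measure S2 := (volume : Measure R3).toSphere

/-- `F ∈ 𝓑ₖ⁺(ℝ≥0)`: a positive Borel measure with `∫ (1 + x)ᵏ dF(x) < ∞`. -/
def MemBPlus (k : ℕ) (F : Measure ℝ≥0) : Prop :=
  ∫⁻ x : ℝ≥0, (1 + (x : ℝ≥0∞)) ^ k ∂F < ⊤

/-- The moment `∫ xᵖ dF(x)`; mass is `p = 0` and energy is `p = 1`. -/
def moment (p : ℕ) (F : Measure ℝ≥0) : ℝ := ∫ x : ℝ≥0, (x : ℝ) ^ p ∂F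

/-- `φ ∈ C_b^k(ℝ≥0)`: `φ` is of class `C^k` on `[0, ∞)` (one-sided derivatives at `0`), and it is
bounded there together with its derivatives up to order `k`. Only the values of `φ` on `[0, ∞)`
are ever used. -/
def MemCb (k : ℕ) (φ : ℝ → ℝ) : Prop :=
  ContDiffOn ℝ k φ (Ici 0) ∧
    ∀ j ≤ k, ∃ C : ℝ, ∀ x ∈ Ici (0 : ℝ), |iteratedDerivWithin j φ (Ici 0) x| ≤ C

/-- `0 ≤ Φ ∈ C_b(ℝ≥0²)` and `Φ` is symmetric. Only the values of `Φ` on `[0, ∞)²` are ever used. -/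
structure IsKernelFactor (Φ : ℝ → ℝ → ℝ) : Prop where
  continuousOn : ContinuousOn (fun p : ℝ × ℝ => Φ p.1 p.2) (Ici 0 ×ˢ Ici 0)
  nonneg : ∀ r ρ : ℝ, 0 ≤ r → 0 ≤ ρ → 0 ≤ Φ r ρ
  bounded : ∃ C : ℝ, ∀ r ρ : ℝ, 0 ≤ r → 0 ≤ ρ → Φ r ρ ≤ C
  symmetric : ∀ r ρ : ℝ, 0 ≤ r → 0 ≤ ρ → Φ r ρ = Φ ρ r

/-- `|a + e^{iθ} b|`. -/
def polarNorm (a b θ : ℝ) : ℝ := ‖(a : ℂ) + Complex.exp (Complex.I * (θ : ℂ)) * (b : ℂ)‖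

/-! ### Collision integrals in the energy variables `x, y, z` -/

/-- `x_* = (y + z - x)₊`. -/
def xStar (x y z : ℝ) : ℝ := max (y + z - x) 0

/-- `Δφ(x, y, z) = φ(x) + φ(x_*) - φ(y) - φ(z)`. -/
def Delta (φ : ℝ → ℝ) (x y z : ℝ) : ℝ := φ x + φ (xStar x y z) - φ y - φ z

/-- `Y_*(x, y, z, s, θ)`. -/
def YStar (x y z s θ : ℝ) : ℝ :=
  if 0 < s then
    polarNorm
      (√(max (z - (x - y + s ^ 2) ^ 2 / (4 * s ^ 2)) 0))
      (√(max (x - (x - y + s ^ 2) ^ 2 / (4 * s ^ 2)) 0)) θ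
  else 0

/-- The weight `W(x, y, z)`. -/
def W (Φ : ℝ → ℝ → ℝ) (x y z : ℝ) : ℝ :=
  if 0 < xStar x y z * x * y * z then
    1 / (4 * π * √(x * y * z)) *
      ∫ s in (max |√x - √y| |√(xStar x y z) - √z|)..(min (√x + √y) (√(xStar x y z) + √z)),
        ∫ θ in (0 : ℝ)..(2 * π), Φ (√2 * s) (√2 * YStar x y z s θ)
  else if x = 0 ∧ 0 < y ∧ 0 < z then
    1 / √(y * z) * Φ (√(2 * y)) (√(2 * z))
  else if y = 0 ∧ 0 < x ∧ x < z then
    1 / √(x * z) * Φ (√(2 * x)) (√(2 * (z - x)))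
  else if z = 0 ∧ 0 < x ∧ x < y then
    1 / √(x * y) * Φ (√(2 * (y - x))) (√(2 * x))
  else 0

/-- `𝒦[φ](x, y, z) = W(x, y, z) Δφ(x, y, z)`. -/
def calK (Φ : ℝ → ℝ → ℝ) (φ : ℝ → ℝ) (x y z : ℝ) : ℝ := W Φ x y z * Delta φ x y z

/-- `𝒥[φ](y, z) = ½ ∫₀^{y+z} 𝒦[φ](x, y, z) √x dx`. -/
def calJ (Φ : ℝ → ℝ → ℝ) (φ : ℝ → ℝ) (y z : ℝ) : ℝ :=
  1 / 2 * ∫ x in (0 : ℝ)..(y + z), calK Φ φ x y z * √x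

/-- The family `(F t)_{t ≥ 0}` is a conservative measure-valued isotropic solution on `[0, ∞)`
in the energy variables, with initial datum `F 0`. -/
structure IsSolution (Φ : ℝ → ℝ → ℝ) (F : ℝ → Measure ℝ≥0) : Prop where
  mem : ∀ t : ℝ, 0 ≤ t → MemBPlus 1 (F t)
  mass : ∀ t : ℝ, 0 ≤ t → moment 0 (F t) = moment 0 (F 0)
  energy : ∀ t : ℝ, 0 ≤ t → moment 1 (F t) = moment 1 (F 0)
  contDiff : ∀ φ : ℝ → ℝ, MemCb 2 φ →
    ContDiffOn ℝ 1 (fun t : ℝ => ∫ x : ℝ≥0, φ x ∂(F t)) (Ici 0)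
  equation : ∀ φ : ℝ → ℝ, MemCb 2 φ → ∀ t : ℝ, 0 ≤ t →
    HasDerivWithinAt (fun t : ℝ => ∫ x : ℝ≥0, φ x ∂(F t))
      ((∫ p : ℝ≥0 × ℝ≥0, calJ Φ φ p.1 p.2 ∂((F t).prod (F t))) +
        ∫ p : ℝ≥0 × ℝ≥0 × ℝ≥0, calK Φ φ p.1 p.2.1 p.2.2 ∂((F t).prod ((F t).prod (F t))))
      (Ici 0) t

/-! ### Collision integrals in the speed variables `r, r', r_*'` -/

/-- The collision kernel `B(V, cos θ) = V cos θ / (4π)² · Φ(V cos θ, V sin θ)` as a function of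
the relative speed `V = |v - v_*|` and the angle `θ ∈ [0, π/2]`. -/
def kernelB (Φ : ℝ → ℝ → ℝ) (V θ : ℝ) : ℝ :=
  V * Real.cos θ / (4 * π) ^ 2 * Φ (V * Real.cos θ) (V * Real.sin θ)

/-- `|v'|²` for `v = r σ`, `v_* = r_* σ_*`, `v' = v - ⟪v - v_*, ω⟫ ω`, where `ω` has polar angle `θ`
from the axis `v - v_*` and azimuth `ϑ`, measured from the component of `v` orthogonal to
that axis. -/
def vPrimeSq (r rs : ℝ) (σ σs : S2) (θ ϑ : ℝ) : ℝ :=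
  r ^ 2 * Real.sin θ ^ 2 + rs ^ 2 * Real.cos θ ^ 2
    - 2 * r * rs * Real.sin θ * Real.cos θ *
        √(1 - ⟪(σ : R3), (σs : R3)⟫_ℝ ^ 2) * Real.cos ϑ

/-- The quadratic integrand `J_B[φ](r, r_*)`. -/
def JB (Φ : ℝ → ℝ → ℝ) (φ : ℝ → ℝ) (r rs : ℝ) : ℝ :=
  2 / (4 * π) ^ 2 *
    ∫ σ : S2, ∫ σs : S2,
      (∫ θ in (0 : ℝ)..(π / 2),
        kernelB Φ ‖r • (σ : R3) - rs • (σs : R3)‖ θ * Real.sin θ *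
          ∫ ϑ in (0 : ℝ)..(2 * π), (φ (vPrimeSq r rs σ σs θ ϑ / 2) - φ (r ^ 2 / 2)))
      ∂surf ∂surf

/-- `X = |r σ - r' σ'|`. -/
def XB (r r' : ℝ) (σ σ' : S2) : ℝ := ‖r • (σ : R3) - r' • (σ' : R3)‖

open Classical in
/-- `ξ = (r σ - r' σ') / |r σ - r' σ'|` if `r σ ≠ r' σ'`, and `ξ = σ` otherwise. -/
def xi (r r' : ℝ) (σ σ' : S2) : R3 :=
  if r • (σ : R3) ≠ r' • (σ' : R3) then
    (XB r r' σ σ')⁻¹ • (r • (σ : R3) - r' • (σ' : R3))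
  else (σ : R3)

/-- `Y = |√(r_*'² - ⟪rσ, ξ⟫²) + e^{iϑ} √(r² - ⟪rσ, ξ⟫²)|`. -/
def YB (r r' rs' : ℝ) (σ σ' : S2) (ϑ : ℝ) : ℝ :=
  polarNorm
    (√(rs' ^ 2 - ⟪r • (σ : R3), xi r r' σ σ'⟫_ℝ ^ 2))
    (√(r ^ 2 - ⟪r • (σ : R3), xi r r' σ σ'⟫_ℝ ^ 2)) ϑ

open Classical in
/-- The cubic integrand `K_B[φ](r, r', r_*')`. The factor `(4π)⁻⁵ = (4π)⁻² (4π)⁻³` contains the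
normalization `(4π)⁻²` of the collision kernel. -/
def KB (Φ : ℝ → ℝ → ℝ) (φ : ℝ → ℝ) (r r' rs' : ℝ) : ℝ :=
  if (r' - r) * (rs' - r) ≠ 0 then
    4 / (4 * π) ^ 5 *
      ∫ σ : S2, ∫ σ' : S2,
        (∫ ϑ in (0 : ℝ)..(2 * π),
          if r * |⟪(σ : R3), xi r r' σ σ'⟫_ℝ| < rs' then
            Delta φ (r ^ 2 / 2) (r' ^ 2 / 2) (rs' ^ 2 / 2) /
                (XB r r' σ σ' * rs' + YB r r' rs' σ σ' ϑ * r') *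
              Φ (XB r r' σ σ') (YB r r' rs' σ σ' ϑ)
          else 0)
        ∂surf ∂surf
  else 0

/-- The family `(G t)_{t ≥ 0}` is a conservative measure-valued isotropic solution on `[0, ∞)`
in the speed variables, with initial datum `G 0`. -/
structure IsSpeedSolution (Φ : ℝ → ℝ → ℝ) (G : ℝ → Measure ℝ≥0) : Prop where
  mem : ∀ t : ℝ, 0 ≤ t → MemBPlus 2 (G t)
  mass : ∀ t : ℝ, 0 ≤ t → moment 0 (G t) = moment 0 (G 0)
  energy : ∀ t : ℝ, 0 ≤ t → moment 2 (G t) = moment 2 (G 0)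
  contDiff : ∀ φ : ℝ → ℝ, MemCb 2 φ →
    ContDiffOn ℝ 1 (fun t : ℝ => ∫ r : ℝ≥0, φ ((r : ℝ) ^ 2 / 2) ∂(G t)) (Ici 0)
  equation : ∀ φ : ℝ → ℝ, MemCb 2 φ → ∀ t : ℝ, 0 ≤ t →
    HasDerivWithinAt (fun t : ℝ => ∫ r : ℝ≥0, φ ((r : ℝ) ^ 2 / 2) ∂(G t))
      ((∫ p : ℝ≥0 × ℝ≥0, JB Φ φ p.1 p.2 ∂((G t).prod (G t))) +
        ∫ p : ℝ≥0 × ℝ≥0 × ℝ≥0, KB Φ φ p.1 p.2.1 p.2.2 ∂((G t).prod ((G t).prod (G t))))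
      (Ici 0) t

/-! ### Correspondence between the two kinds of measures -/

/-- `F(A) = (4π√2)⁻¹ ∫ 1_A(r²/2) dG(r)` for all Borel sets `A`. -/
def EnergyFromSpeed (F G : Measure ℝ≥0) : Prop :=
  ∀ A : Set ℝ≥0, MeasurableSet A →
    F A = ENNReal.ofReal (1 / (4 * π * √2)) * ∫⁻ r : ℝ≥0, A.indicator 1 (r ^ 2 / 2) ∂G

/-- `G(A) = 4π√2 ∫ 1_A(√(2x)) dF(x)` for all Borel sets `A`. -/
def SpeedFromEnergy (F G : Measure ℝ≥0) : Prop :=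
  ∀ A : Set ℝ≥0, MeasurableSet A →
    G A = ENNReal.ofReal (4 * π * √2) * ∫⁻ x : ℝ≥0, A.indicator 1 (NNReal.sqrt (2 * x)) ∂F

end BoseEinstein

end

open MeasureTheory Set
open scoped NNReal ENNReal Real InnerProductSpace

noncomputable section

namespace BoseEinstein

/-! Let `x` be the energy of one particle in a collision and `y`, `z` those of the pair on the other
side. The geometry is carried by `s` and `u`, the distances, divided by `√2`, from the velocity of
energy `x` to the velocities of energies `y` and `z`. These two differences are orthogonal, so `s`,
`u` are the legs of a right triangle whose hypotenuse is the relative speed over `√2`. Every angular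
integral becomes an integral over the quadrant `s, u > 0` with density `4su/√D`, where `D =
collisionDisc s u x y z`. Where `D ≤ 0`, the conventions for real square roots and division by zero
make the density vanish, so admissible regions need not be carried along. In these variables `W` is
`1/(4π√(xyz))` times the integral of `Φ(√2 s, √2 u)` (`ofReal_W`).

Cubic term. The speed kernel is not symmetric in `y`, `z`: its density contains the factor `s/√(xy)
/ (2(s√z + u√y))`. Exchanging `(y, s)` with `(z, u)` preserves `D` and `Φ`, and the two factors add
up to `1/(2√(xyz))`. Hence the two orderings of the speed weight together give `2W`
(`cubicWeight_add_swap`).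

Quadratic term. The relative speed and the scattering angle are polar coordinates for `(s, u)`, and
the uniform azimuth gives the outgoing energy an arcsine law whose density is the one in `D`. The
gain operator is therefore integration against `W √x dx` (`gain_eq_integral`). Exchanging the
incoming particles reflects `x` to `x_*`, and gain minus loss over both orderings gives twice `calJ`
(`JB_add_swap`).

Both identities hold pointwise only after adding the value at swapped arguments. The product
measures are invariant under the swap, so the integrals agree (`integral_eq_of_add_swap`). Since the
measures may charge the origin, and the product measures the diagonals, the identities are needed at
every point: zero energies are computed by hand, and on the diagonals `Δφ` vanishes.

Absolute convergence of the cubic term combines the second-difference bound `|Δφ| ≤ L|x - y||x - z|`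
with `W ≤ C/√(|x - y||x - z|)` off the diagonals. For the quadratic term, `W √x` is at most `C/√(max
y z)`, which gives linear growth in the energies. Equalities of nonnegative quantities are proved in
`ℝ≥0∞`, where Tonelli needs no integrability. -/

/-! ### Polar coordinates and zonal integrals over the sphere. -/

theorem lintegral_polar (f : ℝ × ℝ → ℝ≥0∞) (hf : Measurable f) :
    ∫⁻ p, f p = ∫⁻ r in Ioi (0 : ℝ), ∫⁻ θ in Ioo (-π) π,
      ENNReal.ofReal r * f (r * Real.cos θ, r * Real.sin θ) := by
  rw [← lintegral_comp_polarCoord_symm, polarCoord_target, Measure.volume_eq_prod,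
    ← Measure.prod_restrict, lintegral_prod]
  · simp [polarCoord_symm_apply]
  · apply Measurable.aemeasurable
    simp only [polarCoord_symm_apply]
    fun_prop

theorem lintegral_half_plane_polar (f : ℝ → ℝ → ℝ≥0∞) (hf : Measurable (Function.uncurry f)) :
    ∫⁻ a, ∫⁻ ρ in Ioi (0 : ℝ), f a ρ = ∫⁻ r in Ioi (0 : ℝ), ∫⁻ θ in Ioo 0 π,
      ENNReal.ofReal r * f (r * Real.cos θ) (r * Real.sin θ) := by
  have h1 : ∀ a, ∫⁻ ρ in Ioi (0 : ℝ), f a ρ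
      = ∫⁻ ρ, (Ioi (0 : ℝ)).indicator (fun ρ => f a ρ) ρ := fun a => by
    rw [lintegral_indicator measurableSet_Ioi]
  have hm : Measurable (fun p : ℝ × ℝ => (Ioi (0 : ℝ)).indicator (fun ρ => f p.1 ρ) p.2) := by
    have : (fun p : ℝ × ℝ => (Ioi (0 : ℝ)).indicator (fun ρ => f p.1 ρ) p.2)
        = (Prod.snd ⁻¹' (Ioi (0 : ℝ))).indicator (Function.uncurry f) := by
      ext p; simp [indicator, Function.uncurry]
    rw [this]
    exact hf.indicator (measurable_snd measurableSet_Ioi)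
  simp_rw [h1]
  rw [← lintegral_prod (fun p : ℝ × ℝ => (Ioi (0 : ℝ)).indicator (fun ρ => f p.1 ρ) p.2)
    hm.aemeasurable, ← Measure.volume_eq_prod, lintegral_polar _ hm]
  refine setLIntegral_congr_fun measurableSet_Ioi fun r hr => ?_
  simp only
  rw [← lintegral_indicator measurableSet_Ioo, ← lintegral_indicator measurableSet_Ioo]
  refine lintegral_congr fun θ => ?_
  have hr' : 0 < r := hr
  by_cases h : θ ∈ Ioo 0 π
  · have h' : θ ∈ Ioo (-π) π := ⟨by linarith [h.1, h.2], h.2⟩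
    have : 0 < r * Real.sin θ := mul_pos hr' (Real.sin_pos_of_mem_Ioo h)
    simp [indicator, h.1, h.2, h'.1, this, -mul_pos_iff_of_pos_left]
  · by_cases h' : θ ∈ Ioo (-π) π
    · have h0 : θ ≤ 0 := by
        by_contra h0
        exact h ⟨not_le.1 h0, h'.2⟩
      have : ¬ 0 < r * Real.sin θ := not_lt.2
        (mul_nonpos_of_nonneg_of_nonpos hr'.le (Real.sin_nonpos_of_nonpos_of_neg_pi_le h0 h'.1.le))
      rw [indicator_of_mem h', indicator_of_notMem h, indicator_of_notMem (by simpa using this),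
        mul_zero]
    · rw [indicator_of_notMem h, indicator_of_notMem h']

theorem lintegral_quadrant_polar (f : ℝ → ℝ → ℝ≥0∞) (hf : Measurable (Function.uncurry f)) :
    ∫⁻ s in Ioi (0 : ℝ), ∫⁻ u in Ioi (0 : ℝ), f s u
      = ∫⁻ r in Ioi (0 : ℝ), ∫⁻ θ in Ioc 0 (π / 2),
        ENNReal.ofReal r * f (r * Real.cos θ) (r * Real.sin θ) := by
  have hm : Measurable (Function.uncurry fun a u => (Ioi (0 : ℝ)).indicator (fun s => f s u) a) := by
    have : (Function.uncurry fun a u => (Ioi (0 : ℝ)).indicator (fun s => f s u) a)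
        = (Prod.fst ⁻¹' (Ioi (0 : ℝ))).indicator (Function.uncurry f) := by
      ext p; simp [indicator, Function.uncurry]
    rw [this]
    exact hf.indicator (measurable_fst measurableSet_Ioi)
  have h1 : ∫⁻ s in Ioi (0 : ℝ), ∫⁻ u in Ioi (0 : ℝ), f s u
      = ∫⁻ s, ∫⁻ u in Ioi (0 : ℝ), (Ioi (0 : ℝ)).indicator (fun s => f s u) s := by
    rw [← lintegral_indicator measurableSet_Ioi]
    refine lintegral_congr fun s => ?_
    by_cases hs : s ∈ Ioi (0 : ℝ) <;> simp [hs]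
  rw [h1, lintegral_half_plane_polar _ hm]
  refine setLIntegral_congr_fun measurableSet_Ioi fun r hr => ?_
  have hr' : 0 < r := hr
  rw [setLIntegral_congr (Ioo_ae_eq_Ioc (a := (0 : ℝ)) (b := π / 2)).symm,
    ← lintegral_indicator measurableSet_Ioo, ← lintegral_indicator measurableSet_Ioo]
  refine lintegral_congr fun θ => ?_
  by_cases h : θ ∈ Ioo 0 (π / 2)
  · have h' : θ ∈ Ioo 0 π := ⟨h.1, by linarith [h.2, Real.pi_pos]⟩
    have : 0 < r * Real.cos θ := mul_pos hr' (Real.cos_pos_of_mem_Ioo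
      ⟨by linarith [h.1, Real.pi_pos], h.2⟩)
    rw [indicator_of_mem h, indicator_of_mem h', indicator_of_mem (by simpa using this)]
  · by_cases h' : θ ∈ Ioo 0 π
    · have h0 : π / 2 ≤ θ := by
        by_contra h0
        exact h ⟨h'.1, not_le.1 h0⟩
      have : ¬ 0 < r * Real.cos θ := not_lt.2
        (mul_nonpos_of_nonneg_of_nonpos hr'.le (Real.cos_nonpos_of_pi_div_two_le_of_le h0
          (by linarith [h'.2, Real.pi_pos])))
      rw [indicator_of_mem h', indicator_of_notMem h, indicator_of_notMem (by simpa using this),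
        mul_zero]
    · rw [indicator_of_notMem h, indicator_of_notMem h']

theorem lintegral_axial (F : ℝ → ℝ → ℝ≥0∞) (hF : Measurable (Function.uncurry F)) :
    ∫⁻ w : R3, F (w 0) (√(w 1 ^ 2 + w 2 ^ 2))
      = ∫⁻ a : ℝ, ∫⁻ ρ in Ioi (0 : ℝ), ENNReal.ofReal (2 * π * ρ) * F a ρ := by
  have e1 := (PiLp.volume_preserving_toLp (Fin 3)).lintegral_comp
    (f := fun w : R3 => F (w 0) (√(w 1 ^ 2 + w 2 ^ 2))) (by fun_prop)
  have e2 := (volume_preserving_piFinSuccAbove (fun _ : Fin 3 => ℝ) 0).lintegral_comp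
    (f := fun q : ℝ × (Fin 2 → ℝ) => F q.1 (√(q.2 0 ^ 2 + q.2 1 ^ 2))) (by fun_prop)
  have e3 : ∀ a : ℝ, ∫⁻ q : Fin 2 → ℝ, F a (√(q 0 ^ 2 + q 1 ^ 2))
      = ∫⁻ p : ℝ × ℝ, F a (√(p.1 ^ 2 + p.2 ^ 2)) := fun a =>
    (volume_preserving_finTwoArrow ℝ).lintegral_comp
      (f := fun p : ℝ × ℝ => F a (√(p.1 ^ 2 + p.2 ^ 2))) (by fun_prop)
  rw [← e1]
  refine Eq.trans (Eq.trans ?_ e2) ?_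
  · rfl
  rw [Measure.volume_eq_prod, lintegral_prod _ (by fun_prop)]
  refine lintegral_congr fun a => ?_
  simp only
  rw [e3, lintegral_polar _ (by fun_prop)]
  refine setLIntegral_congr_fun measurableSet_Ioi fun r hr => ?_
  have hr' : 0 < r := hr
  have : ∀ θ, √((r * Real.cos θ) ^ 2 + (r * Real.sin θ) ^ 2) = r := fun θ => by
    rw [show (r * Real.cos θ) ^ 2 + (r * Real.sin θ) ^ 2
      = r ^ 2 * (Real.sin θ ^ 2 + Real.cos θ ^ 2) by ring, Real.sin_sq_add_cos_sq, mul_one,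
      Real.sqrt_sq hr'.le]
  simp only [this]
  rw [setLIntegral_const, Real.volume_Ioo, mul_right_comm, ← ENNReal.ofReal_mul hr'.le]
  congr 2
  ring

theorem lintegral_axial_spherical (F : ℝ → ℝ → ℝ≥0∞) (hF : Measurable (Function.uncurry F)) :
    ∫⁻ w : R3, F (w 0) (√(w 1 ^ 2 + w 2 ^ 2))
      = ∫⁻ r in Ioi (0 : ℝ), ∫⁻ θ in Ioo 0 π,
        ENNReal.ofReal (2 * π * r ^ 2 * Real.sin θ) * F (r * Real.cos θ) (r * Real.sin θ) := by
  rw [lintegral_axial F hF, lintegral_half_plane_polar _ (by fun_prop)]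
  refine setLIntegral_congr_fun measurableSet_Ioi fun r hr => ?_
  have hr' : 0 < r := hr
  refine setLIntegral_congr_fun measurableSet_Ioo fun θ _ => ?_
  rw [← mul_assoc, ← ENNReal.ofReal_mul hr'.le]
  congr 2
  ring

theorem lintegral_sin_comp_cos (f : ℝ → ℝ≥0∞) :
    ∫⁻ θ in Ioo 0 π, ENNReal.ofReal (Real.sin θ) * f (Real.cos θ) = ∫⁻ t in Ioo (-1) 1, f t := by
  have himg : Real.cos '' Ioo 0 π = Ioo (-1) 1 := by
    ext t
    constructor
    · rintro ⟨θ, hθ, rfl⟩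
      have h := Real.sin_pos_of_mem_Ioo hθ
      have h2 := Real.sin_sq_add_cos_sq θ
      exact abs_lt.1 ((sq_lt_one_iff_abs_lt_one _).1 (by nlinarith))
    · intro ht
      exact ⟨Real.arccos t, ⟨Real.arccos_pos.2 ht.2, Real.arccos_lt_pi.2 ht.1⟩,
        Real.cos_arccos ht.1.le ht.2.le⟩
  rw [← himg, lintegral_image_eq_lintegral_abs_deriv_mul measurableSet_Ioo
    (fun x _ => (Real.hasDerivAt_cos x).hasDerivWithinAt)
    (Real.injOn_cos.mono Ioo_subset_Icc_self)]
  refine setLIntegral_congr_fun measurableSet_Ioo fun θ hθ => ?_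
  rw [abs_neg, abs_of_pos (Real.sin_pos_of_mem_Ioo hθ)]

/-- In spherical coordinates the radial integral is `∫₀¹ 2πr² dr = 2π/3`, and `sin θ dθ` is Lebesgue
measure in `cos θ`. Since `toSphere` is defined through the volume of such cones, this is the
computation behind Archimedes' theorem below. -/
theorem volume_axial_cone (B : Set ℝ) (hB : MeasurableSet B) :
    volume {w : R3 | (0 < ‖w‖ ∧ ‖w‖ < 1) ∧ w 0 / ‖w‖ ∈ B}
      = ENNReal.ofReal (2 * π / 3) * volume (B ∩ Ioo (-1) 1) := by
  let S : Set (ℝ × ℝ) := {p | (0 < √(p.1 ^ 2 + p.2 ^ 2) ∧ √(p.1 ^ 2 + p.2 ^ 2) < 1) ∧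
    p.1 / √(p.1 ^ 2 + p.2 ^ 2) ∈ B}
  have hS_iff : ∀ a ρ : ℝ, (a, ρ) ∈ S ↔ (0 < √(a ^ 2 + ρ ^ 2) ∧ √(a ^ 2 + ρ ^ 2) < 1) ∧
      a / √(a ^ 2 + ρ ^ 2) ∈ B := fun _ _ => Iff.rfl
  have hS : MeasurableSet S := by
    have h1 : Measurable fun p : ℝ × ℝ => √(p.1 ^ 2 + p.2 ^ 2) := by fun_prop
    have h2 : Measurable fun p : ℝ × ℝ => p.1 / √(p.1 ^ 2 + p.2 ^ 2) := by fun_prop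
    exact ((measurableSet_lt measurable_const h1).inter (measurableSet_lt h1 measurable_const)).inter
      (h2 hB)
  let F : ℝ → ℝ → ℝ≥0∞ := fun a ρ => S.indicator 1 (a, ρ)
  have hF : Measurable (Function.uncurry F) := by
    have : Function.uncurry F = S.indicator 1 := by ext p; rfl
    rw [this]
    exact measurable_one.indicator hS
  have hnorm : ∀ w : R3, ‖w‖ = √(w 0 ^ 2 + (√(w 1 ^ 2 + w 2 ^ 2)) ^ 2) := fun w => by
    rw [EuclideanSpace.norm_eq, Real.sq_sqrt (by positivity), Fin.sum_univ_three]
    simp [add_assoc]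
  have hset : {w : R3 | (0 < ‖w‖ ∧ ‖w‖ < 1) ∧ w 0 / ‖w‖ ∈ B}
      = (fun w : R3 => (w 0, √(w 1 ^ 2 + w 2 ^ 2))) ⁻¹' S := by
    ext w
    simp only [hnorm]
    rfl
  have hmeas : Measurable fun w : R3 => (w 0, √(w 1 ^ 2 + w 2 ^ 2)) := by fun_prop
  rw [hset, ← lintegral_indicator_one (hmeas hS)]
  refine (lintegral_axial_spherical F hF).trans ?_
  have hin : ∀ r ∈ Ioi (0 : ℝ), ∫⁻ θ in Ioo 0 π,
      ENNReal.ofReal (2 * π * r ^ 2 * Real.sin θ) * F (r * Real.cos θ) (r * Real.sin θ)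
      = (Iio (1 : ℝ)).indicator (fun r => ENNReal.ofReal (2 * π * r ^ 2) *
        volume (B ∩ Ioo (-1) 1)) r := by
    intro r hr
    have hr' : 0 < r := hr
    have hθ : ∀ θ, √((r * Real.cos θ) ^ 2 + (r * Real.sin θ) ^ 2) = r := fun θ => by
      rw [show (r * Real.cos θ) ^ 2 + (r * Real.sin θ) ^ 2
        = r ^ 2 * (Real.sin θ ^ 2 + Real.cos θ ^ 2) by ring, Real.sin_sq_add_cos_sq, mul_one,
        Real.sqrt_sq hr'.le]
    by_cases h1 : r < 1
    · have hFe : ∀ θ, F (r * Real.cos θ) (r * Real.sin θ) = B.indicator 1 (Real.cos θ) := fun θ => by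
        have hiff : (r * Real.cos θ, r * Real.sin θ) ∈ S ↔ Real.cos θ ∈ B := by
          refine (hS_iff _ _).trans ?_
          rw [hθ, mul_div_cancel_left₀ _ hr'.ne']
          simp [hr', h1]
        by_cases hc : Real.cos θ ∈ B
        · simp only [F, indicator_of_mem (hiff.2 hc), indicator_of_mem hc, Pi.one_apply]
        · simp only [F, indicator_of_notMem (mt hiff.1 hc), indicator_of_notMem hc]
      rw [indicator_of_mem (show r ∈ Iio (1 : ℝ) from h1)]
      calc _ = ∫⁻ θ in Ioo 0 π, ENNReal.ofReal (2 * π * r ^ 2) *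
            (ENNReal.ofReal (Real.sin θ) * B.indicator 1 (Real.cos θ)) := by
            refine lintegral_congr fun θ => ?_
            rw [hFe, ENNReal.ofReal_mul (by positivity), mul_assoc]
        _ = _ := by
            rw [lintegral_const_mul' _ _ ENNReal.ofReal_ne_top, lintegral_sin_comp_cos,
              lintegral_indicator_one hB, Measure.restrict_apply hB]
    · have hFe : ∀ θ, F (r * Real.cos θ) (r * Real.sin θ) = 0 := fun θ => by
        refine indicator_of_notMem (fun h => h1 ?_) _
        have := ((hS_iff _ _).1 h).1.2
        rwa [hθ] at this
      rw [indicator_of_notMem (show r ∉ Iio (1 : ℝ) from h1)]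
      simp [hFe]
  rw [setLIntegral_congr_fun measurableSet_Ioi hin, lintegral_indicator measurableSet_Iio,
    Measure.restrict_restrict measurableSet_Iio, lintegral_mul_const _ (by fun_prop)]
  congr 1
  have hI : Iio (1 : ℝ) ∩ Ioi 0 = Ioo 0 1 := by ext; simp [and_comm]
  have : ∫ r in (0 : ℝ)..1, 2 * π * r ^ 2 = 2 * π / 3 := by
    simp
    ring
  rw [hI, ← this, intervalIntegral.integral_of_le zero_le_one,
    ofReal_integral_eq_lintegral_ofReal, setLIntegral_congr Ioo_ae_eq_Ioc]
  · exact (Continuous.integrableOn_Icc (by fun_prop)).mono_set Ioc_subset_Icc_self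
  · exact ae_of_all _ fun r => by positivity

-- Archimedes' hat-box theorem. The surface measure of a set is three times the volume of the cone
-- over it; an orthonormal basis whose first vector is `e` turns the inner product into the first
-- coordinate.
open scoped Pointwise in
theorem surf_map_inner (e : S2) :
    surf.map (fun σ : S2 => ⟪(σ : R3), (e : R3)⟫_ℝ)
      = ENNReal.ofReal (2 * π) • (volume : Measure ℝ).restrict (Ioo (-1) 1) := by
  have hmeas : Measurable fun σ : S2 => ⟪(σ : R3), (e : R3)⟫_ℝ := by fun_prop
  ext B hB
  rw [Measure.map_apply hmeas hB, surf, Measure.toSphere_apply' _ (hmeas hB),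
    Measure.smul_apply, Measure.restrict_apply hB, smul_eq_mul]
  have hv : ‖(e : R3)‖ = 1 := by simp
  obtain ⟨b, hb⟩ := Orthonormal.exists_orthonormalBasis_extension_of_card_eq
    (𝕜 := ℝ) (E := R3) (ι := Fin 3) (by simp) (v := fun _ => (e : R3)) (s := {0}) (by
      refine ⟨fun _ => hv, fun i j hij => ?_⟩
      exact absurd (Subsingleton.elim i j) hij)
  have hb0 : b 0 = (e : R3) := hb 0 rfl
  have hset : Ioo (0 : ℝ) 1 • ((↑) '' ((fun σ : S2 => ⟪(σ : R3), (e : R3)⟫_ℝ) ⁻¹' B) : Set R3)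
      = b.repr ⁻¹' {w : R3 | (0 < ‖w‖ ∧ ‖w‖ < 1) ∧ w 0 / ‖w‖ ∈ B} := by
    have hrepr : ∀ v : R3, b.repr v 0 = ⟪v, (e : R3)⟫_ℝ := fun v => by
      rw [b.repr_apply_apply, hb0, real_inner_comm]
    ext v
    simp only [mem_preimage, mem_ofPred_eq, LinearIsometryEquiv.norm_map, hrepr]
    constructor
    · rintro ⟨r, hr, _, ⟨σ, hσ, rfl⟩, rfl⟩
      have hn : ‖(σ : R3)‖ = 1 := by simp
      have : ‖r • (σ : R3)‖ = r := by rw [norm_smul, hn, mul_one, Real.norm_of_nonneg hr.1.le]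
      simp only [this, inner_smul_left]
      refine ⟨hr, ?_⟩
      have h2 : (starRingEnd ℝ) r * ⟪(σ : R3), (e : R3)⟫_ℝ / r = ⟪(σ : R3), (e : R3)⟫_ℝ := by
        simp [mul_div_cancel_left₀ _ hr.1.ne']
      rw [h2]
      exact hσ
    · rintro ⟨hn, hB'⟩
      refine ⟨‖v‖, hn, ‖v‖⁻¹ • v, ⟨⟨‖v‖⁻¹ • v, ?_⟩, ?_, rfl⟩, ?_⟩
      · simp [norm_smul, hn.1.ne']
      · simp only [mem_preimage, inner_smul_left]
        simpa [div_eq_inv_mul] using hB'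
      · simp [smul_smul, hn.1.ne']
  have hms : MeasurableSet {w : R3 | (0 < ‖w‖ ∧ ‖w‖ < 1) ∧ w 0 / ‖w‖ ∈ B} := by
    have h1 : Measurable fun w : R3 => ‖w‖ := by fun_prop
    have h2 : Measurable fun w : R3 => w 0 / ‖w‖ := by fun_prop
    exact ((measurableSet_lt measurable_const h1).inter (measurableSet_lt h1 measurable_const)).inter
      (h2 hB)
  rw [hset, b.measurePreserving_repr.measure_preimage hms.nullMeasurableSet,
    volume_axial_cone B hB, ← mul_assoc]
  congr 1
  rw [finrank_euclideanSpace_fin, show ((3 : ℕ) : ℝ≥0∞) = ENNReal.ofReal 3 by simp,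
    ← ENNReal.ofReal_mul (by norm_num)]
  congr 1
  ring

instance : IsFiniteMeasure surf := by unfold surf; infer_instance

theorem lintegral_inner_surf (e : S2) (f : ℝ → ℝ≥0∞) (hf : Measurable f) :
    ∫⁻ σ, f ⟪(σ : R3), (e : R3)⟫_ℝ ∂surf = ENNReal.ofReal (2 * π) * ∫⁻ t in Ioo (-1) 1, f t := by
  rw [← lintegral_map hf (by fun_prop), surf_map_inner, lintegral_smul_measure, smul_eq_mul]

theorem surf_univ : surf univ = ENNReal.ofReal (4 * π) := by
  have e : S2 := ⟨EuclideanSpace.single 0 1, by simp⟩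
  have := lintegral_inner_surf e 1 measurable_one
  simp only [Pi.one_apply, lintegral_one, Measure.restrict_apply_univ, Real.volume_Ioo] at this
  rw [this, ← ENNReal.ofReal_mul (by positivity)]
  congr 1
  ring

theorem lintegral_inner_surf_surf (f : ℝ → ℝ≥0∞) (hf : Measurable f) :
    ∫⁻ σ, ∫⁻ σ', f ⟪(σ : R3), (σ' : R3)⟫_ℝ ∂surf ∂surf
      = ENNReal.ofReal (8 * π ^ 2) * ∫⁻ t in Ioo (-1) 1, f t := by
  have : ∀ σ : S2, ∫⁻ σ', f ⟪(σ : R3), (σ' : R3)⟫_ℝ ∂surf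
      = ENNReal.ofReal (2 * π) * ∫⁻ t in Ioo (-1) 1, f t := fun σ => by
    simp_rw [real_inner_comm _ (σ : R3)]
    rw [← lintegral_inner_surf σ f hf]
  simp_rw [this]
  rw [lintegral_const, surf_univ, mul_right_comm, ← ENNReal.ofReal_mul (by positivity)]
  congr 2
  ring

/-! ### One-dimensional changes of variables: arcsine law and law of cosines. -/

/-- The arcsine law: for `x = m + A cos θ` the Jacobian `|A sin θ|` equals `√(A² - (x - m)²)`.
Outside the range the square root is `0` and so is its reciprocal, which allows the integral on the
right to run over all of `ℝ`. -/
theorem lintegral_half_circle {A : ℝ} (hA : A ≠ 0) (m : ℝ) (h : ℝ → ℝ≥0∞) :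
    ∫⁻ θ in Ioo 0 π, h (m + A * Real.cos θ)
      = ∫⁻ x, ENNReal.ofReal (1 / √(A ^ 2 - (x - m) ^ 2)) * h x := by
  have himg : (fun θ => m + A * Real.cos θ) '' Ioo 0 π = {x | 0 < A ^ 2 - (x - m) ^ 2} := by
    ext x
    simp only [mem_image, mem_ofPred_eq]
    constructor
    · rintro ⟨θ, hθ, rfl⟩
      have h1 : 0 < (A * Real.sin θ) ^ 2 :=
        sq_pos_of_ne_zero (mul_ne_zero hA (Real.sin_pos_of_mem_Ioo hθ).ne')
      have h2 := Real.sin_sq_add_cos_sq θ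
      have h3 : A ^ 2 - (m + A * Real.cos θ - m) ^ 2 = (A * Real.sin θ) ^ 2 := by
        linear_combination (-A ^ 2) * h2
      rw [h3]
      exact h1
    · intro hx
      have h1 : |(x - m) / A| < 1 := by
        rw [← sq_lt_one_iff_abs_lt_one, div_pow, div_lt_one (by positivity)]
        linarith
      obtain ⟨h2, h3⟩ := abs_lt.1 h1
      refine ⟨Real.arccos ((x - m) / A), ⟨Real.arccos_pos.2 h3, Real.arccos_lt_pi.2 h2⟩, ?_⟩
      rw [Real.cos_arccos h2.le h3.le]
      field_simp
      ring
  have hmeas : MeasurableSet {x : ℝ | 0 < A ^ 2 - (x - m) ^ 2} :=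
    measurableSet_lt measurable_const (by fun_prop)
  have hr : ∫⁻ x, ENNReal.ofReal (1 / √(A ^ 2 - (x - m) ^ 2)) * h x
      = ∫⁻ x in {x | 0 < A ^ 2 - (x - m) ^ 2}, ENNReal.ofReal (1 / √(A ^ 2 - (x - m) ^ 2)) * h x := by
    rw [← lintegral_indicator hmeas]
    refine lintegral_congr fun x => ?_
    by_cases hx : 0 < A ^ 2 - (x - m) ^ 2
    · rw [indicator_of_mem (show x ∈ {x : ℝ | 0 < A ^ 2 - (x - m) ^ 2} from hx)]
    · rw [indicator_of_notMem (show x ∉ {x : ℝ | 0 < A ^ 2 - (x - m) ^ 2} from hx),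
        Real.sqrt_eq_zero_of_nonpos (not_lt.1 hx)]
      simp
  rw [hr, ← himg, lintegral_image_eq_lintegral_abs_deriv_mul measurableSet_Ioo
    (fun x _ => (((Real.hasDerivAt_cos x).const_mul A).const_add m).hasDerivWithinAt)]
  · refine setLIntegral_congr_fun measurableSet_Ioo fun θ hθ => ?_
    have h1 : 0 < |A * Real.sin θ| :=
      abs_pos.2 (mul_ne_zero hA (Real.sin_pos_of_mem_Ioo hθ).ne')
    have h2 := Real.sin_sq_add_cos_sq θ
    have h3 : A ^ 2 - (m + A * Real.cos θ - m) ^ 2 = (A * Real.sin θ) ^ 2 := by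
      linear_combination (-A ^ 2) * h2
    rw [← mul_assoc, h3, Real.sqrt_sq_eq_abs, mul_neg, abs_neg, ← ENNReal.ofReal_mul h1.le,
      mul_one_div_cancel h1.ne', ENNReal.ofReal_one, one_mul]
  · intro a ha b hb hab
    refine Real.injOn_cos (Ioo_subset_Icc_self ha) (Ioo_subset_Icc_self hb) ?_
    exact mul_left_cancel₀ hA (add_left_cancel hab)

theorem lintegral_circle {A : ℝ} (hA : A ≠ 0) (m : ℝ) (h : ℝ → ℝ≥0∞) :
    ∫⁻ θ in Ioc 0 (2 * π), h (m + A * Real.cos θ)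
      = ∫⁻ x, ENNReal.ofReal (2 / √(A ^ 2 - (x - m) ^ 2)) * h x := by
  have hπ := Real.pi_pos
  have h1 : ∫⁻ θ in Ioc 0 π, h (m + A * Real.cos θ)
      = ∫⁻ x, ENNReal.ofReal (1 / √(A ^ 2 - (x - m) ^ 2)) * h x := by
    rw [← lintegral_half_circle hA, setLIntegral_congr Ioo_ae_eq_Ioc]
  have h2 : ∫⁻ θ in Ioc π (2 * π), h (m + A * Real.cos θ)
      = ∫⁻ x, ENNReal.ofReal (1 / √(A ^ 2 - (x - m) ^ 2)) * h x := by
    -- Translation by `π` changes the sign of the cosine, so the second half circle is the first one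
    -- with amplitude `-A`.
    have e := lintegral_half_circle (neg_ne_zero.2 hA) m h
    rw [neg_sq] at e
    rw [← e, setLIntegral_congr (Ioo_ae_eq_Ioc (a := π) (b := 2 * π)).symm]
    have himg : (fun θ => θ + π) '' Ioo 0 π = Ioo π (2 * π) := by
      rw [image_add_const_Ioo]
      congr 1 <;> ring
    rw [← himg, lintegral_image_eq_lintegral_abs_deriv_mul measurableSet_Ioo
      (fun x _ => ((hasDerivAt_id' x).add_const π).hasDerivWithinAt)
      (add_left_injective π).injOn]
    refine setLIntegral_congr_fun measurableSet_Ioo fun θ _ => ?_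
    simp [Real.cos_add_pi]
  rw [← Ioc_union_Ioc_eq_Ioc hπ.le (by linarith), lintegral_union measurableSet_Ioc
    (Ioc_disjoint_Ioc_of_le le_rfl), h1, h2, ← two_mul,
    ← lintegral_const_mul' _ _ (by simp)]
  refine lintegral_congr fun x => ?_
  rw [← mul_assoc, show (2 : ℝ≥0∞) = ENNReal.ofReal 2 by simp, ← ENNReal.ofReal_mul (by simp)]
  congr 2
  ring

theorem lintegral_Ioi_sq (g : ℝ → ℝ≥0∞) :
    ∫⁻ x in Ioi (0 : ℝ), g x = ∫⁻ u in Ioi (0 : ℝ), ENNReal.ofReal (2 * u) * g (u ^ 2) := by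
  have himg : (fun u : ℝ => u ^ 2) '' Ioi 0 = Ioi 0 := by
    ext x
    constructor
    · rintro ⟨u, hu, rfl⟩
      exact pow_pos (show 0 < u from hu) 2
    · intro hx
      exact ⟨√x, Real.sqrt_pos.2 hx, Real.sq_sqrt (le_of_lt hx)⟩
  conv_lhs => rw [← himg]
  rw [lintegral_image_eq_lintegral_abs_deriv_mul measurableSet_Ioi
    (fun x _ => (hasDerivAt_pow 2 x).hasDerivWithinAt)]
  · refine setLIntegral_congr_fun measurableSet_Ioi fun u hu => ?_
    have : (0 : ℝ) < u := hu
    simp [abs_of_pos this]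
  · intro a ha b hb hab
    exact (pow_left_inj₀ (le_of_lt ha) (le_of_lt hb) two_ne_zero).1 hab

/-- By the law of cosines, `s` is the third side of a triangle with sides `√x`, `√y` enclosing an
angle of cosine `t`, and `√(xy) dt = -s ds`. -/
theorem lintegral_comp_chord {x y : ℝ} (hx : 0 < x) (hy : 0 < y) (f : ℝ → ℝ≥0∞) :
    ∫⁻ t in Ioo (-1 : ℝ) 1, f t
      = ∫⁻ s in Ioo |√x - √y| (√x + √y), ENNReal.ofReal (s / √(x * y)) *
          f ((x + y - s ^ 2) / (2 * √(x * y))) := by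
  have hx' := Real.sqrt_pos.2 hx
  have hy' := Real.sqrt_pos.2 hy
  have ex := Real.sq_sqrt hx.le
  have ey := Real.sq_sqrt hy.le
  have hxy : √(x * y) = √x * √y := Real.sqrt_mul hx.le y
  rw [hxy]
  have hp : 0 < √x * √y := mul_pos hx' hy'
  have himg : (fun s : ℝ => (x + y - s ^ 2) / (2 * (√x * √y))) '' Ioo |√x - √y| (√x + √y)
      = Ioo (-1) 1 := by
    ext t
    simp only [mem_image, mem_Ioo]
    constructor
    · rintro ⟨s, ⟨h1, h2⟩, rfl⟩
      have h0 : 0 < s := (abs_nonneg _).trans_lt h1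
      have h3 : s ^ 2 < (√x + √y) ^ 2 := by gcongr
      have h4 : (√x - √y) ^ 2 < s ^ 2 := by rw [← sq_abs (√x - √y)]; gcongr
      rw [lt_div_iff₀ (by positivity), div_lt_iff₀ (by positivity)]
      constructor <;> nlinarith
    · rintro ⟨h1, h2⟩
      refine ⟨√(x + y - 2 * (√x * √y) * t), ⟨?_, ?_⟩, ?_⟩
      · apply Real.lt_sqrt_of_sq_lt
        rw [sq_abs]
        nlinarith
      · rw [Real.sqrt_lt' (by positivity)]
        nlinarith
      · rw [Real.sq_sqrt (by nlinarith [sq_nonneg (√x - √y)])]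
        field_simp
        ring
  have hd : ∀ s : ℝ, HasDerivAt (fun s : ℝ => (x + y - s ^ 2) / (2 * (√x * √y)))
      (-(s / (√x * √y))) s := fun s => by
    have h := (((hasDerivAt_pow 2 s).const_sub (x + y)).div_const (2 * (√x * √y)))
    refine h.congr_deriv ?_
    simp
    field_simp
  rw [← himg, lintegral_image_eq_lintegral_abs_deriv_mul measurableSet_Ioo
    (fun s _ => (hd s).hasDerivWithinAt)]
  · refine setLIntegral_congr_fun measurableSet_Ioo fun s hs => ?_
    have h0 : 0 < s := (abs_nonneg _).trans_lt hs.1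
    rw [abs_neg, abs_of_pos (div_pos h0 hp)]
  · intro a ha b hb hab
    have ha0 : 0 < a := (abs_nonneg _).trans_lt ha.1
    have hb0 : 0 < b := (abs_nonneg _).trans_lt hb.1
    have h1 := (div_left_inj' (by positivity)).1 hab
    exact (pow_left_inj₀ ha0.le hb0.le two_ne_zero).1 (by linarith)

/-! ### The collision discriminant and the transfer variables `s`, `u`. -/

/-- The discriminant of the collision geometry: sixteen times the squared area factor relating
the transferred speeds `s`, `u` to the energies `x`, `y`, `z`. -/
def collisionDisc (s u x y z : ℝ) : ℝ :=
  4 * x * s ^ 2 * u ^ 2 - s ^ 2 * (u ^ 2 + x - z) ^ 2 - u ^ 2 * (s ^ 2 + x - y) ^ 2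

/-- This symmetry is what puts both orderings of the cubic weight over one common density. -/
theorem collisionDisc_swap (s u x y z : ℝ) :
    collisionDisc u s x z y = collisionDisc s u x y z := by
  unfold collisionDisc; ring

/-- The discriminant can be written in two ways as `u²` times a Heron expression minus a square,
once with `x` and once with `z`; if it is positive, both Heron expressions are. -/
theorem collisionDisc_pos_imp {s u x y z : ℝ} (h : 0 < collisionDisc s u x y z) :
    (x - y + s ^ 2) ^ 2 < 4 * s ^ 2 * x ∧ (x - y + s ^ 2) ^ 2 < 4 * s ^ 2 * z := by
  have h1 : collisionDisc s u x y z
      = u ^ 2 * (4 * s ^ 2 * x - (x - y + s ^ 2) ^ 2) - (s * (u ^ 2 + x - z)) ^ 2 := by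
    unfold collisionDisc; ring
  have h2 : collisionDisc s u x y z
      = u ^ 2 * (4 * s ^ 2 * z - (x - y + s ^ 2) ^ 2) - (s * (u ^ 2 + z - x)) ^ 2 := by
    unfold collisionDisc; ring
  constructor
  · by_contra hc
    have := mul_nonneg (sq_nonneg u) (sub_nonneg.2 (not_lt.1 hc))
    nlinarith [sq_nonneg (s * (u ^ 2 + x - z))]
  · by_contra hc
    have := mul_nonneg (sq_nonneg u) (sub_nonneg.2 (not_lt.1 hc))
    nlinarith [sq_nonneg (s * (u ^ 2 + z - x))]

/-- Heron's factorization into `s + p + q` and the three triangle defects. The pairwise sums of the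
defects are `2p`, `2q`, `2s`, so no two of them are negative, and a positive product forces all
three to be positive. -/
theorem heron_pos_iff {p q s : ℝ} (hp : 0 ≤ p) (hq : 0 ≤ q) (hs : 0 < s) :
    (p ^ 2 - q ^ 2 + s ^ 2) ^ 2 < 4 * s ^ 2 * p ^ 2 ↔ |p - q| < s ∧ s < p + q := by
  have hf : 4 * s ^ 2 * p ^ 2 - (p ^ 2 - q ^ 2 + s ^ 2) ^ 2
      = (q + p - s) * ((s + q - p) * (s + p - q)) * (s + p + q) := by ring
  have hpos : 0 < s + p + q := by linarith
  rw [← sub_pos, hf, abs_lt]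
  constructor
  · intro h
    have h1 := (mul_pos_iff_of_pos_right hpos).1 h
    have hA : 0 < s + q - p := by
      by_contra hc
      have h2 : 0 < s + p - q := by linarith
      have h3 : 0 ≤ q + p - s ∨ q + p - s < 0 := le_or_gt _ _
      rcases h3 with h3 | h3
      · exact absurd h1 (not_lt.2 (mul_nonpos_of_nonneg_of_nonpos h3
          (mul_nonpos_of_nonpos_of_nonneg (not_lt.1 hc) h2.le)))
      · linarith
    have hB : 0 < s + p - q := by
      by_contra hc
      have h3 : 0 ≤ q + p - s ∨ q + p - s < 0 := le_or_gt _ _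
      rcases h3 with h3 | h3
      · exact absurd h1 (not_lt.2 (mul_nonpos_of_nonneg_of_nonpos h3
          (mul_nonpos_of_nonneg_of_nonpos hA.le (not_lt.1 hc))))
      · linarith
    have hC := (mul_pos_iff_of_pos_right (mul_pos hA hB)).1 h1
    exact ⟨⟨by linarith, by linarith⟩, by linarith⟩
  · rintro ⟨⟨h1, h2⟩, h3⟩
    exact mul_pos (mul_pos (by linarith) (mul_pos (by linarith) (by linarith))) hpos

/-- The range expresses that `(√x, √y, s)` and `(√z, √x_*, s)` are sides of nondegenerate triangles.
Energy conservation gives `z - x_* = x - y`, so the same quadratic in `s` appears in both Heron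
conditions. -/
theorem mem_transfer_range_iff {x y z s : ℝ} (hx : 0 ≤ x) (hy : 0 ≤ y) (hz : 0 ≤ z)
    (hxyz : x ≤ y + z) :
    s ∈ Ioo (max |√x - √y| |√(xStar x y z) - √z|) (min (√x + √y) (√(xStar x y z) + √z)) ↔
      0 < s ∧ (x - y + s ^ 2) ^ 2 < 4 * s ^ 2 * x ∧ (x - y + s ^ 2) ^ 2 < 4 * s ^ 2 * z := by
  have hxs : xStar x y z = y + z - x := max_eq_left (by linarith)
  have hx0 : 0 ≤ y + z - x := by linarith
  rw [hxs, mem_Ioo, max_lt_iff, lt_min_iff]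
  have e1 : 0 < s → ((x - y + s ^ 2) ^ 2 < 4 * s ^ 2 * x ↔ |√x - √y| < s ∧ s < √x + √y) := by
    intro hs
    rw [← heron_pos_iff (Real.sqrt_nonneg x) (Real.sqrt_nonneg y) hs, Real.sq_sqrt hx,
      Real.sq_sqrt hy]
  have e2 : 0 < s → ((x - y + s ^ 2) ^ 2 < 4 * s ^ 2 * z ↔
      |√(y + z - x) - √z| < s ∧ s < √(y + z - x) + √z) := by
    intro hs
    rw [abs_sub_comm, add_comm √(y + z - x), ← heron_pos_iff (Real.sqrt_nonneg z)
      (Real.sqrt_nonneg (y + z - x)) hs, Real.sq_sqrt hz, Real.sq_sqrt hx0]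
    rw [show z - (y + z - x) + s ^ 2 = x - y + s ^ 2 by ring]
  constructor
  · rintro ⟨⟨h1, h2⟩, h3, h4⟩
    have hs : 0 < s := (abs_nonneg _).trans_lt h1
    exact ⟨hs, (e1 hs).2 ⟨h1, h3⟩, (e2 hs).2 ⟨h2, h4⟩⟩
  · rintro ⟨hs, h1, h2⟩
    have h1' := (e1 hs).1 h1
    have h2' := (e2 hs).1 h2
    exact ⟨⟨h1'.1, h2'.1⟩, h1'.2, h2'.2⟩

theorem polarNorm_eq_sqrt (a b θ : ℝ) :
    polarNorm a b θ = √(a ^ 2 + b ^ 2 + 2 * a * b * Real.cos θ) := by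
  unfold polarNorm
  rw [Complex.norm_def, Complex.normSq_apply]
  congr 1
  rw [mul_comm Complex.I, Complex.exp_mul_I]
  simp [← Complex.ofReal_cos, ← Complex.ofReal_sin]
  linear_combination b ^ 2 * Real.sin_sq_add_cos_sq θ

theorem polarNorm_nonneg (a b θ : ℝ) : 0 ≤ polarNorm a b θ := norm_nonneg _

theorem polarNorm_comm (a b θ : ℝ) : polarNorm a b θ = polarNorm b a θ := by
  rw [polarNorm_eq_sqrt, polarNorm_eq_sqrt]
  congr 1
  ring

theorem YStar_nonneg (x y z s θ : ℝ) : 0 ≤ YStar x y z s θ := by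
  unfold YStar
  split_ifs
  exacts [polarNorm_nonneg _ _ _, le_rfl]

/-- The square of `YStar` is affine in `cos θ`, so it follows an arcsine law; the substitution `v =
u²` then gives the density in `u`. The constant `4` is the `2` of the full circle times the `2` of
`dv = 2u du`, and `s` enters because `√D` is `s` times the arcsine root. -/
theorem lintegral_YStar {x y z s : ℝ} (hs : 0 < s) (h1 : (x - y + s ^ 2) ^ 2 < 4 * s ^ 2 * x)
    (h2 : (x - y + s ^ 2) ^ 2 < 4 * s ^ 2 * z) (H : ℝ → ℝ≥0∞) :
    ∫⁻ θ in Ioc 0 (2 * π), H (YStar x y z s θ)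
      = ∫⁻ u in Ioi (0 : ℝ), ENNReal.ofReal (4 * (s * u) / √(collisionDisc s u x y z)) * H u := by
  set q := (x - y + s ^ 2) ^ 2 / (4 * s ^ 2) with hq
  have hq' : 4 * s ^ 2 * q = (x - y + s ^ 2) ^ 2 := by rw [hq]; field_simp
  have hqx : 0 < x - q := by
    rw [sub_pos, hq, div_lt_iff₀ (by positivity)]; linarith
  have hqz : 0 < z - q := by
    rw [sub_pos, hq, div_lt_iff₀ (by positivity)]; linarith
  have ha := Real.sqrt_pos.2 hqz
  have hb := Real.sqrt_pos.2 hqx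
  have ha2 := Real.sq_sqrt hqz.le
  have hb2 := Real.sq_sqrt hqx.le
  set a := √(z - q)
  set b := √(x - q)
  have hY : ∀ θ, YStar x y z s θ = √((z - q + (x - q)) + (2 * a * b) * Real.cos θ) := fun θ => by
    rw [YStar, if_pos hs, ← hq, max_eq_left hqz.le, max_eq_left hqx.le, polarNorm_eq_sqrt, ha2, hb2]
  simp_rw [hY]
  have hA : 2 * a * b ≠ 0 := by positivity
  rw [lintegral_circle hA (z - q + (x - q)) (fun v => H (√v))]
  have hD : ∀ v, (2 * a * b) ^ 2 - (v - (z - q + (x - q))) ^ 2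
      = 4 * (z - q) * (x - q) - (v - (z - q + (x - q))) ^ 2 := fun v => by
    rw [← ha2, ← hb2]; ring
  simp_rw [hD]
  -- For `v ≤ 0` the radicand is at most `-((z - q) - (x - q))²`, so nothing is lost by restricting
  -- to positive `v`.
  have hI : ∫⁻ v, ENNReal.ofReal (2 / √(4 * (z - q) * (x - q) - (v - (z - q + (x - q))) ^ 2)) * H √v
      = ∫⁻ v in Ioi (0 : ℝ),
        ENNReal.ofReal (2 / √(4 * (z - q) * (x - q) - (v - (z - q + (x - q))) ^ 2)) * H √v := by
    rw [← lintegral_indicator measurableSet_Ioi]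
    refine lintegral_congr fun v => ?_
    by_cases hv : v ∈ Ioi (0 : ℝ)
    · rw [indicator_of_mem hv]
    · have hv' : v ≤ 0 := not_lt.1 hv
      rw [indicator_of_notMem hv, Real.sqrt_eq_zero_of_nonpos]
      · simp
      · nlinarith [sq_nonneg (z - q - (x - q)), mul_nonneg (neg_nonneg.2 hv') (add_pos hqz hqx).le,
          sq_nonneg v]
  rw [hI, lintegral_Ioi_sq]
  refine setLIntegral_congr_fun measurableSet_Ioi fun u hu => ?_
  have hu' : 0 < u := hu
  rw [← mul_assoc, ← ENNReal.ofReal_mul (by positivity), Real.sqrt_sq hu'.le]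
  congr 2
  have hE : collisionDisc s u x y z
      = s ^ 2 * (4 * (z - q) * (x - q) - (u ^ 2 - (z - q + (x - q))) ^ 2) := by
    unfold collisionDisc
    linear_combination u ^ 2 * hq'
  rw [hE, Real.sqrt_mul (by positivity), Real.sqrt_sq hs.le]
  rw [mul_div_assoc', mul_comm s, mul_comm s, ← mul_assoc, mul_div_mul_right _ _ hs.ne']
  ring_nf

/-- Outside the admissible range of `s` the discriminant is nonpositive for every `u`, so the
density vanishes and the limits of integration can be dropped. -/
theorem lintegral_transfer {x y z : ℝ} (hx : 0 ≤ x) (hy : 0 ≤ y) (hz : 0 ≤ z) (hxyz : x ≤ y + z)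
    (H : ℝ → ℝ → ℝ≥0∞) :
    ∫⁻ s in Ioo (max |√x - √y| |√(xStar x y z) - √z|) (min (√x + √y) (√(xStar x y z) + √z)),
        ∫⁻ θ in Ioc 0 (2 * π), H s (YStar x y z s θ)
      = ∫⁻ s in Ioi (0 : ℝ), ∫⁻ u in Ioi (0 : ℝ),
        ENNReal.ofReal (4 * (s * u) / √(collisionDisc s u x y z)) * H s u := by
  rw [← lintegral_indicator measurableSet_Ioo, ← lintegral_indicator measurableSet_Ioi]
  refine lintegral_congr fun s => ?_
  have hiff := mem_transfer_range_iff (s := s) hx hy hz hxyz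
  by_cases hs : s ∈ Ioo (max |√x - √y| |√(xStar x y z) - √z|)
      (min (√x + √y) (√(xStar x y z) + √z))
  · obtain ⟨h0, h1, h2⟩ := hiff.1 hs
    rw [indicator_of_mem hs, indicator_of_mem (show s ∈ Ioi (0 : ℝ) from h0),
      lintegral_YStar h0 h1 h2]
  · rw [indicator_of_notMem hs]
    by_cases h0 : s ∈ Ioi (0 : ℝ)
    · rw [indicator_of_mem h0]
      symm
      refine (setLIntegral_congr_fun measurableSet_Ioi fun u _ => ?_).trans lintegral_zero
      have : ¬ 0 < collisionDisc s u x y z := fun h =>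
        hs (hiff.2 ⟨h0, collisionDisc_pos_imp h⟩)
      rw [Real.sqrt_eq_zero_of_nonpos (not_lt.1 this)]
      simp
    · rw [indicator_of_notMem h0]

/-! ### The weight `W` as an integral over transfer variables. -/

/-- A kernel factor extended to the whole plane, with an explicit bound. -/
structure IsGlobalFactor (Φ : ℝ → ℝ → ℝ) (C : ℝ) : Prop where
  continuous : Continuous (Function.uncurry Φ)
  nonneg : ∀ r ρ : ℝ, 0 ≤ Φ r ρ
  le : ∀ r ρ : ℝ, Φ r ρ ≤ C
  symm : ∀ r ρ : ℝ, Φ r ρ = Φ ρ r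

theorem IsGlobalFactor.bound_nonneg {Φ : ℝ → ℝ → ℝ} {C : ℝ} (h : IsGlobalFactor Φ C) : 0 ≤ C :=
  (h.nonneg 0 0).trans (h.le 0 0)

theorem IsGlobalFactor.measurable_comp {Φ : ℝ → ℝ → ℝ} {C : ℝ} (h : IsGlobalFactor Φ C)
    {α : Type*} [MeasurableSpace α] {f g : α → ℝ} (hf : Measurable f) (hg : Measurable g) :
    Measurable fun a => Φ (f a) (g a) :=
  h.continuous.measurable.comp (hf.prodMk hg)

theorem measurable_polarNorm_comp {α : Type*} [MeasurableSpace α] {a b θ : α → ℝ}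
    (ha : Measurable a) (hb : Measurable b) (hθ : Measurable θ) :
    Measurable fun p => polarNorm (a p) (b p) (θ p) := by
  simp_rw [polarNorm_eq_sqrt]
  fun_prop

theorem measurable_YStar_comp {α : Type*} [MeasurableSpace α] {x y z s θ : α → ℝ}
    (hx : Measurable x) (hy : Measurable y) (hz : Measurable z) (hs : Measurable s)
    (hθ : Measurable θ) :
    Measurable fun p => YStar (x p) (y p) (z p) (s p) (θ p) := by
  unfold YStar
  refine Measurable.ite (measurableSet_lt measurable_const hs)
    (measurable_polarNorm_comp ?_ ?_ hθ) measurable_const <;> fun_prop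

/-- Ensures that the oriented integral defining `W` is an ordinary one. Only the mixed inequalities
use energy conservation: if `a² + d² = b² + c²`, then `a > b + c + d` is impossible. -/
theorem transfer_range_le {x y z : ℝ} (hx : 0 ≤ x) (hy : 0 ≤ y) (hz : 0 ≤ z) (hxyz : x ≤ y + z) :
    max |√x - √y| |√(xStar x y z) - √z| ≤ min (√x + √y) (√(xStar x y z) + √z) := by
  have hxs : xStar x y z = y + z - x := max_eq_left (by linarith)
  rw [hxs]
  have e1 := Real.sq_sqrt hx
  have e2 := Real.sq_sqrt hy
  have e3 := Real.sq_sqrt hz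
  have e4 := Real.sq_sqrt (show 0 ≤ y + z - x by linarith)
  have p1 := Real.sqrt_nonneg x
  have p2 := Real.sqrt_nonneg y
  have p3 := Real.sqrt_nonneg z
  have p4 := Real.sqrt_nonneg (y + z - x)
  set a := √x
  set b := √y
  set c := √z
  set d := √(y + z - x)
  have key : ∀ a b c d : ℝ, 0 ≤ a → 0 ≤ b → 0 ≤ c → 0 ≤ d → a ^ 2 + d ^ 2 = b ^ 2 + c ^ 2 →
      a - b ≤ d + c := by
    intro a b c d ha hb hc hd h
    by_contra hcon
    nlinarith [mul_nonneg hb hc, mul_nonneg hb hd, mul_nonneg hc hd]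
  have hsum : a ^ 2 + d ^ 2 = b ^ 2 + c ^ 2 := by linarith
  refine max_le (le_min ?_ ?_) (le_min ?_ ?_)
  · exact abs_le.2 ⟨by linarith, by linarith⟩
  · exact abs_le.2 ⟨by linarith [key b a d c p2 p1 p4 p3 (by linarith)], key a b c d p1 p2 p3 p4 hsum⟩
  · exact abs_le.2 ⟨by linarith [key c d a b p3 p4 p1 p2 (by linarith)],
      by linarith [key d c b a p4 p3 p2 p1 (by linarith)]⟩
  · exact abs_le.2 ⟨by linarith, by linarith⟩

/-- The integral of `Φ` over the collision parameters `s`, `u`, up to normalization. -/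
def transferMass (Φ : ℝ → ℝ → ℝ) (x y z : ℝ) : ℝ≥0∞ :=
  ∫⁻ s in Ioi (0 : ℝ), ∫⁻ u in Ioi (0 : ℝ),
    ENNReal.ofReal (4 * (s * u) / √(collisionDisc s u x y z)) *
      ENNReal.ofReal (Φ (√2 * s) (√2 * u))

theorem transferIntegrand_measurable {Φ : ℝ → ℝ → ℝ} {C : ℝ} (h : IsGlobalFactor Φ C)
    (x y z : ℝ) :
    Measurable fun p : ℝ × ℝ => Φ (√2 * p.1) (√2 * YStar x y z p.1 p.2) :=
  h.measurable_comp (by fun_prop) ((measurable_YStar_comp measurable_const measurable_const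
    measurable_const measurable_fst measurable_snd).const_mul _)

theorem ofReal_integral_prod_of_bound {α β : Type*} [MeasurableSpace α] [MeasurableSpace β]
    {μ : Measure α} {ν : Measure β} [IsFiniteMeasure μ] [IsFiniteMeasure ν] {f : α → β → ℝ}
    (hf : Measurable (Function.uncurry f)) {C : ℝ} (h0 : ∀ a b, 0 ≤ f a b)
    (hC : ∀ a b, f a b ≤ C) :
    ENNReal.ofReal (∫ a, ∫ b, f a b ∂ν ∂μ) = ∫⁻ a, ∫⁻ b, ENNReal.ofReal (f a b) ∂ν ∂μ := by
  have hi : Integrable (Function.uncurry f) (μ.prod ν) :=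
    Integrable.of_bound hf.aestronglyMeasurable C (ae_of_all _ fun p => by
      rw [Real.norm_of_nonneg (show 0 ≤ Function.uncurry f p from h0 _ _)]; exact hC _ _)
  have e1 := integral_prod _ hi
  have e2 := lintegral_prod (μ := μ) (ν := ν) (fun p => ENNReal.ofReal (Function.uncurry f p))
    hf.ennreal_ofReal.aemeasurable
  simp only [Function.uncurry_apply_pair] at e1 e2
  rw [← e1, ← e2, ofReal_integral_eq_lintegral_ofReal hi (ae_of_all _ fun p => h0 _ _)]

theorem ofReal_W {Φ : ℝ → ℝ → ℝ} {C : ℝ} (h : IsGlobalFactor Φ C) {x y z : ℝ} (hx : 0 < x)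
    (hy : 0 < y) (hz : 0 < z) (hxyz : x < y + z) :
    ENNReal.ofReal (W Φ x y z)
      = ENNReal.ofReal (1 / (4 * π * √(x * y * z))) * transferMass Φ x y z := by
  have hxs : xStar x y z = y + z - x := max_eq_left (by linarith)
  have hpos : 0 < xStar x y z * x * y * z := by
    rw [hxs]; have : 0 < y + z - x := by linarith
    positivity
  rw [W, if_pos hpos, ENNReal.ofReal_mul (by positivity)]
  congr 1
  rw [intervalIntegral.integral_of_le (transfer_range_le hx.le hy.le hz.le hxyz.le)]
  simp_rw [intervalIntegral.integral_of_le (show (0 : ℝ) ≤ 2 * π by positivity)]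
  rw [ofReal_integral_prod_of_bound (transferIntegrand_measurable h x y z)
    (fun _ _ => h.nonneg _ _) (fun _ _ => h.le _ _), transferMass,
    ← lintegral_transfer hx.le hy.le hz.le hxyz.le
      (fun s u => ENNReal.ofReal (Φ (√2 * s) (√2 * u))),
    setLIntegral_congr Ioo_ae_eq_Ioc]

theorem W_nonneg {Φ : ℝ → ℝ → ℝ} {C : ℝ} (h : IsGlobalFactor Φ C) {x y z : ℝ} (hx : 0 ≤ x)
    (hy : 0 ≤ y) (hz : 0 ≤ z) : 0 ≤ W Φ x y z := by
  unfold W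
  split_ifs with h1 h2 h3 h4
  · have hle : x ≤ y + z := by
      by_contra hc
      have : xStar x y z = 0 := max_eq_right (by linarith)
      simp [this] at h1
    refine mul_nonneg (by positivity) (intervalIntegral.integral_nonneg
      (transfer_range_le hx hy hz hle) fun s _ => ?_)
    exact intervalIntegral.integral_nonneg (by positivity) fun θ _ => h.nonneg _ _
  · exact mul_nonneg (by positivity) (h.nonneg _ _)
  · exact mul_nonneg (by positivity) (h.nonneg _ _)
  · exact mul_nonneg (by positivity) (h.nonneg _ _)
  · exact le_rfl

/-- Symmetry of the weight under exchange of the two incoming and the two outgoing energies. -/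
theorem sqrt_mul_W_reflect (Φ : ℝ → ℝ → ℝ) {x y z : ℝ}
    (hx : 0 < x) (hy : 0 ≤ y) (hz : 0 ≤ z) (hxyz : x < y + z) :
    √(y + z - x) * W Φ (y + z - x) z y = √x * W Φ x y z := by
  have hs : 0 < y + z - x := by linarith
  have hxs : xStar x y z = y + z - x := max_eq_left hs.le
  have hxs' : xStar (y + z - x) z y = x := by
    unfold xStar; rw [max_eq_left (by linarith)]; ring
  rcases hy.eq_or_lt with rfl | hy'
  · have hz' : 0 < z := by linarith
    have h1 : x < z := by linarith
    have h2 : √x ≠ 0 := (Real.sqrt_pos.2 hx).ne'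
    have h3 : √(z - x) ≠ 0 := (Real.sqrt_pos.2 (by linarith)).ne'
    have h4 : √z ≠ 0 := (Real.sqrt_pos.2 hz').ne'
    simp only [W, hxs, hxs']
    simp only [mul_zero, zero_mul, lt_irrefl, if_false, zero_add, hx.ne', false_and, hx, h1,
      hz'.ne', true_and, if_true, and_self, sub_pos, sub_eq_zero, sub_lt_self_iff, h1.ne']
    rw [Real.sqrt_mul hx.le, Real.sqrt_mul (by linarith), show z - (z - x) = x by ring]
    field_simp
  rcases hz.eq_or_lt with rfl | hz'
  · have h1 : x < y := by linarith
    have h2 : √x ≠ 0 := (Real.sqrt_pos.2 hx).ne'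
    have h3 : √(y - x) ≠ 0 := (Real.sqrt_pos.2 (by linarith)).ne'
    have h4 : √y ≠ 0 := (Real.sqrt_pos.2 hy').ne'
    simp only [W, hxs, hxs']
    simp only [mul_zero, zero_mul, lt_irrefl, if_false, add_zero, hx.ne', false_and, hx, h1,
      hy'.ne', true_and, if_true, and_self, sub_pos, sub_eq_zero, sub_lt_self_iff, h1.ne',
      and_false]
    rw [Real.sqrt_mul hx.le, Real.sqrt_mul (by linarith), show y - (y - x) = x by ring]
    field_simp
  have p1 : 0 < xStar x y z * x * y * z := by rw [hxs]; positivity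
  have p2 : 0 < xStar (y + z - x) z y * (y + z - x) * z * y := by rw [hxs']; positivity
  rw [W, W, if_pos p1, if_pos p2, hxs, hxs']
  -- The reflection interchanges the two radicands of `YStar`, and `polarNorm` is symmetric in its
  -- two lengths. The two pairs of limits are interchanged as well, which `max` and `min` do not
  -- see.
  have hI : ∀ s θ, YStar (y + z - x) z y s θ = YStar x y z s θ := fun s θ => by
    unfold YStar
    split_ifs with h0
    · rw [polarNorm_comm]
      have e1 : y - (y + z - x - z + s ^ 2) ^ 2 / (4 * s ^ 2)
          = x - (x - y + s ^ 2) ^ 2 / (4 * s ^ 2) := by field_simp; ring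
      have e2 : y + z - x - (y + z - x - z + s ^ 2) ^ 2 / (4 * s ^ 2)
          = z - (x - y + s ^ 2) ^ 2 / (4 * s ^ 2) := by field_simp; ring
      rw [e1, e2]
    · rfl
  simp_rw [hI]
  rw [max_comm, min_comm, Real.sqrt_mul (by positivity), Real.sqrt_mul (by positivity),
    Real.sqrt_mul (by positivity), Real.sqrt_mul (by positivity)]
  have h2 : √x ≠ 0 := (Real.sqrt_pos.2 hx).ne'
  have h3 : √(y + z - x) ≠ 0 := (Real.sqrt_pos.2 hs).ne'
  generalize (∫ s in (max |√x - √y| |√(y + z - x) - √z|)..(min (√x + √y) (√(y + z - x) + √z)),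
    ∫ θ in (0 : ℝ)..2 * π, Φ (√2 * s) (√2 * YStar x y z s θ)) = I
  field_simp

/-! ### Geometry, measurability and bounds of the cubic speed kernel. -/

theorem norm_S2 (σ : S2) : ‖(σ : R3)‖ = 1 := by simp

theorem XB_sq (r r' : ℝ) (σ σ' : S2) :
    XB r r' σ σ' ^ 2 = r ^ 2 + r' ^ 2 - 2 * r * r' * ⟪(σ : R3), (σ' : R3)⟫_ℝ := by
  rw [XB, @norm_sub_sq_real, norm_smul, norm_smul, norm_S2, norm_S2, inner_smul_left,
    inner_smul_right, mul_one, mul_one, Real.norm_eq_abs, Real.norm_eq_abs, sq_abs, sq_abs]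
  simp
  ring

theorem abs_sub_le_XB {r r' : ℝ} (hr : 0 ≤ r) (hr' : 0 ≤ r') (σ σ' : S2) :
    |r - r'| ≤ XB r r' σ σ' := by
  have := abs_norm_sub_norm_le (r • (σ : R3)) (r' • (σ' : R3))
  rwa [norm_smul, norm_smul, norm_S2, norm_S2, mul_one, mul_one, Real.norm_of_nonneg hr,
    Real.norm_of_nonneg hr'] at this

theorem XB_pos {r r' : ℝ} (hr : 0 ≤ r) (hr' : 0 ≤ r') (hne : r ≠ r') (σ σ' : S2) :
    0 < XB r r' σ σ' :=
  (abs_pos.2 (sub_ne_zero.2 hne)).trans_le (abs_sub_le_XB hr hr' σ σ')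

theorem inner_smul_xi {r r' : ℝ} {σ σ' : S2} (hX : 0 < XB r r' σ σ') :
    ⟪r • (σ : R3), xi r r' σ σ'⟫_ℝ
      = (r ^ 2 - r * r' * ⟪(σ : R3), (σ' : R3)⟫_ℝ) / XB r r' σ σ' := by
  have hne : r • (σ : R3) ≠ r' • (σ' : R3) := fun h => by
    rw [XB, h, sub_self, norm_zero] at hX
    exact lt_irrefl _ hX
  rw [xi, if_pos hne, inner_smul_right, inner_sub_right, real_inner_self_eq_norm_sq, norm_smul,
    norm_S2, inner_smul_left, inner_smul_right, mul_one, Real.norm_eq_abs, sq_abs]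
  simp
  ring

theorem mul_abs_inner_xi {r r' : ℝ} (hr : 0 ≤ r) (σ σ' : S2) :
    r * |⟪(σ : R3), xi r r' σ σ'⟫_ℝ| = |⟪r • (σ : R3), xi r r' σ σ'⟫_ℝ| := by
  rw [inner_smul_left, abs_mul]
  simp [abs_of_nonneg hr]

theorem measurable_XB_comp {α : Type*} [MeasurableSpace α] {r r' : α → ℝ} {σ σ' : α → S2}
    (hr : Measurable r) (hr' : Measurable r') (hσ : Measurable σ) (hσ' : Measurable σ') :
    Measurable fun p => XB (r p) (r' p) (σ p) (σ' p) := by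
  unfold XB
  have h1 : Measurable fun p => (σ p : R3) := measurable_subtype_coe.comp hσ
  have h2 : Measurable fun p => (σ' p : R3) := measurable_subtype_coe.comp hσ'
  fun_prop

theorem measurable_xi_comp {α : Type*} [MeasurableSpace α] {r r' : α → ℝ} {σ σ' : α → S2}
    (hr : Measurable r) (hr' : Measurable r') (hσ : Measurable σ) (hσ' : Measurable σ') :
    Measurable fun p => xi (r p) (r' p) (σ p) (σ' p) := by
  unfold xi
  have h1 : Measurable fun p => (σ p : R3) := measurable_subtype_coe.comp hσ
  have h2 : Measurable fun p => (σ' p : R3) := measurable_subtype_coe.comp hσ'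
  have h3 : Measurable fun p => r p • (σ p : R3) := hr.smul h1
  have h4 : Measurable fun p => r' p • (σ' p : R3) := hr'.smul h2
  exact Measurable.ite (measurableSet_eq_fun h3 h4).compl
    ((measurable_XB_comp hr hr' hσ hσ').inv.smul (h3.sub h4)) h1

theorem measurable_YB_comp {α : Type*} [MeasurableSpace α] {r r' q ϑ : α → ℝ} {σ σ' : α → S2}
    (hr : Measurable r) (hr' : Measurable r') (hq : Measurable q) (hσ : Measurable σ)
    (hσ' : Measurable σ') (hϑ : Measurable ϑ) :
    Measurable fun p => YB (r p) (r' p) (q p) (σ p) (σ' p) (ϑ p) := by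
  unfold YB
  have h1 : Measurable fun p => (σ p : R3) := measurable_subtype_coe.comp hσ
  have h2 := measurable_xi_comp hr hr' hσ hσ'
  have h3 : Measurable fun p => ⟪r p • (σ p : R3), xi (r p) (r' p) (σ p) (σ' p)⟫_ℝ :=
    (hr.smul h1).inner h2
  exact measurable_polarNorm_comp (by fun_prop) (by fun_prop) hϑ

theorem YB_nonneg (r r' q : ℝ) (σ σ' : S2) (ϑ : ℝ) : 0 ≤ YB r r' q σ σ' ϑ :=
  polarNorm_nonneg _ _ _

open Classical in
/-- The angular integrand of the cubic collision weight. -/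
def cubicIntegrand (Φ : ℝ → ℝ → ℝ) (r r' rs' : ℝ) (σ σ' : S2) (ϑ : ℝ) : ℝ :=
  if r * |⟪(σ : R3), xi r r' σ σ'⟫_ℝ| < rs' then
    Φ (XB r r' σ σ') (YB r r' rs' σ σ' ϑ) / (XB r r' σ σ' * rs' + YB r r' rs' σ σ' ϑ * r')
  else 0

/-- The weight multiplying `Δφ` in `KB`. -/
def cubicWeight (Φ : ℝ → ℝ → ℝ) (r r' rs' : ℝ) : ℝ :=
  4 / (4 * π) ^ 5 * ∫ σ : S2, ∫ σ' : S2,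
    (∫ ϑ in (0 : ℝ)..(2 * π), cubicIntegrand Φ r r' rs' σ σ' ϑ) ∂surf ∂surf

theorem KB_eq (Φ : ℝ → ℝ → ℝ) (φ : ℝ → ℝ) {r r' rs' : ℝ} (h1 : r ≠ r') (h2 : r ≠ rs') :
    KB Φ φ r r' rs'
      = cubicWeight Φ r r' rs' * Delta φ (r ^ 2 / 2) (r' ^ 2 / 2) (rs' ^ 2 / 2) := by
  have h : (r' - r) * (rs' - r) ≠ 0 := mul_ne_zero (sub_ne_zero.2 h1.symm) (sub_ne_zero.2 h2.symm)
  rw [KB, if_pos h, cubicWeight, mul_assoc]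
  congr 1
  have : ∀ σ σ' : S2, ∀ ϑ : ℝ, (if r * |⟪(σ : R3), xi r r' σ σ'⟫_ℝ| < rs' then
            Delta φ (r ^ 2 / 2) (r' ^ 2 / 2) (rs' ^ 2 / 2) /
                (XB r r' σ σ' * rs' + YB r r' rs' σ σ' ϑ * r') *
              Φ (XB r r' σ σ') (YB r r' rs' σ σ' ϑ)
          else 0) = cubicIntegrand Φ r r' rs' σ σ' ϑ *
            Delta φ (r ^ 2 / 2) (r' ^ 2 / 2) (rs' ^ 2 / 2) := fun σ σ' ϑ => by
    unfold cubicIntegrand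
    split_ifs <;> ring
  simp_rw [this, intervalIntegral.integral_mul_const, integral_mul_const]

theorem measurable_cubicIntegrand_comp {Φ : ℝ → ℝ → ℝ} {C : ℝ} (h : IsGlobalFactor Φ C)
    {α : Type*} [MeasurableSpace α] {r r' q ϑ : α → ℝ} {σ σ' : α → S2}
    (hr : Measurable r) (hr' : Measurable r') (hq : Measurable q) (hσ : Measurable σ)
    (hσ' : Measurable σ') (hϑ : Measurable ϑ) :
    Measurable fun p => cubicIntegrand Φ (r p) (r' p) (q p) (σ p) (σ' p) (ϑ p) := by
  unfold cubicIntegrand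
  have h1 : Measurable fun p => (σ p : R3) := measurable_subtype_coe.comp hσ
  have h2 := measurable_xi_comp hr hr' hσ hσ'
  have hX := measurable_XB_comp hr hr' hσ hσ'
  have hY := measurable_YB_comp hr hr' hq hσ hσ' hϑ
  have h3 : Measurable fun p => ⟪(σ p : R3), xi (r p) (r' p) (σ p) (σ' p)⟫_ℝ := h1.inner h2
  refine Measurable.ite (measurableSet_lt (hr.mul ?_) hq)
    ((h.measurable_comp hX hY).div ((hX.mul hq).add (hY.mul hr'))) measurable_const
  exact continuous_abs.measurable.comp h3

theorem cubicIntegrand_nonneg {Φ : ℝ → ℝ → ℝ} {C : ℝ} (h : IsGlobalFactor Φ C) {r r' q : ℝ}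
    (hr' : 0 ≤ r') (hq : 0 ≤ q) (σ σ' : S2) (ϑ : ℝ) : 0 ≤ cubicIntegrand Φ r r' q σ σ' ϑ := by
  unfold cubicIntegrand
  split_ifs
  · exact div_nonneg (h.nonneg _ _) (add_nonneg (mul_nonneg (norm_nonneg _) hq)
      (mul_nonneg (YB_nonneg _ _ _ _ _ _) hr'))
  · exact le_rfl

/-- The cutoff forces `q > 0`, and `X ≥ |r - r'|` bounds the denominator from below. The bound
degenerates at the diagonal and serves only to justify the angular integrals at fixed speeds. -/
theorem cubicIntegrand_le {Φ : ℝ → ℝ → ℝ} {C : ℝ} (h : IsGlobalFactor Φ C) {r r' q : ℝ}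
    (hr : 0 ≤ r) (hr' : 0 ≤ r') (hq : 0 ≤ q) (hne : r ≠ r') (σ σ' : S2) (ϑ : ℝ) :
    cubicIntegrand Φ r r' q σ σ' ϑ ≤ C / (|r - r'| * q) := by
  have hp : 0 < |r - r'| := abs_pos.2 (sub_ne_zero.2 hne)
  unfold cubicIntegrand
  split_ifs with hc
  · have hq' : 0 < q := lt_of_le_of_lt (mul_nonneg hr (abs_nonneg _)) hc
    refine div_le_div₀ h.bound_nonneg (h.le _ _) (by positivity) ?_
    have h1 := abs_sub_le_XB hr hr' σ σ'
    have h2 := mul_nonneg (YB_nonneg r r' q σ σ' ϑ) hr'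
    nlinarith
  · exact div_nonneg h.bound_nonneg (by positivity)

theorem ofReal_integral_of_bound {α : Type*} [MeasurableSpace α] {μ : Measure α}
    [IsFiniteMeasure μ] {f : α → ℝ} (hf : Measurable f) {C : ℝ} (h0 : ∀ a, 0 ≤ f a)
    (hC : ∀ a, f a ≤ C) :
    ENNReal.ofReal (∫ a, f a ∂μ) = ∫⁻ a, ENNReal.ofReal (f a) ∂μ :=
  ofReal_integral_eq_lintegral_ofReal (Integrable.of_bound hf.aestronglyMeasurable C
    (ae_of_all _ fun p => by rw [Real.norm_of_nonneg (h0 p)]; exact hC p)) (ae_of_all _ h0)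

theorem ofReal_cubicWeight {Φ : ℝ → ℝ → ℝ} {C : ℝ} (h : IsGlobalFactor Φ C) {r r' q : ℝ}
    (hr : 0 ≤ r) (hr' : 0 ≤ r') (hq : 0 ≤ q) (hne : r ≠ r') :
    ENNReal.ofReal (cubicWeight Φ r r' q) = ENNReal.ofReal (4 / (4 * π) ^ 5) *
      ∫⁻ σ, ∫⁻ σ', (∫⁻ ϑ in Ioc 0 (2 * π),
        ENNReal.ofReal (cubicIntegrand Φ r r' q σ σ' ϑ)) ∂surf ∂surf := by
  rw [cubicWeight, ENNReal.ofReal_mul (by positivity)]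
  congr 1
  have hπ : (0 : ℝ) ≤ 2 * π := by positivity
  have hm : Measurable fun p : (S2 × S2) × ℝ => cubicIntegrand Φ r r' q p.1.1 p.1.2 p.2 :=
    measurable_cubicIntegrand_comp h measurable_const measurable_const measurable_const
      (by fun_prop) (by fun_prop) (by fun_prop)
  simp_rw [intervalIntegral.integral_of_le hπ]
  rw [ofReal_integral_prod_of_bound (C := C / (|r - r'| * q) * (2 * π))]
  · refine lintegral_congr fun σ => lintegral_congr fun σ' => ?_
    exact ofReal_integral_of_bound (measurable_cubicIntegrand_comp h measurable_const
      measurable_const measurable_const measurable_const measurable_const measurable_id)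
      (cubicIntegrand_nonneg h hr' hq σ σ') (cubicIntegrand_le h hr hr' hq hne σ σ')
  · have hm' : Measurable fun p : S2 × S2 =>
        ∫ ϑ in Ioc 0 (2 * π), cubicIntegrand Φ r r' q p.1 p.2 ϑ :=
      (hm.stronglyMeasurable.integral_prod_right'
        (ν := volume.restrict (Ioc 0 (2 * π)))).measurable
    exact hm'
  · exact fun σ σ' => integral_nonneg fun ϑ => cubicIntegrand_nonneg h hr' hq σ σ' ϑ
  · intro σ σ'
    refine (le_abs_self _).trans ?_
    have := norm_setIntegral_le_of_norm_le_const (μ := volume) (s := Ioc 0 (2 * π))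
      (f := fun ϑ => cubicIntegrand Φ r r' q σ σ' ϑ) (C := C / (|r - r'| * q)) measure_Ioc_lt_top
      fun ϑ _ => by
        rw [Real.norm_of_nonneg (cubicIntegrand_nonneg h hr' hq σ σ' ϑ)]
        exact cubicIntegrand_le h hr hr' hq hne σ σ' ϑ
    simpa [measureReal_def, hπ, Real.pi_pos.le] using this

theorem cubicWeight_nonneg {Φ : ℝ → ℝ → ℝ} {C : ℝ} (h : IsGlobalFactor Φ C) {r r' q : ℝ}
    (hr' : 0 ≤ r') (hq : 0 ≤ q) : 0 ≤ cubicWeight Φ r r' q :=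
  mul_nonneg (by positivity) (integral_nonneg fun σ => integral_nonneg fun σ' =>
    intervalIntegral.integral_nonneg (by positivity) fun ϑ _ =>
      cubicIntegrand_nonneg h hr' hq σ σ' ϑ)

/-! ### The cubic weight in energy variables and its symmetrization. -/

theorem sqrt_max_zero (a : ℝ) : √(max a 0) = √a := by
  rcases le_total a 0 with h | h
  · rw [max_eq_right h, Real.sqrt_zero, Real.sqrt_eq_zero_of_nonpos h]
  · rw [max_eq_left h]

/-- The transferred speed `|v - v'| / √2` as a function of the cosine of the angle. -/
def chord (x y t : ℝ) : ℝ := √(x + y - 2 * √(x * y) * t)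

theorem measurable_chord (x y : ℝ) : Measurable (chord x y) := by unfold chord; fun_prop

theorem XB_sqrt {x y : ℝ} (hx : 0 ≤ x) (hy : 0 ≤ y) (σ σ' : S2) :
    XB √(2 * x) √(2 * y) σ σ' = √2 * chord x y ⟪(σ : R3), (σ' : R3)⟫_ℝ := by
  rw [chord, ← Real.sqrt_mul zero_le_two, ← Real.sqrt_sq (show 0 ≤ XB √(2 * x) √(2 * y) σ σ' from
    norm_nonneg _), XB_sq, Real.sq_sqrt (by positivity), Real.sq_sqrt (by positivity)]
  congr 1
  rw [mul_assoc 2, ← Real.sqrt_mul (by positivity), show 2 * x * (2 * y) = 2 ^ 2 * (x * y) by ring,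
    Real.sqrt_mul (by positivity), Real.sqrt_sq zero_le_two]
  ring

/-- The component of the velocity along the transfer direction is `(x - y + s²)/(√2 s)`, by the law
of cosines. Its square is twice the quantity subtracted under both roots of `YStar`, which links
`YB` and the cutoff to the energy variables. -/
theorem inner_xi_sq {x y : ℝ} (hx : 0 ≤ x) (hy : 0 ≤ y) (hne : x ≠ y) (σ σ' : S2) :
    0 < chord x y ⟪(σ : R3), (σ' : R3)⟫_ℝ ∧
    ⟪√(2 * x) • (σ : R3), xi √(2 * x) √(2 * y) σ σ'⟫_ℝ ^ 2
      = 2 * ((x - y + chord x y ⟪(σ : R3), (σ' : R3)⟫_ℝ ^ 2) ^ 2 /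
          (4 * chord x y ⟪(σ : R3), (σ' : R3)⟫_ℝ ^ 2)) := by
  have hne' : √(2 * x) ≠ √(2 * y) := fun h => hne (by
    have := (Real.sqrt_inj (by positivity) (by positivity)).1 h
    linarith)
  have hX := XB_pos (Real.sqrt_nonneg _) (Real.sqrt_nonneg _) hne' σ σ'
  have hXs := XB_sqrt hx hy σ σ'
  have hX2 := XB_sq √(2 * x) √(2 * y) σ σ'
  rw [inner_smul_xi hX]
  set t := ⟪(σ : R3), (σ' : R3)⟫_ℝ
  set s := chord x y t
  have h2 : (0 : ℝ) < √2 := by positivity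
  have h22 : √2 ^ 2 = (2 : ℝ) := Real.sq_sqrt zero_le_two
  have hs : 0 < s := by
    rw [hXs] at hX
    exact (mul_pos_iff_of_pos_left h2).1 hX
  refine ⟨hs, ?_⟩
  rw [hXs, Real.sq_sqrt (by positivity), Real.sq_sqrt (by positivity), mul_pow, h22] at hX2
  rw [hXs, div_pow, mul_pow, h22, Real.sq_sqrt (by positivity)]
  have hnum : 2 * x - √(2 * x) * √(2 * y) * t = x - y + s ^ 2 := by
    linear_combination (-1 / 2) * hX2
  rw [hnum]
  field_simp
  norm_num

/-- The positive parts in `YStar` are invisible to the real square root, so the two formulas agree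
without any condition on the range. -/
theorem YB_sqrt {x y z : ℝ} (hx : 0 ≤ x) (hy : 0 ≤ y) (hz : 0 ≤ z) (hne : x ≠ y) (σ σ' : S2)
    (ϑ : ℝ) :
    YB √(2 * x) √(2 * y) √(2 * z) σ σ' ϑ
      = √2 * YStar x y z (chord x y ⟪(σ : R3), (σ' : R3)⟫_ℝ) ϑ := by
  obtain ⟨hs, hi⟩ := inner_xi_sq hx hy hne σ σ'
  rw [YB, YStar, if_pos hs, hi, Real.sq_sqrt (by positivity), Real.sq_sqrt (by positivity),
    sqrt_max_zero, sqrt_max_zero, ← mul_sub, ← mul_sub, Real.sqrt_mul zero_le_two,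
    Real.sqrt_mul zero_le_two, polarNorm_eq_sqrt, polarNorm_eq_sqrt]
  generalize √(z - _) = a
  generalize √(x - _) = b
  rw [← Real.sqrt_mul zero_le_two]
  congr 1
  have h22 : √2 ^ 2 = (2 : ℝ) := Real.sq_sqrt zero_le_two
  linear_combination (a ^ 2 + b ^ 2 + 2 * a * b * Real.cos ϑ) * h22

-- The cutoff of the speed kernel turns into the triangle condition for `(√z, √x_*, s)`; the
-- condition for `(√x, √y, s)` is left to the range of the chord.
open Classical in
theorem cubicIntegrand_sqrt (Φ : ℝ → ℝ → ℝ) {x y z : ℝ} (hx : 0 ≤ x) (hy : 0 ≤ y) (hz : 0 ≤ z)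
    (hne : x ≠ y) (σ σ' : S2) (ϑ : ℝ) {s : ℝ} (hs : s = chord x y ⟪(σ : R3), (σ' : R3)⟫_ℝ) :
    cubicIntegrand Φ √(2 * x) √(2 * y) √(2 * z) σ σ' ϑ
      = if (x - y + s ^ 2) ^ 2 < 4 * s ^ 2 * z then
          Φ (√2 * s) (√2 * YStar x y z s ϑ) / (2 * (s * √z + YStar x y z s ϑ * √y)) else 0 := by
  obtain ⟨hs0, hi⟩ := inner_xi_sq hx hy hne σ σ'
  rw [cubicIntegrand, mul_abs_inner_xi (Real.sqrt_nonneg _), YB_sqrt hx hy hz hne, XB_sqrt hx hy]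
  rw [← hs] at hs0 hi ⊢
  have hiff : |⟪√(2 * x) • (σ : R3), xi √(2 * x) √(2 * y) σ σ'⟫_ℝ| < √(2 * z) ↔
      (x - y + s ^ 2) ^ 2 < 4 * s ^ 2 * z := by
    rw [Real.lt_sqrt (abs_nonneg _), sq_abs, hi, mul_lt_mul_iff_right₀ zero_lt_two,
      div_lt_iff₀ (by positivity), mul_comm z]
  simp only [hiff]
  congr 2
  rw [Real.sqrt_mul zero_le_two, Real.sqrt_mul zero_le_two]
  have h22 : √2 ^ 2 = (2 : ℝ) := Real.sq_sqrt zero_le_two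
  linear_combination (s * √z + YStar x y z s ϑ * √y) * h22

theorem chord_comp {x y : ℝ} (hx : 0 < x) (hy : 0 < y) {s : ℝ} (hs : 0 ≤ s) :
    chord x y ((x + y - s ^ 2) / (2 * √(x * y))) = s := by
  have : 0 < √(x * y) := Real.sqrt_pos.2 (by positivity)
  rw [chord, mul_div_cancel₀ _ (by positivity), sub_sub_cancel, Real.sqrt_sq hs]

-- The integrand depends on the directions only through their inner product, which the chord
-- substitution trades for `s`; this produces the factor `s/√(xy)`. The azimuth is then traded for
-- `u`. The prefactor `32π² = (4π√2)²` is what two of the three measures contribute in the passage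
-- from speed to energy.
open Classical in
theorem ofReal_cubicWeight_sqrt {Φ : ℝ → ℝ → ℝ} {C : ℝ} (h : IsGlobalFactor Φ C) {x y z : ℝ}
    (hx : 0 < x) (hy : 0 < y) (hz : 0 < z) (hxyz : x < y + z) (hne : x ≠ y) :
    ENNReal.ofReal (32 * π ^ 2 * cubicWeight Φ √(2 * x) √(2 * y) √(2 * z))
      = ENNReal.ofReal (1 / π) * ∫⁻ s in Ioi (0 : ℝ), ∫⁻ u in Ioi (0 : ℝ),
        ENNReal.ofReal (4 * (s * u) / √(collisionDisc s u x y z)) *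
          ENNReal.ofReal (s / √(x * y) * (Φ (√2 * s) (√2 * u) / (2 * (s * √z + u * √y)))) := by
  have hne' : √(2 * x) ≠ √(2 * y) := fun h => hne (by
    have := (Real.sqrt_inj (by positivity) (by positivity)).1 h
    linarith)
  let g : ℝ → ℝ → ℝ≥0∞ := fun s ϑ => ENNReal.ofReal
    (if (x - y + s ^ 2) ^ 2 < 4 * s ^ 2 * z then
      Φ (√2 * s) (√2 * YStar x y z s ϑ) / (2 * (s * √z + YStar x y z s ϑ * √y)) else 0)
  have hY : Measurable fun p : ℝ × ℝ => YStar x y z p.1 p.2 :=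
    measurable_YStar_comp measurable_const measurable_const measurable_const measurable_fst
      measurable_snd
  have hg : Measurable (Function.uncurry g) := by
    refine Measurable.ennreal_ofReal (Measurable.ite (measurableSet_lt (by fun_prop) (by fun_prop))
      ((h.measurable_comp (by fun_prop) (by fun_prop)).div (by fun_prop)) measurable_const)
  have hf : Measurable fun t : ℝ => ∫⁻ ϑ in Ioc 0 (2 * π), g (chord x y t) ϑ :=
    (hg.lintegral_prod_right' (ν := volume.restrict (Ioc 0 (2 * π)))).comp (measurable_chord x y)
  rw [ENNReal.ofReal_mul (by positivity), ofReal_cubicWeight h (Real.sqrt_nonneg _)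
    (Real.sqrt_nonneg _) (Real.sqrt_nonneg _) hne']
  have hE : ∀ σ σ' : S2, ∫⁻ ϑ in Ioc 0 (2 * π),
      ENNReal.ofReal (cubicIntegrand Φ √(2 * x) √(2 * y) √(2 * z) σ σ' ϑ)
      = (fun t => ∫⁻ ϑ in Ioc 0 (2 * π), g (chord x y t) ϑ) ⟪(σ : R3), (σ' : R3)⟫_ℝ :=
    fun σ σ' => lintegral_congr fun ϑ => by
      rw [cubicIntegrand_sqrt Φ hx.le hy.le hz.le hne σ σ' ϑ rfl]
  simp_rw [hE]
  rw [lintegral_inner_surf_surf _ hf, lintegral_comp_chord hx hy, ← mul_assoc, ← mul_assoc,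
    ← ENNReal.ofReal_mul (by positivity), ← ENNReal.ofReal_mul (by positivity)]
  have hconst : 32 * π ^ 2 * (4 / (4 * π) ^ 5) * (8 * π ^ 2) = 1 / π := by
    have := Real.pi_pos
    field_simp
    norm_num
  rw [hconst]
  congr 1
  rw [← lintegral_transfer hx.le hy.le hz.le hxyz.le (fun s u => ENNReal.ofReal
    (s / √(x * y) * (Φ (√2 * s) (√2 * u) / (2 * (s * √z + u * √y))))),
    ← lintegral_indicator measurableSet_Ioo, ← lintegral_indicator measurableSet_Ioo]
  refine lintegral_congr fun s => ?_
  have hiff := mem_transfer_range_iff (s := s) hx.le hy.le hz.le hxyz.le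
  by_cases hs : s ∈ Ioo |√x - √y| (√x + √y)
  · have hs0 : 0 < s := (abs_nonneg _).trans_lt hs.1
    have hsx : (x - y + s ^ 2) ^ 2 < 4 * s ^ 2 * x := by
      have := (heron_pos_iff (Real.sqrt_nonneg x) (Real.sqrt_nonneg y) hs0).2 hs
      rwa [Real.sq_sqrt hx.le, Real.sq_sqrt hy.le] at this
    rw [indicator_of_mem hs, chord_comp hx hy hs0.le]
    by_cases hz' : (x - y + s ^ 2) ^ 2 < 4 * s ^ 2 * z
    · rw [indicator_of_mem (hiff.2 ⟨hs0, hsx, hz'⟩), ← lintegral_const_mul' _ _ (by simp)]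
      refine lintegral_congr fun ϑ => ?_
      simp only [g, if_pos hz']
      rw [← ENNReal.ofReal_mul (by positivity)]
    · rw [indicator_of_notMem (fun hc => hz' (hiff.1 hc).2.2)]
      simp [g, hz']
  · rw [indicator_of_notMem hs, indicator_of_notMem]
    exact fun hc => hs ⟨(max_lt_iff.1 hc.1).1, (lt_min_iff.1 hc.2).1⟩

/-- The denominator `s√z + u√y` is common to both orderings, and the numerators `s/√(xy)` and
`u/√(xz)` sum to that denominator divided by `√(xyz)`. -/
theorem cubicWeight_add_swap {Φ : ℝ → ℝ → ℝ} {C : ℝ} (h : IsGlobalFactor Φ C) {x y z : ℝ}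
    (hx : 0 < x) (hy : 0 < y) (hz : 0 < z) (hxyz : x < y + z) (hxy : x ≠ y) (hxz : x ≠ z) :
    32 * π ^ 2 * cubicWeight Φ √(2 * x) √(2 * y) √(2 * z)
      + 32 * π ^ 2 * cubicWeight Φ √(2 * x) √(2 * z) √(2 * y) = 2 * W Φ x y z := by
  have n1 : 0 ≤ 32 * π ^ 2 * cubicWeight Φ √(2 * x) √(2 * y) √(2 * z) :=
    mul_nonneg (by positivity) (cubicWeight_nonneg h (by positivity) (by positivity))
  have n2 : 0 ≤ 32 * π ^ 2 * cubicWeight Φ √(2 * x) √(2 * z) √(2 * y) :=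
    mul_nonneg (by positivity) (cubicWeight_nonneg h (by positivity) (by positivity))
  have n3 : 0 ≤ 2 * W Φ x y z := mul_nonneg zero_le_two (W_nonneg h hx.le hy.le hz.le)
  rw [← ENNReal.ofReal_eq_ofReal_iff (add_nonneg n1 n2) n3, ENNReal.ofReal_add n1 n2,
    ENNReal.ofReal_mul zero_le_two, ofReal_W h hx hy hz hxyz,
    ofReal_cubicWeight_sqrt h hx hy hz hxyz hxy,
    ofReal_cubicWeight_sqrt h hx hz hy (by linarith) hxz, transferMass]
  have hm : ∀ x y z : ℝ, Measurable fun p : ℝ × ℝ =>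
      ENNReal.ofReal (4 * (p.1 * p.2) / √(collisionDisc p.1 p.2 x y z)) *
        ENNReal.ofReal (p.1 / √(x * y) *
          (Φ (√2 * p.1) (√2 * p.2) / (2 * (p.1 * √z + p.2 * √y)))) := fun x y z => by
    have h1 : Measurable fun p : ℝ × ℝ => Φ (√2 * p.1) (√2 * p.2) :=
      h.measurable_comp (by fun_prop) (by fun_prop)
    unfold collisionDisc
    exact Measurable.mul (by fun_prop) (Measurable.ennreal_ofReal
      (Measurable.mul (by fun_prop) (h1.div (by fun_prop))))
  have hm' : Measurable (Function.uncurry fun s u : ℝ =>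
      ENNReal.ofReal (4 * (s * u) / √(collisionDisc s u x z y)) *
        ENNReal.ofReal (s / √(x * z) *
          (Φ (√2 * s) (√2 * u) / (2 * (s * √y + u * √z))))) := hm x z y
  -- Exchanging the order of integration in the swapped weight renames `s` and `u`, after which the
  -- two integrands can be added pointwise.
  rw [lintegral_lintegral_swap hm'.aemeasurable, ← mul_add, ← lintegral_add_left
    (hm x y z).lintegral_prod_right', ← mul_assoc, ← ENNReal.ofReal_mul zero_le_two,
    ← lintegral_const_mul' _ _ ENNReal.ofReal_ne_top,
    ← lintegral_const_mul' _ _ ENNReal.ofReal_ne_top]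
  refine setLIntegral_congr_fun measurableSet_Ioi fun s hs => ?_
  have hs0 : 0 < s := hs
  have hms : Measurable fun u : ℝ =>
      ENNReal.ofReal (4 * (s * u) / √(collisionDisc s u x y z)) *
        ENNReal.ofReal (s / √(x * y) *
          (Φ (√2 * s) (√2 * u) / (2 * (s * √z + u * √y)))) :=
    (hm x y z).comp measurable_prodMk_left
  rw [← lintegral_add_left hms, ← lintegral_const_mul' _ _ ENNReal.ofReal_ne_top,
    ← lintegral_const_mul' _ _ ENNReal.ofReal_ne_top]
  refine setLIntegral_congr_fun measurableSet_Ioi fun u hu => ?_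
  have hu0 : 0 < u := hu
  have hΦ := h.nonneg (√2 * s) (√2 * u)
  rw [collisionDisc_swap s u x y z, mul_comm u s, h.symm (√2 * u), ← mul_add,
    ← ENNReal.ofReal_add (by positivity) (by positivity)]
  have e1 : ∀ a b c : ℝ, 0 ≤ a → 0 ≤ b → ENNReal.ofReal a * (ENNReal.ofReal b * ENNReal.ofReal c)
      = ENNReal.ofReal (a * (b * c)) := fun a b c ha hb => by
    rw [← ENNReal.ofReal_mul hb, ← ENNReal.ofReal_mul ha]
  rw [e1 _ _ _ (by positivity) (by positivity), e1 _ _ _ (by positivity) (by positivity)]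
  congr 1
  generalize 4 * (s * u) / √(collisionDisc s u x y z) = D
  have q1 := Real.sqrt_pos.2 hx
  have q2 := Real.sqrt_pos.2 hy
  have q3 := Real.sqrt_pos.2 hz
  have hπ := Real.pi_pos
  rw [Real.sqrt_mul (show 0 ≤ x * y by positivity) z, Real.sqrt_mul hx.le y, Real.sqrt_mul hx.le z]
  generalize Φ (√2 * s) (√2 * u) = F
  have hden : s * √z + u * √y ≠ 0 := by positivity
  rw [add_comm (u * √y)]
  field_simp
  ring

/-! ### The cubic weight with vanishing energies or outside the energy shell. -/

theorem surf_real_univ : surf.real univ = 4 * π := by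
  rw [measureReal_def, surf_univ, ENNReal.toReal_ofReal (by positivity)]

/-- With one particle at rest, or with the cutoff never satisfied, the integrand does not see the
angles. The constant is `32π² · 4/(4π)⁵ · (4π)² · 2π = 4`. -/
theorem cubicWeight_of_const {Φ : ℝ → ℝ → ℝ} {r r' q c : ℝ}
    (hc : ∀ σ σ' ϑ, cubicIntegrand Φ r r' q σ σ' ϑ = c) :
    32 * π ^ 2 * cubicWeight Φ r r' q = 4 * c := by
  have hπ := Real.pi_pos
  simp only [cubicWeight, hc, intervalIntegral.integral_const, integral_const, surf_real_univ,
    smul_eq_mul]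
  field_simp
  ring

theorem cubicWeight_zero_left {Φ : ℝ → ℝ → ℝ} {y z : ℝ} (hy : 0 < y) (hz : 0 < z) :
    32 * π ^ 2 * cubicWeight Φ √(2 * 0) √(2 * y) √(2 * z)
      = 1 / √(y * z) * Φ √(2 * y) √(2 * z) := by
  have h2y : 0 < √(2 * y) := Real.sqrt_pos.2 (by positivity)
  have h2z : 0 < √(2 * z) := Real.sqrt_pos.2 (by positivity)
  have hyz : √(2 * y) * √(2 * z) = 2 * √(y * z) := by
    rw [← Real.sqrt_mul (by positivity), show 2 * y * (2 * z) = 2 ^ 2 * (y * z) by ring,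
      Real.sqrt_mul (by positivity), Real.sqrt_sq zero_le_two]
  rw [cubicWeight_of_const (c := Φ √(2 * y) √(2 * z) / (4 * √(y * z)))]
  · field_simp
  · intro σ σ' ϑ
    have hX : XB √(2 * 0) √(2 * y) σ σ' = √(2 * y) := by
      simp [XB, norm_smul, abs_of_pos h2y, -Nat.ofNat_pos, -Real.sqrt_mul]
    have hY : YB √(2 * 0) √(2 * y) √(2 * z) σ σ' ϑ = √(2 * z) := by
      simp only [YB, mul_zero, Real.sqrt_zero, zero_smul, inner_zero_left, polarNorm_eq_sqrt]
      simp [Real.sqrt_sq h2z.le, -Real.sqrt_mul]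
    rw [cubicIntegrand, hX, hY, if_pos (by simpa [-Real.sqrt_mul] using hz)]
    congr 1
    linear_combination 2 * hyz

/-- Here one ordering carries the whole of `2W`: in the other, the cutoff would require a
nonnegative number to lie below `0`. -/
theorem cubicWeight_zero_mid {Φ : ℝ → ℝ → ℝ} {x z : ℝ} (hx : 0 < x) (hxz : x < z) :
    32 * π ^ 2 * cubicWeight Φ √(2 * x) √(2 * 0) √(2 * z)
      = 2 * (1 / √(x * z) * Φ √(2 * x) √(2 * (z - x))) := by
  have hz : 0 < z := hx.trans hxz
  have h2x : 0 < √(2 * x) := Real.sqrt_pos.2 (by positivity)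
  have hyz : √(2 * x) * √(2 * z) = 2 * √(x * z) := by
    rw [← Real.sqrt_mul (by positivity), show 2 * x * (2 * z) = 2 ^ 2 * (x * z) by ring,
      Real.sqrt_mul (by positivity), Real.sqrt_sq zero_le_two]
  rw [cubicWeight_of_const (c := Φ √(2 * x) √(2 * (z - x)) / (2 * √(x * z)))]
  · field_simp
    norm_num
  · intro σ σ' ϑ
    have hX : XB √(2 * x) √(2 * 0) σ σ' = √(2 * x) := by
      simp [XB, norm_smul, -Real.sqrt_mul]
    have hi : ⟪√(2 * x) • (σ : R3), xi √(2 * x) √(2 * 0) σ σ'⟫_ℝ = √(2 * x) := by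
      rw [inner_smul_xi (by rw [hX]; exact h2x), hX]
      simp [-Real.sqrt_mul]
      field_simp
    have hY : YB √(2 * x) √(2 * 0) √(2 * z) σ σ' ϑ = √(2 * (z - x)) := by
      rw [YB, hi, polarNorm_eq_sqrt, Real.sq_sqrt (show 0 ≤ 2 * z by positivity),
        Real.sq_sqrt (show 0 ≤ 2 * x by positivity), sub_self, Real.sqrt_zero, mul_sub, Real.sq_sqrt (show 0 ≤ 2 * z - 2 * x by linarith)]
      simp
    rw [cubicIntegrand, mul_abs_inner_xi h2x.le, hi, abs_of_pos h2x, hX, hY,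
      if_pos (Real.sqrt_lt_sqrt (by positivity) (by linarith)), hyz]
    simp

theorem cubicWeight_zero_right {Φ : ℝ → ℝ → ℝ} {r r' : ℝ} (hr : 0 ≤ r) :
    32 * π ^ 2 * cubicWeight Φ r r' √(2 * 0) = 0 := by
  rw [cubicWeight_of_const (c := 0), mul_zero]
  intro σ σ' ϑ
  rw [cubicIntegrand, if_neg]
  simpa using mul_nonneg hr (abs_nonneg _)

theorem cubicWeight_eq_zero {Φ : ℝ → ℝ → ℝ} {r r' q : ℝ} (hr : 0 ≤ r) (hr' : 0 ≤ r')
    (hq : 0 ≤ q) (hne : r ≠ r') (hle : r' ^ 2 + q ^ 2 ≤ r ^ 2) :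
    32 * π ^ 2 * cubicWeight Φ r r' q = 0 := by
  rw [cubicWeight_of_const (c := 0), mul_zero]
  intro σ σ' ϑ
  have hX := XB_pos hr hr' hne σ σ'
  have hX2 := XB_sq r r' σ σ'
  rw [cubicIntegrand, if_neg]
  rw [mul_abs_inner_xi hr, not_lt, inner_smul_xi hX]
  rw [← abs_of_nonneg hq, ← sq_le_sq, div_pow, le_div_iff₀ (by positivity), hX2]
  -- With `a = r r' ⟪σ, σ'⟫` one has `(r² - a)² - (r² - r'²) X² = (a - r'²)²`, and `q² ≤ r² - r'²`;
  -- hence the cutoff always fails.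
  have := sq_nonneg (r * r' * ⟪(σ : R3), (σ' : R3)⟫_ℝ - r' ^ 2)
  have h3 : 0 ≤ r ^ 2 + r' ^ 2 - 2 * r * r' * ⟪(σ : R3), (σ' : R3)⟫_ℝ := by
    rw [← hX2]; positivity
  nlinarith [mul_nonneg (sub_nonneg.2 hle) h3]

theorem Delta_swap (φ : ℝ → ℝ) (x y z : ℝ) : Delta φ x z y = Delta φ x y z := by
  unfold Delta xStar
  rw [add_comm z y]
  ring

theorem Delta_eq_zero_left (φ : ℝ → ℝ) {x z : ℝ} (hz : 0 ≤ z) : Delta φ x x z = 0 := by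
  unfold Delta xStar
  rw [show x + z - x = z by ring, max_eq_left hz]
  ring

/-- Holds for all nonnegative energies, zero ones and diagonals included. The signs of `v`, `w`
matter: besides the symmetrized identity, they bound each ordering separately by the sum. On a
diagonal zero weights suffice, since `KB` is zero by definition and `Δφ` vanishes. -/
theorem exists_cubic_weights {Φ : ℝ → ℝ → ℝ} {C : ℝ} (h : IsGlobalFactor Φ C) (φ : ℝ → ℝ)
    {x y z : ℝ} (hx : 0 ≤ x) (hy : 0 ≤ y) (hz : 0 ≤ z) :
    ∃ v w : ℝ, 0 ≤ v ∧ 0 ≤ w ∧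
      32 * π ^ 2 * KB Φ φ √(2 * x) √(2 * y) √(2 * z) = v * Delta φ x y z ∧
      32 * π ^ 2 * KB Φ φ √(2 * x) √(2 * z) √(2 * y) = w * Delta φ x y z ∧
      (v + w) * Delta φ x y z = 2 * calK Φ φ x y z := by
  by_cases hxy : x = y
  · subst hxy
    refine ⟨0, 0, le_rfl, le_rfl, ?_, ?_, ?_⟩
    · simp [KB]
    · simp [KB]
    · simp [calK, Delta_eq_zero_left φ hz]
  by_cases hxz : x = z
  · subst hxz
    refine ⟨0, 0, le_rfl, le_rfl, ?_, ?_, ?_⟩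
    · simp [KB]
    · simp [KB]
    · simp [calK, Delta_swap φ x x y, Delta_eq_zero_left φ hy]
  have inj : ∀ {a b : ℝ}, 0 ≤ a → 0 ≤ b → a ≠ b → √(2 * a) ≠ √(2 * b) := fun ha hb hne h => hne (by
    have := (Real.sqrt_inj (by positivity) (by positivity)).1 h
    linarith)
  have n1 := inj hx hy hxy
  have n2 := inj hx hz hxz
  have hsq : ∀ {a : ℝ}, 0 ≤ a → √(2 * a) ^ 2 / 2 = a := fun ha => by
    rw [Real.sq_sqrt (by positivity)]; ring
  refine ⟨32 * π ^ 2 * cubicWeight Φ √(2 * x) √(2 * y) √(2 * z),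
    32 * π ^ 2 * cubicWeight Φ √(2 * x) √(2 * z) √(2 * y),
    mul_nonneg (by positivity) (cubicWeight_nonneg h (by positivity) (by positivity)),
    mul_nonneg (by positivity) (cubicWeight_nonneg h (by positivity) (by positivity)), ?_, ?_, ?_⟩
  · rw [KB_eq Φ φ n1 n2, hsq hx, hsq hy, hsq hz, ← mul_assoc]
  · rw [KB_eq Φ φ n2 n1, hsq hx, hsq hy, hsq hz, ← mul_assoc, Delta_swap φ x y z]
  · rw [calK, ← mul_assoc]
    congr 1
    rcases le_or_gt (y + z) x with hle | hlt
    · have hs : xStar x y z = 0 := max_eq_right (by linarith)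
      have hx0 : x ≠ 0 := fun h0 => hxy (by linarith)
      rw [cubicWeight_eq_zero (by positivity) (by positivity) (by positivity) n1
        (by rw [Real.sq_sqrt (by positivity), Real.sq_sqrt (by positivity),
              Real.sq_sqrt (by positivity)]; linarith),
        cubicWeight_eq_zero (by positivity) (by positivity) (by positivity) n2
        (by rw [Real.sq_sqrt (by positivity), Real.sq_sqrt (by positivity),
              Real.sq_sqrt (by positivity)]; linarith)]
      have h3 : ¬ x < z := by linarith
      have h4 : ¬ x < y := by linarith
      simp [W, hs, hx0, h3, h4]
    have hs : xStar x y z = y + z - x := max_eq_left (by linarith)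
    have hs0 : 0 < y + z - x := by linarith
    rcases hx.eq_or_lt with rfl | hx'
    · have hy' : 0 < y := lt_of_le_of_ne hy hxy
      have hz' : 0 < z := lt_of_le_of_ne hz hxz
      rw [cubicWeight_zero_left hy' hz', cubicWeight_zero_left hz' hy',
        h.symm √(2 * z), mul_comm z y, W, if_neg (by simp), if_pos ⟨rfl, hy', hz'⟩]
      ring
    rcases hy.eq_or_lt with rfl | hy'
    · have hxz' : x < z := by linarith
      rw [cubicWeight_zero_mid hx' hxz', cubicWeight_zero_right (Real.sqrt_nonneg _), W,
        if_neg (by simp), if_neg (fun hc => hx'.ne' hc.1), if_pos ⟨rfl, hx', hxz'⟩]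
      ring
    rcases hz.eq_or_lt with rfl | hz'
    · have hxy' : x < y := by linarith
      rw [cubicWeight_zero_mid hx' hxy', cubicWeight_zero_right (Real.sqrt_nonneg _), W,
        if_neg (by simp), if_neg (fun hc => hx'.ne' hc.1), if_neg (fun hc => hy'.ne' hc.1),
        if_pos ⟨rfl, hx', hxy'⟩, h.symm √(2 * x)]
      ring
    exact cubicWeight_add_swap h hx' hy' hz' hlt hxy hxz

/-! ### The quadratic term split into gain and loss. -/

theorem measurable_intervalIntegral {α : Type*} [MeasurableSpace α] {a b : α → ℝ}
    {f : α → ℝ → ℝ} (ha : Measurable a) (hb : Measurable b)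
    (hf : Measurable (Function.uncurry f)) :
    Measurable fun p => ∫ s in (a p)..(b p), f p s := by
  have key : ∀ {a b : α → ℝ}, Measurable a → Measurable b →
      Measurable fun p => ∫ s in Ioc (a p) (b p), f p s := by
    intro a b ha hb
    have hS : MeasurableSet {q : α × ℝ | a q.1 < q.2 ∧ q.2 ≤ b q.1} :=
      (measurableSet_lt (ha.comp measurable_fst) measurable_snd).inter
        (measurableSet_le measurable_snd (hb.comp measurable_fst))
    have e : ∀ p, ∫ s in Ioc (a p) (b p), f p s
        = ∫ s, {q : α × ℝ | a q.1 < q.2 ∧ q.2 ≤ b q.1}.indicator (Function.uncurry f) (p, s) :=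
      fun p => by
        rw [← integral_indicator measurableSet_Ioc]
        rfl
    simp_rw [e]
    exact ((hf.indicator hS).stronglyMeasurable.integral_prod_right').measurable
  exact (key ha hb).sub (key hb ha)

/-- The parameter space of the quadratic collision integral. -/
def gainMeasure : Measure ((S2 × S2) × (ℝ × ℝ)) :=
  (surf.prod surf).prod
    ((volume.restrict (Ioc 0 (π / 2))).prod (volume.restrict (Ioc 0 (2 * π))))

instance : IsFiniteMeasure gainMeasure := by unfold gainMeasure; infer_instance

/-- The density of the quadratic collision integral. -/
def gainDensity (Φ : ℝ → ℝ → ℝ) (r rs : ℝ) (p : (S2 × S2) × (ℝ × ℝ)) : ℝ :=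
  kernelB Φ (XB r rs p.1.1 p.1.2) p.2.1 * Real.sin p.2.1

/-- The gain part of `JB`. -/
def gain (Φ : ℝ → ℝ → ℝ) (h : ℝ → ℝ) (r rs : ℝ) : ℝ :=
  2 / (4 * π) ^ 2 * ∫ p, gainDensity Φ r rs p *
    h (vPrimeSq r rs p.1.1 p.1.2 p.2.1 p.2.2 / 2) ∂gainMeasure

theorem ae_gainMeasure : ∀ᵐ p ∂gainMeasure, p.2.1 ∈ Ioc 0 (π / 2) := by
  have h1 : ∀ᵐ θ ∂(volume.restrict (Ioc 0 (π / 2))), θ ∈ Ioc 0 (π / 2) :=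
    ae_restrict_mem measurableSet_Ioc
  have h2 := (Measure.quasiMeasurePreserving_fst (μ := volume.restrict (Ioc 0 (π / 2)))
    (ν := volume.restrict (Ioc 0 (2 * π)))).ae h1
  exact (Measure.quasiMeasurePreserving_snd (μ := surf.prod surf)).ae h2

theorem measurable_gainDensity_comp {Φ : ℝ → ℝ → ℝ} {C : ℝ} (h : IsGlobalFactor Φ C)
    {α : Type*} [MeasurableSpace α] {r rs : α → ℝ} {q : α → (S2 × S2) × (ℝ × ℝ)}
    (hr : Measurable r) (hrs : Measurable rs) (hq : Measurable q) :
    Measurable fun p => gainDensity Φ (r p) (rs p) (q p) := by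
  unfold gainDensity kernelB
  have hX : Measurable fun p => XB (r p) (rs p) (q p).1.1 (q p).1.2 :=
    measurable_XB_comp hr hrs (by fun_prop) (by fun_prop)
  have hθ : Measurable fun p => (q p).2.1 := by fun_prop
  have hΦ := h.measurable_comp (hX.mul hθ.cos) (hX.mul hθ.sin)
  exact (((hX.mul hθ.cos).div_const _).mul hΦ).mul hθ.sin

theorem measurable_vPrimeSq_comp {α : Type*} [MeasurableSpace α] {r rs : α → ℝ}
    {q : α → (S2 × S2) × (ℝ × ℝ)} (hr : Measurable r) (hrs : Measurable rs) (hq : Measurable q) :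
    Measurable fun p => vPrimeSq (r p) (rs p) (q p).1.1 (q p).1.2 (q p).2.1 (q p).2.2 := by
  unfold vPrimeSq
  have h1 : Measurable fun p => ((q p).1.1 : R3) := measurable_subtype_coe.comp (by fun_prop)
  have h2 : Measurable fun p => ((q p).1.2 : R3) := measurable_subtype_coe.comp (by fun_prop)
  have h3 : Measurable fun p => ⟪((q p).1.1 : R3), ((q p).1.2 : R3)⟫_ℝ := h1.inner h2
  fun_prop

theorem gainDensity_nonneg {Φ : ℝ → ℝ → ℝ} {C : ℝ} (h : IsGlobalFactor Φ C) (r rs : ℝ)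
    {p : (S2 × S2) × (ℝ × ℝ)} (hp : p.2.1 ∈ Ioc 0 (π / 2)) : 0 ≤ gainDensity Φ r rs p := by
  have hs : 0 ≤ Real.sin p.2.1 :=
    Real.sin_nonneg_of_nonneg_of_le_pi hp.1.le (by linarith [hp.2, Real.pi_pos])
  have hc : 0 ≤ Real.cos p.2.1 :=
    Real.cos_nonneg_of_neg_pi_div_two_le_of_le (by linarith [hp.1, Real.pi_pos]) hp.2
  have hX : 0 ≤ XB r rs p.1.1 p.1.2 := norm_nonneg _
  have hΦ := h.nonneg (XB r rs p.1.1 p.1.2 * Real.cos p.2.1) (XB r rs p.1.1 p.1.2 * Real.sin p.2.1)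
  unfold gainDensity kernelB
  positivity

theorem gainDensity_abs_le {Φ : ℝ → ℝ → ℝ} {C : ℝ} (h : IsGlobalFactor Φ C) (r rs : ℝ)
    (p : (S2 × S2) × (ℝ × ℝ)) : |gainDensity Φ r rs p| ≤ (|r| + |rs|) * C := by
  have hX0 : 0 ≤ XB r rs p.1.1 p.1.2 := norm_nonneg _
  have hX : XB r rs p.1.1 p.1.2 ≤ |r| + |rs| := by
    have := norm_sub_le (r • (p.1.1 : R3)) (rs • (p.1.2 : R3))
    rwa [norm_smul, norm_smul, norm_S2, norm_S2, mul_one, mul_one] at this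
  have hC := h.bound_nonneg
  have hΦ0 := h.nonneg (XB r rs p.1.1 p.1.2 * Real.cos p.2.1) (XB r rs p.1.1 p.1.2 * Real.sin p.2.1)
  have hΦ := h.le (XB r rs p.1.1 p.1.2 * Real.cos p.2.1) (XB r rs p.1.1 p.1.2 * Real.sin p.2.1)
  have h16 : (1 : ℝ) ≤ (4 * π) ^ 2 := by nlinarith [Real.pi_gt_three]
  have hB : |kernelB Φ (XB r rs p.1.1 p.1.2) p.2.1| ≤ (|r| + |rs|) * C := by
    unfold kernelB
    rw [abs_mul, abs_of_nonneg hΦ0, abs_div, abs_mul, abs_of_nonneg hX0,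
      abs_of_nonneg (show (0 : ℝ) ≤ (4 * π) ^ 2 by positivity)]
    refine mul_le_mul ?_ hΦ hΦ0 (by positivity)
    refine (div_le_self (by positivity) h16).trans ?_
    exact (mul_le_of_le_one_right hX0 (Real.abs_cos_le_one _)).trans hX
  unfold gainDensity
  rw [abs_mul]
  exact (mul_le_of_le_one_right (abs_nonneg _) (Real.abs_sin_le_one _)).trans hB

theorem integrable_gainDensity_mul {Φ : ℝ → ℝ → ℝ} {C : ℝ} (h : IsGlobalFactor Φ C)
    (r rs : ℝ) {g : (S2 × S2) × (ℝ × ℝ) → ℝ} (hg : Measurable g) {K : ℝ} (hK : ∀ p, |g p| ≤ K) :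
    Integrable (fun p => gainDensity Φ r rs p * g p) gainMeasure := by
  refine Integrable.of_bound (C := (|r| + |rs|) * C * K) ((measurable_gainDensity_comp h
    measurable_const measurable_const measurable_id).mul hg).aestronglyMeasurable
    (ae_of_all _ fun p => ?_)
  rw [Real.norm_eq_abs, abs_mul]
  exact mul_le_mul (gainDensity_abs_le h r rs p) (hK p) (abs_nonneg _)
    (mul_nonneg (by positivity) h.bound_nonneg)

theorem iterated_gain_integral {Φ : ℝ → ℝ → ℝ} {C : ℝ} (h : IsGlobalFactor Φ C)
    (r rs : ℝ) {g : (S2 × S2) × (ℝ × ℝ) → ℝ} (hg : Measurable g) {K : ℝ} (hK : ∀ p, |g p| ≤ K) :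
    ∫ σ : S2, ∫ σs : S2,
      (∫ θ in (0 : ℝ)..(π / 2),
        kernelB Φ ‖r • (σ : R3) - rs • (σs : R3)‖ θ * Real.sin θ *
          ∫ ϑ in (0 : ℝ)..(2 * π), g ((σ, σs), (θ, ϑ)))
      ∂surf ∂surf = ∫ p, gainDensity Φ r rs p * g p ∂gainMeasure := by
  have hi := integrable_gainDensity_mul h r rs hg hK
  rw [gainMeasure, integral_prod _ hi, integral_prod _ hi.integral_prod_left]
  refine integral_congr_ae (ae_of_all _ fun σ => integral_congr_ae (ae_of_all _ fun σs => ?_))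
  have hm : Measurable fun q : ℝ × ℝ => gainDensity Φ r rs ((σ, σs), q) * g ((σ, σs), q) :=
    ((measurable_gainDensity_comp h measurable_const measurable_const measurable_id).mul hg).comp
      measurable_prodMk_left
  have hi2 : Integrable (fun q : ℝ × ℝ => gainDensity Φ r rs ((σ, σs), q) * g ((σ, σs), q))
      ((volume.restrict (Ioc 0 (π / 2))).prod (volume.restrict (Ioc 0 (2 * π)))) := by
    refine Integrable.of_bound (C := (|r| + |rs|) * C * K) hm.aestronglyMeasurable
      (ae_of_all _ fun q => ?_)
    rw [Real.norm_eq_abs, abs_mul]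
    exact mul_le_mul (gainDensity_abs_le h r rs _) (hK _) (abs_nonneg _)
      (mul_nonneg (by positivity) h.bound_nonneg)
  simp only
  rw [integral_prod _ hi2, intervalIntegral.integral_of_le (by positivity)]
  refine integral_congr_ae (ae_of_all _ fun θ => ?_)
  simp only
  rw [intervalIntegral.integral_of_le (by positivity), ← integral_const_mul]
  rfl

theorem JB_eq_gain {Φ : ℝ → ℝ → ℝ} {C : ℝ} (h : IsGlobalFactor Φ C) {φ : ℝ → ℝ}
    (hφ : Measurable φ) {K : ℝ} (hK : ∀ x, |φ x| ≤ K) (r rs : ℝ) :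
    JB Φ φ r rs = gain Φ φ r rs - φ (r ^ 2 / 2) * gain Φ 1 r rs := by
  have hm : Measurable fun p : (S2 × S2) × (ℝ × ℝ) =>
      φ (vPrimeSq r rs p.1.1 p.1.2 p.2.1 p.2.2 / 2) :=
    hφ.comp ((measurable_vPrimeSq_comp measurable_const measurable_const measurable_id).div_const 2)
  have e := iterated_gain_integral h r rs
    (g := fun p => φ (vPrimeSq r rs p.1.1 p.1.2 p.2.1 p.2.2 / 2) - φ (r ^ 2 / 2))
    (hm.sub_const _) (K := K + K) (fun p => (abs_sub _ _).trans (add_le_add (hK _) (hK _)))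
  simp only at e
  rw [JB, e, gain, gain, mul_left_comm, ← mul_sub]
  congr 1
  rw [← integral_const_mul, ← integral_sub (integrable_gainDensity_mul h r rs hm fun p => hK _)]
  · refine integral_congr_ae (ae_of_all _ fun p => ?_)
    simp only [Pi.one_apply]
    ring
  · exact (integrable_gainDensity_mul h r rs (g := 1) measurable_one (K := 1)
      (by simp)).const_mul _

theorem gain_nonneg {Φ : ℝ → ℝ → ℝ} {C : ℝ} (h : IsGlobalFactor Φ C) {ψ : ℝ → ℝ}
    (h0 : ∀ x, 0 ≤ ψ x) (r rs : ℝ) : 0 ≤ gain Φ ψ r rs := by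
  refine mul_nonneg (by positivity) (integral_nonneg_of_ae ?_)
  filter_upwards [ae_gainMeasure] with p hp
  exact mul_nonneg (gainDensity_nonneg h r rs hp) (h0 _)

theorem measurable_gain {Φ : ℝ → ℝ → ℝ} {C : ℝ} (h : IsGlobalFactor Φ C) {ψ : ℝ → ℝ}
    (hψ : Measurable ψ) : Measurable fun p : ℝ × ℝ => gain Φ ψ p.1 p.2 := by
  have hm : Measurable fun q : (ℝ × ℝ) × ((S2 × S2) × (ℝ × ℝ)) => gainDensity Φ q.1.1 q.1.2 q.2 *
      ψ (vPrimeSq q.1.1 q.1.2 q.2.1.1 q.2.1.2 q.2.2.1 q.2.2.2 / 2) :=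
    (measurable_gainDensity_comp h (by fun_prop) (by fun_prop) measurable_snd).mul
      (hψ.comp ((measurable_vPrimeSq_comp (by fun_prop) (by fun_prop)
        measurable_snd).div_const 2))
  exact (hm.stronglyMeasurable.integral_prod_right' (ν := gainMeasure)).measurable.const_mul _

theorem ofReal_gain {Φ : ℝ → ℝ → ℝ} {C : ℝ} (h : IsGlobalFactor Φ C) {ψ : ℝ → ℝ}
    (hψ : Measurable ψ) {K : ℝ} (h0 : ∀ x, 0 ≤ ψ x) (hK : ∀ x, ψ x ≤ K) (r rs : ℝ) :
    ENNReal.ofReal (gain Φ ψ r rs) = ENNReal.ofReal (2 / (4 * π) ^ 2) *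
      ∫⁻ σ : S2, ∫⁻ σs : S2, (∫⁻ θ in Ioc 0 (π / 2), ∫⁻ ϑ in Ioc 0 (2 * π),
        ENNReal.ofReal (kernelB Φ (XB r rs σ σs) θ * Real.sin θ *
          ψ (vPrimeSq r rs σ σs θ ϑ / 2))) ∂surf ∂surf := by
  have hm : Measurable fun p : (S2 × S2) × (ℝ × ℝ) =>
      ψ (vPrimeSq r rs p.1.1 p.1.2 p.2.1 p.2.2 / 2) :=
    hψ.comp ((measurable_vPrimeSq_comp measurable_const measurable_const measurable_id).div_const 2)
  have hi := integrable_gainDensity_mul h r rs hm (K := K)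
    (fun p => by rw [abs_of_nonneg (h0 _)]; exact hK _)
  have hm2 : Measurable fun p : (S2 × S2) × (ℝ × ℝ) => ENNReal.ofReal (gainDensity Φ r rs p *
      ψ (vPrimeSq r rs p.1.1 p.1.2 p.2.1 p.2.2 / 2)) :=
    ((measurable_gainDensity_comp h measurable_const measurable_const
      measurable_id).mul hm).ennreal_ofReal
  rw [gain, ENNReal.ofReal_mul (by positivity), ofReal_integral_eq_lintegral_ofReal hi]
  · congr 1
    rw [gainMeasure, lintegral_prod _ hm2.aemeasurable,
      lintegral_prod _ hm2.lintegral_prod_right'.aemeasurable]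
    refine lintegral_congr fun σ => lintegral_congr fun σs => ?_
    exact lintegral_prod _ (hm2.comp (measurable_prodMk_left (x := (σ, σs)))).aemeasurable
  · filter_upwards [ae_gainMeasure] with p hp
    exact mul_nonneg (gainDensity_nonneg h r rs hp) (h0 _)

/-! ### Measurability and pointwise bounds of `W`. -/

theorem measurable_W {Φ : ℝ → ℝ → ℝ} {C : ℝ} (h : IsGlobalFactor Φ C) :
    Measurable fun p : ℝ × ℝ × ℝ => W Φ p.1 p.2.1 p.2.2 := by
  unfold W
  have hxs : Measurable fun p : ℝ × ℝ × ℝ => xStar p.1 p.2.1 p.2.2 := by unfold xStar; fun_prop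
  have hI : Measurable fun p : ℝ × ℝ × ℝ =>
      ∫ s in (max |√p.1 - √p.2.1| |√(xStar p.1 p.2.1 p.2.2) - √p.2.2|)..(min (√p.1 + √p.2.1)
        (√(xStar p.1 p.2.1 p.2.2) + √p.2.2)),
      ∫ θ in (0 : ℝ)..(2 * π), Φ (√2 * s) (√2 * YStar p.1 p.2.1 p.2.2 s θ) := by
    have habs : Measurable fun x : ℝ => |x| := continuous_abs.measurable
    refine measurable_intervalIntegral ?_ (by fun_prop) ?_
    · exact (habs.comp (by fun_prop)).max (habs.comp (by fun_prop))
    · exact measurable_intervalIntegral (α := (ℝ × ℝ × ℝ) × ℝ) measurable_const measurable_const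
        (h.measurable_comp (by fun_prop) ((measurable_YStar_comp (by fun_prop) (by fun_prop)
          (by fun_prop) (by fun_prop) (by fun_prop)).const_mul _))
  have hset : ∀ a b c d e : ℝ × ℝ × ℝ → ℝ, Measurable a → Measurable b → Measurable c →
      Measurable d → Measurable e → MeasurableSet {p | a p = 0 ∧ b p < c p ∧ d p < e p} :=
    fun a b c d e ha hb hc hd he => (measurableSet_eq_fun ha measurable_const).inter
      ((measurableSet_lt hb hc).inter (measurableSet_lt hd he))
  refine Measurable.ite (measurableSet_lt measurable_const (by fun_prop)) ?_
    (Measurable.ite ?_ ?_ (Measurable.ite ?_ ?_ (Measurable.ite ?_ ?_ measurable_const)))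
  · exact Measurable.mul (by fun_prop) hI
  · exact hset (fun p => p.1) (fun p => 0) (fun p => p.2.1) (fun p => 0) (fun p => p.2.2)
      (by fun_prop) (by fun_prop) (by fun_prop) (by fun_prop) (by fun_prop)
  · exact Measurable.mul (by fun_prop) (h.measurable_comp (by fun_prop) (by fun_prop))
  · exact hset (fun p => p.2.1) (fun p => 0) (fun p => p.1) (fun p => p.1) (fun p => p.2.2)
      (by fun_prop) (by fun_prop) (by fun_prop) (by fun_prop) (by fun_prop)
  · exact Measurable.mul (by fun_prop) (h.measurable_comp (by fun_prop) (by fun_prop))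
  · exact hset (fun p => p.2.2) (fun p => 0) (fun p => p.1) (fun p => p.1) (fun p => p.2.1)
      (by fun_prop) (by fun_prop) (by fun_prop) (by fun_prop) (by fun_prop)
  · exact Measurable.mul (by fun_prop) (h.measurable_comp (by fun_prop) (by fun_prop))

/-- The `s`-interval has length at most `2√m` for any one of the four energies `m`, because `√x + √y
- |√x - √y|` is twice the smaller root, and likewise for the other pair. The factors `2π` and `2`
cancel the `4π` of `W`. -/
theorem W_le_of_range {Φ : ℝ → ℝ → ℝ} {C : ℝ} (h : IsGlobalFactor Φ C) {x y z m : ℝ} (hx : 0 < x)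
    (hy : 0 < y) (hz : 0 < z) (hxyz : x < y + z)
    (hm : m = x ∨ m = y ∨ m = z ∨ m = y + z - x) :
    W Φ x y z ≤ C * √m / √(x * y * z) := by
  have hxs : xStar x y z = y + z - x := max_eq_left (by linarith)
  have hpos : 0 < xStar x y z * x * y * z := by
    rw [hxs]; have : 0 < y + z - x := by linarith
    positivity
  have hlo := transfer_range_le hx.le hy.le hz.le hxyz.le
  have hlen : min (√x + √y) (√(xStar x y z) + √z) - max |√x - √y| |√(xStar x y z) - √z|
      ≤ 2 * √m := by
    have a1 := min_le_left (√x + √y) (√(xStar x y z) + √z)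
    have a2 := min_le_right (√x + √y) (√(xStar x y z) + √z)
    have b1 := le_max_left |√x - √y| |√(xStar x y z) - √z|
    have b2 := le_max_right |√x - √y| |√(xStar x y z) - √z|
    have c1 := le_abs_self (√x - √y)
    have c2 := neg_abs_le (√x - √y)
    have c3 := le_abs_self (√(xStar x y z) - √z)
    have c4 := neg_abs_le (√(xStar x y z) - √z)
    rcases hm with rfl | rfl | rfl | hm
    · linarith
    · linarith
    · linarith
    · rw [← hxs] at hm
      rw [hm]
      linarith
  have hI := intervalIntegral.norm_integral_le_of_norm_le_const
    (a := max |√x - √y| |√(xStar x y z) - √z|) (b := min (√x + √y) (√(xStar x y z) + √z))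
    (f := fun s => ∫ θ in (0 : ℝ)..(2 * π), Φ (√2 * s) (√2 * YStar x y z s θ))
    (C := C * (2 * π)) (fun s _ => by
      have := intervalIntegral.norm_integral_le_of_norm_le_const (a := 0) (b := 2 * π)
        (f := fun θ => Φ (√2 * s) (√2 * YStar x y z s θ)) (C := C) fun θ _ => by
          rw [Real.norm_of_nonneg (h.nonneg _ _)]; exact h.le _ _
      rwa [sub_zero, abs_of_nonneg (by positivity)] at this)
  rw [abs_of_nonneg (sub_nonneg.2 hlo)] at hI
  have hC := h.bound_nonneg
  have hp : 0 < √(x * y * z) := Real.sqrt_pos.2 (by positivity)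
  rw [W, if_pos hpos]
  calc _ ≤ 1 / (4 * π * √(x * y * z)) * (C * (2 * π) * (2 * √m)) := by
        refine mul_le_mul_of_nonneg_left ?_ (by positivity)
        exact (le_abs_self _).trans (hI.trans (mul_le_mul_of_nonneg_left hlen (by positivity)))
    _ = _ := by
        have := Real.pi_pos
        field_simp
        ring

/-- Taking `m` to be the smaller of `y`, `z` leaves exactly `√x` times the root of the larger one in
the denominator. -/
theorem sqrt_mul_W_le {Φ : ℝ → ℝ → ℝ} {C : ℝ} (h : IsGlobalFactor Φ C) {x y z : ℝ} (hx : 0 < x)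
    (hy : 0 ≤ y) (hz : 0 ≤ z) (hxyz : x < y + z) :
    W Φ x y z * √x * √(max y z) ≤ C := by
  have hC := h.bound_nonneg
  have px := Real.sqrt_pos.2 hx
  rcases hy.eq_or_lt with rfl | hy'
  · have hxz : x < z := by linarith
    have pz := Real.sqrt_pos.2 (hx.trans hxz)
    rw [W, if_neg (by simp), if_neg (fun hc => hx.ne' hc.1), if_pos ⟨rfl, hx, hxz⟩,
      max_eq_right hz, Real.sqrt_mul hx.le]
    have e : ∀ F : ℝ, 1 / (√x * √z) * F * √x * √z = F := fun F => by field_simp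
    rw [e]
    exact h.le _ _
  rcases hz.eq_or_lt with rfl | hz'
  · have hxy : x < y := by linarith
    have py := Real.sqrt_pos.2 hy'
    rw [W, if_neg (by simp), if_neg (fun hc => hx.ne' hc.1), if_neg (fun hc => hy'.ne' hc.1),
      if_pos ⟨rfl, hx, hxy⟩, max_eq_left hy, Real.sqrt_mul hx.le]
    have e : ∀ F : ℝ, 1 / (√x * √y) * F * √x * √y = F := fun F => by field_simp
    rw [e]
    exact h.le _ _
  have py := Real.sqrt_pos.2 hy'
  have pz := Real.sqrt_pos.2 hz'
  have hsq : √(x * y * z) = √x * √y * √z := by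
    rw [Real.sqrt_mul (by positivity), Real.sqrt_mul hx.le]
  rcases le_total y z with hyz | hyz
  · have h1 := W_le_of_range h hx hy' hz' hxyz (m := y) (by simp)
    rw [hsq] at h1
    rw [max_eq_right hyz, mul_assoc]
    refine (mul_le_mul_of_nonneg_right h1 (by positivity)).trans_eq ?_
    field_simp
  · have h1 := W_le_of_range h hx hy' hz' hxyz (m := z) (by simp)
    rw [hsq] at h1
    rw [max_eq_left hyz, mul_assoc]
    refine (mul_le_mul_of_nonneg_right h1 (by positivity)).trans_eq ?_
    field_simp

/-- Uniform bound for the cubic weight against second differences. -/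
theorem W_mul_sqrt_le {Φ : ℝ → ℝ → ℝ} {C : ℝ} (h : IsGlobalFactor Φ C) {x y z : ℝ} (hx : 0 ≤ x)
    (hy : 0 ≤ y) (hz : 0 ≤ z) :
    W Φ x y z * √(|x - y| * |x - z|) ≤ C := by
  have hC := h.bound_nonneg
  by_cases h1 : 0 < xStar x y z * x * y * z
  · have hx' : 0 < x := lt_of_le_of_ne hx (by rintro rfl; simp at h1)
    have hy' : 0 < y := lt_of_le_of_ne hy (by rintro rfl; simp at h1)
    have hz' : 0 < z := lt_of_le_of_ne hz (by rintro rfl; simp at h1)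
    have hlt : x < y + z := by
      by_contra hc
      have : xStar x y z = 0 := max_eq_right (by linarith)
      simp [this] at h1
    have hp : 0 < √(x * y * z) := Real.sqrt_pos.2 (by positivity)
    have key : ∀ m : ℝ, 0 ≤ m → (m = x ∨ m = y ∨ m = z ∨ m = y + z - x) →
        m * (|x - y| * |x - z|) ≤ x * y * z → W Φ x y z * √(|x - y| * |x - z|) ≤ C := by
      intro m hm0 hm hle
      have h2 := W_le_of_range h hx' hy' hz' hlt hm
      calc _ ≤ C * √m / √(x * y * z) * √(|x - y| * |x - z|) := by gcongr
        _ = C * (√(m * (|x - y| * |x - z|)) / √(x * y * z)) := by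
            rw [Real.sqrt_mul hm0]; ring
        _ ≤ C * 1 := by
            gcongr
            exact (div_le_one hp).2 (Real.sqrt_le_sqrt hle)
        _ = C := mul_one C
    -- `m` is the smallest of `x`, `y`, `z`, except when `x` exceeds both others: then `x < y + z`
    -- gives `x - y ≤ z` and `x - z ≤ y`, and `m = x` works.
    rcases le_total x y with hxy | hxy <;> rcases le_total x z with hxz | hxz
    · refine key x hx (by simp) ?_
      rw [abs_of_nonpos (by linarith), abs_of_nonpos (by linarith), mul_assoc]
      exact mul_le_mul_of_nonneg_left (mul_le_mul (by linarith) (by linarith) (by linarith) hy) hx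
    · refine key z hz (by simp) ?_
      rw [abs_of_nonpos (by linarith), abs_of_nonneg (by linarith), mul_comm _ z]
      refine mul_le_mul_of_nonneg_left ?_ hz
      rw [mul_comm x]
      exact mul_le_mul (by linarith) (by linarith) (by linarith) hy
    · refine key y hy (by simp) ?_
      rw [abs_of_nonneg (by linarith), abs_of_nonpos (by linarith), mul_comm x, mul_assoc]
      exact mul_le_mul_of_nonneg_left (mul_le_mul (by linarith) (by linarith) (by linarith) hx) hy
    · refine key x hx (by simp) ?_
      rw [abs_of_nonneg (by linarith), abs_of_nonneg (by linarith), mul_assoc, mul_comm y]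
      exact mul_le_mul_of_nonneg_left (mul_le_mul (by linarith) (by linarith) (by linarith) hz) hx
  · have e : ∀ {a b F : ℝ}, 0 < a * b → 0 ≤ F → F ≤ C → 1 / √(a * b) * F * √(a * b) ≤ C := by
      intro a b F hab hF hFC
      have := Real.sqrt_pos.2 hab
      rw [div_mul_eq_mul_div, one_mul, div_mul_cancel₀ _ this.ne']
      exact hFC
    have e' : ∀ {a b F : ℝ}, 0 < a * b → 0 ≤ F → F ≤ C → ∀ c, 0 ≤ c → c ≤ a * b →
        1 / √(a * b) * F * √c ≤ C := by
      intro a b F hab hF hFC c hc0 hc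
      refine le_trans ?_ (e hab hF hFC)
      exact mul_le_mul_of_nonneg_left (Real.sqrt_le_sqrt hc) (by positivity)
    rw [W, if_neg h1]
    split_ifs with h2 h3 h4
    · obtain ⟨rfl, hy', hz'⟩ := h2
      refine e' (by positivity) (h.nonneg _ _) (h.le _ _) _ (by positivity) ?_
      rw [zero_sub, zero_sub, abs_neg, abs_neg, abs_of_pos hy', abs_of_pos hz']
    · obtain ⟨rfl, hx', hz'⟩ := h3
      refine e' (mul_pos hx' (hx'.trans hz')) (h.nonneg _ _) (h.le _ _) _ (by positivity) ?_
      rw [sub_zero, abs_of_pos hx', abs_of_neg (by linarith)]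
      gcongr
      linarith
    · obtain ⟨rfl, hx', hz'⟩ := h4
      refine e' (mul_pos hx' (hx'.trans hz')) (h.nonneg _ _) (h.le _ _) _ (by positivity) ?_
      rw [sub_zero, abs_of_pos hx', abs_of_neg (by linarith), mul_comm]
      gcongr
      linarith
    · simpa using hC

/-! ### The gain term as an integral against `W √x dx`. -/

/-- The gain integral in the collision parameters `s`, `u` and the outgoing energy `x`, up to
normalization. -/
def gainMass (Φ : ℝ → ℝ → ℝ) (ψ : ℝ → ℝ) (y z : ℝ) : ℝ≥0∞ :=
  ∫⁻ s in Ioi (0 : ℝ), ∫⁻ u in Ioi (0 : ℝ), ∫⁻ x,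
    ENNReal.ofReal (4 * (s * u) / √(collisionDisc s u x y z)) *
      ENNReal.ofReal (Φ (√2 * s) (√2 * u)) * ENNReal.ofReal (ψ x)

theorem measurable_gainMass_integrand {Φ : ℝ → ℝ → ℝ} {C : ℝ} (h : IsGlobalFactor Φ C)
    {ψ : ℝ → ℝ} (hψ : Measurable ψ) (y z : ℝ) :
    Measurable fun p : (ℝ × ℝ) × ℝ =>
      ENNReal.ofReal (4 * (p.1.1 * p.1.2) / √(collisionDisc p.1.1 p.1.2 p.2 y z)) *
      ENNReal.ofReal (Φ (√2 * p.1.1) (√2 * p.1.2)) * ENNReal.ofReal (ψ p.2) := by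
  unfold collisionDisc
  exact (Measurable.mul (by fun_prop) (h.measurable_comp (by fun_prop)
    (by fun_prop)).ennreal_ofReal).mul (hψ.comp measurable_snd).ennreal_ofReal

theorem gainMass_eq_lintegral_transferMass {Φ : ℝ → ℝ → ℝ} {C : ℝ} (h : IsGlobalFactor Φ C)
    {ψ : ℝ → ℝ} (hψ : Measurable ψ) (y z : ℝ) :
    gainMass Φ ψ y z = ∫⁻ x, transferMass Φ x y z * ENNReal.ofReal (ψ x) := by
  have hm := measurable_gainMass_integrand h hψ y z
  have hm1 : Measurable fun p : (ℝ × ℝ) × ℝ =>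
      ENNReal.ofReal (4 * (p.1.1 * p.2) / √(collisionDisc p.1.1 p.2 p.1.2 y z)) *
      ENNReal.ofReal (Φ (√2 * p.1.1) (√2 * p.2)) * ENNReal.ofReal (ψ p.1.2) :=
    hm.comp (f := fun p : (ℝ × ℝ) × ℝ => (((p.1.1, p.2), p.1.2) : (ℝ × ℝ) × ℝ)) (by fun_prop)
  have e1 : gainMass Φ ψ y z = ∫⁻ s in Ioi (0 : ℝ), ∫⁻ x, ∫⁻ u in Ioi (0 : ℝ),
      ENNReal.ofReal (4 * (s * u) / √(collisionDisc s u x y z)) *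
      ENNReal.ofReal (Φ (√2 * s) (√2 * u)) * ENNReal.ofReal (ψ x) := by
    refine lintegral_congr fun s => lintegral_lintegral_swap ?_
    have : Measurable (Function.uncurry fun u x : ℝ =>
      ENNReal.ofReal (4 * (s * u) / √(collisionDisc s u x y z)) *
      ENNReal.ofReal (Φ (√2 * s) (√2 * u)) * ENNReal.ofReal (ψ x)) :=
      hm.comp (f := fun p : ℝ × ℝ => (((s, p.1), p.2) : (ℝ × ℝ) × ℝ)) (by fun_prop)
    exact this.aemeasurable
  have hm2 : Measurable (Function.uncurry fun s x : ℝ => ∫⁻ u in Ioi (0 : ℝ),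
      ENNReal.ofReal (4 * (s * u) / √(collisionDisc s u x y z)) *
      ENNReal.ofReal (Φ (√2 * s) (√2 * u)) * ENNReal.ofReal (ψ x)) :=
    hm1.lintegral_prod_right'
  rw [e1, lintegral_lintegral_swap hm2.aemeasurable]
  refine lintegral_congr fun x => ?_
  rw [transferMass, ← lintegral_mul_const' _ _ ENNReal.ofReal_ne_top]
  refine lintegral_congr fun s => ?_
  rw [← lintegral_mul_const' _ _ ENNReal.ofReal_ne_top]

/-- Positivity of the discriminant forces `4s²x > 0`, and also `(x - y + s²)² < 4s²z`, which `x - y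
≥ z` would contradict through `(x - y + s²)² ≥ 4s²(x - y)`. The outgoing energy can therefore be
integrated over all of `ℝ`. -/
theorem transferMass_eq_zero (Φ : ℝ → ℝ → ℝ) {x y z : ℝ}
    (hx : x ∉ Ioo 0 (y + z)) : transferMass Φ x y z = 0 := by
  refine (lintegral_congr fun s => ?_).trans lintegral_zero
  refine (lintegral_congr fun u => ?_).trans lintegral_zero
  rw [Real.sqrt_eq_zero_of_nonpos]
  · simp
  · by_contra hc
    obtain ⟨h1, h2⟩ := collisionDisc_pos_imp (not_le.1 hc)
    refine hx ⟨?_, ?_⟩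
    · by_contra h
      nlinarith [sq_nonneg (x - y + s ^ 2), mul_nonneg (sq_nonneg s) (neg_nonneg.2 (not_lt.1 h))]
    · by_contra h
      nlinarith [sq_nonneg (x - y - s ^ 2), mul_nonneg (sq_nonneg s) (sub_nonneg.2 (not_lt.1 h)),
        sq_nonneg (x - y + s ^ 2)]

theorem integrableOn_W_mul {Φ : ℝ → ℝ → ℝ} {C : ℝ} (h : IsGlobalFactor Φ C) {ψ : ℝ → ℝ}
    (hψ : Measurable ψ) {K : ℝ} (hK : ∀ x, |ψ x| ≤ K) {y z : ℝ} (hy : 0 ≤ y) (hz : 0 ≤ z) :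
    IntegrableOn (fun x => W Φ x y z * √x * ψ x) (Ioc 0 (y + z)) := by
  rcases (add_nonneg hy hz).eq_or_lt with h0 | h0
  · rw [← h0, Ioc_self]
    exact integrableOn_empty
  have hmax : 0 < √(max y z) := by
    refine Real.sqrt_pos.2 ?_
    by_contra hc
    have h1 := le_max_left y z
    have h2 := le_max_right y z
    linarith
  have hm : Measurable fun x => W Φ x y z * √x * ψ x :=
    (((measurable_W h).comp (f := fun x : ℝ => (x, y, z)) (by fun_prop)).mul
      (by fun_prop)).mul hψ
  refine Measure.integrableOn_of_bounded (M := C / √(max y z) * K) measure_Ioc_lt_top.ne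
    hm.aestronglyMeasurable ?_
  rw [← restrict_Ioo_eq_restrict_Ioc]
  filter_upwards [ae_restrict_mem measurableSet_Ioo] with x hx
  have hW := sqrt_mul_W_le h hx.1 hy hz hx.2
  rw [← le_div_iff₀ hmax] at hW
  have h1 : 0 ≤ W Φ x y z * √x := mul_nonneg (W_nonneg h hx.1.le hy hz) (Real.sqrt_nonneg _)
  rw [norm_mul, Real.norm_of_nonneg h1, Real.norm_eq_abs]
  exact mul_le_mul hW (hK x) (abs_nonneg _) (h1.trans hW)

theorem ofReal_integral_W {Φ : ℝ → ℝ → ℝ} {C : ℝ} (h : IsGlobalFactor Φ C) {ψ : ℝ → ℝ}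
    (hψ : Measurable ψ) {K : ℝ} (h0 : ∀ x, 0 ≤ ψ x) (hK : ∀ x, ψ x ≤ K) {y z : ℝ} (hy : 0 < y)
    (hz : 0 < z) :
    ENNReal.ofReal (∫ x in (0 : ℝ)..(y + z), W Φ x y z * √x * ψ x)
      = ENNReal.ofReal (1 / (4 * π * √(y * z))) * gainMass Φ ψ y z := by
  have hi := integrableOn_W_mul h hψ (K := K)
    (fun x => by rw [abs_of_nonneg (h0 _)]; exact hK x) hy.le hz.le
  rw [intervalIntegral.integral_of_le (by positivity), ofReal_integral_eq_lintegral_ofReal hi]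
  · rw [gainMass_eq_lintegral_transferMass h hψ, ← lintegral_const_mul' _ _ ENNReal.ofReal_ne_top,
      setLIntegral_congr Ioo_ae_eq_Ioc.symm, ← lintegral_indicator measurableSet_Ioo]
    refine lintegral_congr fun x => ?_
    by_cases hx : x ∈ Ioo 0 (y + z)
    · rw [indicator_of_mem hx, ENNReal.ofReal_mul (mul_nonneg (W_nonneg h hx.1.le hy.le hz.le)
        (Real.sqrt_nonneg _)), ENNReal.ofReal_mul (W_nonneg h hx.1.le hy.le hz.le),
        ofReal_W h hx.1 hy hz hx.2, ← mul_assoc, mul_right_comm (ENNReal.ofReal _),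
        ← ENNReal.ofReal_mul (by positivity)]
      congr 3
      have := Real.sqrt_pos.2 hx.1
      rw [mul_assoc x, Real.sqrt_mul hx.1.le]
      field_simp
    · rw [indicator_of_notMem hx, transferMass_eq_zero Φ hx]
      simp
  · filter_upwards [ae_restrict_mem measurableSet_Ioc] with x hx
    exact mul_nonneg (mul_nonneg (W_nonneg h hx.1.le hy.le hz.le) (Real.sqrt_nonneg _)) (h0 x)

theorem vPrimeSq_sqrt {y z : ℝ} (hy : 0 ≤ y) (hz : 0 ≤ z) (σ σs : S2) (θ ϑ : ℝ) :
    vPrimeSq √(2 * y) √(2 * z) σ σs θ ϑ / 2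
      = y * Real.sin θ ^ 2 + z * Real.cos θ ^ 2 + -(2 * √(y * z) * Real.sin θ * Real.cos θ *
        √(1 - ⟪(σ : R3), (σs : R3)⟫_ℝ ^ 2)) * Real.cos ϑ := by
  have hyz : √(2 * y) * √(2 * z) = 2 * √(y * z) := by
    rw [← Real.sqrt_mul (by positivity), show 2 * y * (2 * z) = 2 ^ 2 * (y * z) by ring,
      Real.sqrt_mul (by positivity), Real.sqrt_sq zero_le_two]
  rw [vPrimeSq, Real.sq_sqrt (by positivity), Real.sq_sqrt (by positivity)]
  linear_combination (-(Real.sin θ * Real.cos θ *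
        √(1 - ⟪(σ : R3), (σs : R3)⟫_ℝ ^ 2) * Real.cos ϑ)) * hyz

/-- In polar coordinates the discriminant is `ρ²` times the radicand of the arcsine law followed by
the outgoing energy, with centre `y sin² θ + z cos² θ`. This identity links the two parametrizations
of a collision. -/
theorem collisionDisc_polar {y z t ρ : ℝ} (hy : 0 < y) (hz : 0 < z)
    (ht : t = (y + z - ρ ^ 2) / (2 * √(y * z))) (θ x : ℝ) :
    collisionDisc (ρ * Real.cos θ) (ρ * Real.sin θ) x y z
      = ρ ^ 2 * ((2 * √(y * z) * Real.sin θ * Real.cos θ) ^ 2 * (1 - t ^ 2)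
        - (x - (y * Real.sin θ ^ 2 + z * Real.cos θ ^ 2)) ^ 2) := by
  have hp : 0 < √(y * z) := Real.sqrt_pos.2 (by positivity)
  have h2 : √(y * z) ^ 2 = y * z := Real.sq_sqrt (by positivity)
  have ht2 : 4 * √(y * z) ^ 2 * t ^ 2 = (y + z - ρ ^ 2) ^ 2 := by
    rw [ht]; field_simp; ring
  have hc : Real.cos θ ^ 2 = 1 - Real.sin θ ^ 2 := by
    linear_combination Real.sin_sq_add_cos_sq θ
  have e : (2 * √(y * z) * Real.sin θ * Real.cos θ) ^ 2 * (1 - t ^ 2)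
      = Real.sin θ ^ 2 * Real.cos θ ^ 2 * (4 * (y * z) - (y + z - ρ ^ 2) ^ 2) := by
    linear_combination (Real.sin θ ^ 2 * Real.cos θ ^ 2) * (4 * h2 - ht2)
  rw [e]
  unfold collisionDisc
  rw [mul_pow, mul_pow, hc]
  ring

theorem collisionDisc_polar_nonpos {y z ρ : ℝ} (hy : 0 < y) (hz : 0 < z) (hρ : 0 < ρ)
    (hr : ρ ∉ Ioo |√y - √z| (√y + √z)) (θ x : ℝ) :
    collisionDisc (ρ * Real.cos θ) (ρ * Real.sin θ) x y z ≤ 0 := by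
  have hp : 0 < √(y * z) := Real.sqrt_pos.2 (by positivity)
  rw [collisionDisc_polar hy hz rfl]
  have h1 : 1 - ((y + z - ρ ^ 2) / (2 * √(y * z))) ^ 2 ≤ 0 := by
    have h2 := mt (heron_pos_iff (Real.sqrt_nonneg y) (Real.sqrt_nonneg z) hρ).1 hr
    rw [Real.sq_sqrt hy.le, Real.sq_sqrt hz.le, not_lt] at h2
    rw [div_pow, sub_nonpos, le_div_iff₀ (by positivity), mul_pow, Real.sq_sqrt (by positivity)]
    nlinarith
  have h3 := mul_nonneg (sq_nonneg (2 * √(y * z) * Real.sin θ * Real.cos θ)) (neg_nonneg.2 h1)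
  refine mul_nonpos_of_nonneg_of_nonpos (sq_nonneg _) ?_
  nlinarith [sq_nonneg (x - (y * Real.sin θ ^ 2 + z * Real.cos θ ^ 2))]

/-- At fixed relative speed `√2 ρ` and scattering angle `θ`, the azimuth is replaced by the outgoing
energy `x`; the remaining factors match one by one. -/
theorem gain_inner_identity {Φ : ℝ → ℝ → ℝ} {C : ℝ} (h : IsGlobalFactor Φ C) {ψ : ℝ → ℝ}
    {y z ρ t θ : ℝ} (hy : 0 < y) (hz : 0 < z)
    (hρ : ρ ∈ Ioo |√y - √z| (√y + √z)) (ht : t = (y + z - ρ ^ 2) / (2 * √(y * z)))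
    (hθ : θ ∈ Ioo 0 (π / 2)) :
    ENNReal.ofReal (4 * π * √2 * (2 / (4 * π) ^ 2) * (8 * π ^ 2)) * (ENNReal.ofReal (ρ / √(y * z)) *
      ∫⁻ ϑ in Ioc 0 (2 * π), ENNReal.ofReal (kernelB Φ (√2 * ρ) θ * Real.sin θ) *
        ENNReal.ofReal (ψ (y * Real.sin θ ^ 2 + z * Real.cos θ ^ 2 +
        -(2 * √(y * z) * Real.sin θ * Real.cos θ * √(1 - t ^ 2)) * Real.cos ϑ)))
    = ENNReal.ofReal (1 / (4 * π * √(y * z))) * (ENNReal.ofReal ρ * ∫⁻ x,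
      ENNReal.ofReal (4 * ((ρ * Real.cos θ) * (ρ * Real.sin θ)) /
        √(collisionDisc (ρ * Real.cos θ) (ρ * Real.sin θ) x y z)) *
      ENNReal.ofReal (Φ (√2 * (ρ * Real.cos θ)) (√2 * (ρ * Real.sin θ))) *
        ENNReal.ofReal (ψ x)) := by
  have hπ := Real.pi_pos
  have hρ0 : 0 < ρ := (abs_nonneg _).trans_lt hρ.1
  have hp : 0 < √(y * z) := Real.sqrt_pos.2 (by positivity)
  have hs : 0 < Real.sin θ := Real.sin_pos_of_mem_Ioo ⟨hθ.1, by linarith [hθ.2]⟩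
  have hc : 0 < Real.cos θ := Real.cos_pos_of_mem_Ioo ⟨by linarith [hθ.1], hθ.2⟩
  have ht1 : 0 < 1 - t ^ 2 := by
    have h2 := (heron_pos_iff (Real.sqrt_nonneg y) (Real.sqrt_nonneg z) hρ0).2 hρ
    rw [Real.sq_sqrt hy.le, Real.sq_sqrt hz.le] at h2
    rw [ht, div_pow, sub_pos, div_lt_one (by positivity), mul_pow, Real.sq_sqrt (by positivity)]
    nlinarith
  have hw := Real.sqrt_pos.2 ht1
  have hA : -(2 * √(y * z) * Real.sin θ * Real.cos θ * √(1 - t ^ 2)) ≠ 0 :=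
    neg_ne_zero.2 (by positivity)
  have hΦ := h.nonneg (√2 * (ρ * Real.cos θ)) (√2 * (ρ * Real.sin θ))
  have hB : kernelB Φ (√2 * ρ) θ * Real.sin θ = √2 * ρ * Real.cos θ * Real.sin θ / (4 * π) ^ 2 *
      Φ (√2 * (ρ * Real.cos θ)) (√2 * (ρ * Real.sin θ)) := by
    rw [kernelB, mul_assoc √2, mul_assoc √2]; ring
  have hmul : ∀ {a b : ℝ} {I : ℝ≥0∞}, 0 ≤ a →
      ENNReal.ofReal a * (ENNReal.ofReal b * I) = ENNReal.ofReal (a * b) * I := fun ha => by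
    rw [← mul_assoc, ← ENNReal.ofReal_mul ha]
  rw [lintegral_const_mul' _ _ ENNReal.ofReal_ne_top, lintegral_circle hA
    (y * Real.sin θ ^ 2 + z * Real.cos θ ^ 2) (fun x => ENNReal.ofReal (ψ x)), hB,
    hmul (by positivity), hmul (by positivity), hmul (by positivity),
    ← lintegral_const_mul' _ _ ENNReal.ofReal_ne_top,
    ← lintegral_const_mul' _ _ ENNReal.ofReal_ne_top]
  refine lintegral_congr fun x => ?_
  rw [collisionDisc_polar hy hz ht, neg_sq, mul_pow _ √(1 - t ^ 2), Real.sq_sqrt ht1.le,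
    Real.sqrt_mul (sq_nonneg ρ), Real.sqrt_sq hρ0.le, hmul (by positivity),
    mul_assoc (ENNReal.ofReal (_ / (ρ * _))), hmul (by positivity), hmul (by positivity)]
  congr 2
  generalize √((2 * √(y * z) * Real.sin θ * Real.cos θ) ^ 2 * (1 - t ^ 2)
        - (x - (y * Real.sin θ ^ 2 + z * Real.cos θ ^ 2)) ^ 2) = D
  generalize Φ (√2 * (ρ * Real.cos θ)) (√2 * (ρ * Real.sin θ)) = F
  have h22 : √2 * √2 = (2 : ℝ) := Real.mul_self_sqrt zero_le_two
  -- If the root vanishes, both densities are `0` by the division convention.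
  rcases eq_or_ne D 0 with rfl | hD
  · simp
  · field_simp
    ring_nf
    rw [show √2 ^ 2 = (2 : ℝ) from Real.sq_sqrt zero_le_two]
    ring

/-- The two arguments of `Φ` in the kernel are `V cos θ` and `V sin θ` with `V = √2 ρ`, so `(ρ, θ)`
are polar coordinates for `(s, u)`. Relative speeds outside the chord range contribute nothing, as
the discriminant is nonpositive there. -/
theorem ofReal_gain_sqrt {Φ : ℝ → ℝ → ℝ} {C : ℝ} (h : IsGlobalFactor Φ C) {ψ : ℝ → ℝ}
    (hψ : Measurable ψ) {K : ℝ} (h0 : ∀ x, 0 ≤ ψ x) (hK : ∀ x, ψ x ≤ K) {y z : ℝ} (hy : 0 < y)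
    (hz : 0 < z) :
    ENNReal.ofReal (4 * π * √2 * gain Φ ψ √(2 * y) √(2 * z))
      = ENNReal.ofReal (1 / (4 * π * √(y * z))) * gainMass Φ ψ y z := by
  let g : ℝ → ℝ → ℝ → ℝ≥0∞ := fun t θ ϑ =>
    ENNReal.ofReal (kernelB Φ (√2 * chord y z t) θ * Real.sin θ) *
        ENNReal.ofReal (ψ (y * Real.sin θ ^ 2 + z * Real.cos θ ^ 2 +
        -(2 * √(y * z) * Real.sin θ * Real.cos θ * √(1 - t ^ 2)) * Real.cos ϑ))
  have hg : Measurable fun p : (ℝ × ℝ) × ℝ => g p.1.1 p.1.2 p.2 := by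
    have hch : Measurable fun p : (ℝ × ℝ) × ℝ => chord y z p.1.1 :=
      (measurable_chord y z).comp (by fun_prop)
    have hθ : Measurable fun p : (ℝ × ℝ) × ℝ => p.1.2 := by fun_prop
    have hX := hch.const_mul √2
    refine Measurable.mul (Measurable.ennreal_ofReal ?_) (hψ.comp (by fun_prop)).ennreal_ofReal
    exact (((hX.mul hθ.cos).div_const _).mul
      (h.measurable_comp (hX.mul hθ.cos) (hX.mul hθ.sin))).mul hθ.sin
  have hf : Measurable fun t : ℝ => ∫⁻ θ in Ioc 0 (π / 2), ∫⁻ ϑ in Ioc 0 (2 * π), g t θ ϑ := by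
    have h1 : Measurable fun q : ℝ × ℝ => ∫⁻ ϑ in Ioc 0 (2 * π), g q.1 q.2 ϑ :=
      hg.lintegral_prod_right'
    exact h1.lintegral_prod_right'
  have e : ∀ σ σs : S2, (∫⁻ θ in Ioc 0 (π / 2), ∫⁻ ϑ in Ioc 0 (2 * π),
        ENNReal.ofReal (kernelB Φ (XB √(2 * y) √(2 * z) σ σs) θ * Real.sin θ *
          ψ (vPrimeSq √(2 * y) √(2 * z) σ σs θ ϑ / 2)))
      = (fun t => ∫⁻ θ in Ioc 0 (π / 2), ∫⁻ ϑ in Ioc 0 (2 * π), g t θ ϑ)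
        ⟪(σ : R3), (σs : R3)⟫_ℝ := fun σ σs => by
    refine lintegral_congr fun θ => lintegral_congr fun ϑ => ?_
    rw [ENNReal.ofReal_mul' (h0 _), vPrimeSq_sqrt hy.le hz.le, XB_sqrt hy.le hz.le]
  have hmF := measurable_gainMass_integrand h hψ y z
  have hF : Measurable (Function.uncurry fun s u : ℝ => ∫⁻ x,
      ENNReal.ofReal (4 * (s * u) / √(collisionDisc s u x y z)) *
      ENNReal.ofReal (Φ (√2 * s) (√2 * u)) * ENNReal.ofReal (ψ x)) := hmF.lintegral_prod_right'
  rw [ENNReal.ofReal_mul (by positivity), ofReal_gain h hψ h0 hK]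
  simp_rw [e]
  rw [lintegral_inner_surf_surf _ hf, lintegral_comp_chord hy hz, ← mul_assoc, ← mul_assoc,
    ← ENNReal.ofReal_mul (by positivity), ← ENNReal.ofReal_mul (by positivity), gainMass,
    lintegral_quadrant_polar _ hF, ← lintegral_const_mul' _ _ ENNReal.ofReal_ne_top,
    ← lintegral_const_mul' _ _ ENNReal.ofReal_ne_top, ← lintegral_indicator measurableSet_Ioo,
    ← lintegral_indicator measurableSet_Ioi]
  refine lintegral_congr fun ρ => ?_
  by_cases hρ : ρ ∈ Ioo |√y - √z| (√y + √z)
  · have hρ0 : 0 < ρ := (abs_nonneg _).trans_lt hρ.1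
    rw [indicator_of_mem hρ, indicator_of_mem (show ρ ∈ Ioi (0 : ℝ) from hρ0),
      ← lintegral_const_mul' _ _ ENNReal.ofReal_ne_top,
      ← lintegral_const_mul' _ _ ENNReal.ofReal_ne_top,
      ← lintegral_const_mul' _ _ ENNReal.ofReal_ne_top,
      setLIntegral_congr Ioo_ae_eq_Ioc.symm, setLIntegral_congr Ioo_ae_eq_Ioc.symm]
    refine setLIntegral_congr_fun measurableSet_Ioo fun θ hθ => ?_
    simp only [g, chord_comp hy hz hρ0.le]
    exact gain_inner_identity h hy hz hρ rfl hθ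
  · rw [indicator_of_notMem hρ]
    by_cases hρ0 : ρ ∈ Ioi (0 : ℝ)
    · rw [indicator_of_mem hρ0]
      simp [Real.sqrt_eq_zero_of_nonpos (collisionDisc_polar_nonpos hy hz hρ0 hρ _ _)]
    · rw [indicator_of_notMem hρ0]

theorem gain_eq_integral_of_pos {Φ : ℝ → ℝ → ℝ} {C : ℝ} (h : IsGlobalFactor Φ C) {ψ : ℝ → ℝ}
    (hψ : Measurable ψ) {K : ℝ} (h0 : ∀ x, 0 ≤ ψ x) (hK : ∀ x, ψ x ≤ K) {y z : ℝ} (hy : 0 < y)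
    (hz : 0 < z) :
    4 * π * √2 * gain Φ ψ √(2 * y) √(2 * z) = ∫ x in (0 : ℝ)..(y + z), W Φ x y z * √x * ψ x := by
  rw [← ENNReal.ofReal_eq_ofReal_iff, ofReal_gain_sqrt h hψ h0 hK hy hz,
    ofReal_integral_W h hψ h0 hK hy hz]
  · exact mul_nonneg (by positivity) (gain_nonneg h h0 _ _)
  · exact intervalIntegral.integral_nonneg (by positivity) fun x hx =>
      mul_nonneg (mul_nonneg (W_nonneg h hx.1 hy.le hz.le) (Real.sqrt_nonneg _)) (h0 x)

/-! ### The gain term with a particle at rest, and its reflection. -/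

theorem gain_of_axis {Φ : ℝ → ℝ → ℝ} {C : ℝ} (h : IsGlobalFactor Φ C) {ψ : ℝ → ℝ}
    (hψ : Measurable ψ) {K : ℝ} (hK : ∀ x, |ψ x| ≤ K) {r rs V : ℝ} {w : ℝ → ℝ}
    (hV : ∀ σ σs, XB r rs σ σs = V) (hw : ∀ σ σs θ ϑ, vPrimeSq r rs σ σs θ ϑ / 2 = w θ) :
    4 * π * √2 * gain Φ ψ r rs = ∫ θ in (0 : ℝ)..(π / 2),
      √2 * V * Φ (V * Real.cos θ) (V * Real.sin θ) * ψ (w θ) * (Real.cos θ * Real.sin θ) := by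
  have hm : Measurable fun p : (S2 × S2) × (ℝ × ℝ) =>
      ψ (vPrimeSq r rs p.1.1 p.1.2 p.2.1 p.2.2 / 2) :=
    hψ.comp ((measurable_vPrimeSq_comp measurable_const measurable_const measurable_id).div_const 2)
  rw [gain, ← iterated_gain_integral h r rs hm (K := K) (fun p => hK _)]
  have hV' : ∀ σ σs : S2, ‖r • (σ : R3) - rs • (σs : R3)‖ = V := hV
  simp only [hw, hV', intervalIntegral.integral_const, integral_const, surf_real_univ, smul_eq_mul]
  rw [← mul_assoc (4 * π) (4 * π), ← mul_assoc (2 / _), ← mul_assoc (4 * π * √2),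
    ← intervalIntegral.integral_const_mul]
  refine intervalIntegral.integral_congr fun θ _ => ?_
  have := Real.pi_pos
  simp only [kernelB]
  field_simp
  ring

theorem gain_zero_left {Φ : ℝ → ℝ → ℝ} {C : ℝ} (h : IsGlobalFactor Φ C) {ψ : ℝ → ℝ}
    (hψ : Continuous ψ) {K : ℝ} (hK : ∀ x, |ψ x| ≤ K) {z : ℝ} (hz : 0 < z) :
    4 * π * √2 * gain Φ ψ √(2 * 0) √(2 * z)
      = ∫ x in (0 : ℝ)..(0 + z), W Φ x 0 z * √x * ψ x := by
  have h2z : √(2 * z) = √2 * √z := Real.sqrt_mul zero_le_two z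
  have hpz := Real.sqrt_pos.2 hz
  rw [gain_of_axis h hψ.measurable hK (V := √(2 * z)) (w := fun θ => z * Real.cos θ ^ 2)]
  · have hsub := intervalIntegral.integral_comp_mul_deriv (a := 0) (b := π / 2)
      (f := fun θ => z * Real.cos θ ^ 2) (f' := fun θ => z * (2 * Real.cos θ * -Real.sin θ))
      (g := fun x => 1 / √z * Φ √(2 * x) √(2 * (z - x)) * ψ x)
      (fun θ _ => by
        have := ((Real.hasDerivAt_cos θ).pow 2).const_mul z
        simpa using this) (by fun_prop)
      ((continuous_const.mul (h.continuous.comp (by fun_prop :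
        Continuous fun x : ℝ => (√(2 * x), √(2 * (z - x)))))).mul hψ)
    simp only [Real.cos_zero, Real.cos_pi_div_two, one_pow, mul_one, ne_eq, OfNat.ofNat_ne_zero,
      not_false_eq_true, zero_pow, mul_zero] at hsub
    rw [intervalIntegral.integral_symm 0 z] at hsub
    have hR : ∫ x in (0 : ℝ)..(0 + z), W Φ x 0 z * √x * ψ x
        = ∫ x in (0 : ℝ)..z, 1 / √z * Φ √(2 * x) √(2 * (z - x)) * ψ x := by
      rw [zero_add, intervalIntegral.integral_of_le hz.le, intervalIntegral.integral_of_le hz.le,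
        integral_Ioc_eq_integral_Ioo, integral_Ioc_eq_integral_Ioo]
      refine setIntegral_congr_fun measurableSet_Ioo fun x hx => ?_
      have hpx := Real.sqrt_pos.2 hx.1
      rw [W, if_neg (by simp), if_neg (fun hc => hx.1.ne' hc.1), if_pos ⟨rfl, hx.1, hx.2⟩,
        Real.sqrt_mul hx.1.le]
      field_simp
    rw [hR, ← neg_neg (∫ x in (0 : ℝ)..z, _), ← hsub, ← intervalIntegral.integral_neg]
    refine intervalIntegral.integral_congr fun θ hθ => ?_
    rw [uIcc_of_le (by positivity)] at hθ
    have hs : 0 ≤ Real.sin θ :=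
      Real.sin_nonneg_of_nonneg_of_le_pi hθ.1 (by linarith [hθ.2, Real.pi_pos])
    have hc : 0 ≤ Real.cos θ :=
      Real.cos_nonneg_of_neg_pi_div_two_le_of_le (by linarith [hθ.1, Real.pi_pos]) hθ.2
    have e1 : √(2 * (z * Real.cos θ ^ 2)) = √(2 * z) * Real.cos θ := by
      rw [← mul_assoc, Real.sqrt_mul (by positivity), Real.sqrt_sq hc]
    have e2 : √(2 * (z - z * Real.cos θ ^ 2)) = √(2 * z) * Real.sin θ := by
      rw [show 2 * (z - z * Real.cos θ ^ 2) = 2 * z * Real.sin θ ^ 2 by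
        rw [Real.sin_sq]; ring, Real.sqrt_mul (by positivity), Real.sqrt_sq hs]
    have e3 : √2 * √(2 * z) = 1 / √z * (2 * z) := by
      rw [h2z, ← mul_assoc, Real.mul_self_sqrt zero_le_two]
      field_simp
      rw [Real.sq_sqrt hz.le]
    simp only [Function.comp, e1, e2, e3]
    ring
  · intro σ σs
    simp [XB, norm_smul, -Real.sqrt_mul]
  · intro σ σs θ ϑ
    simp only [vPrimeSq, mul_zero, Real.sqrt_zero, zero_mul]
    rw [Real.sq_sqrt (by positivity)]
    ring

theorem gain_zero_right {Φ : ℝ → ℝ → ℝ} {C : ℝ} (h : IsGlobalFactor Φ C) {ψ : ℝ → ℝ}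
    (hψ : Continuous ψ) {K : ℝ} (hK : ∀ x, |ψ x| ≤ K) {y : ℝ} (hy : 0 < y) :
    4 * π * √2 * gain Φ ψ √(2 * y) √(2 * 0)
      = ∫ x in (0 : ℝ)..(y + 0), W Φ x y 0 * √x * ψ x := by
  have h2y : √(2 * y) = √2 * √y := Real.sqrt_mul zero_le_two y
  have hpy := Real.sqrt_pos.2 hy
  rw [gain_of_axis h hψ.measurable hK (V := √(2 * y)) (w := fun θ => y * Real.sin θ ^ 2)]
  · have hsub := intervalIntegral.integral_comp_mul_deriv (a := 0) (b := π / 2)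
      (f := fun θ => y * Real.sin θ ^ 2) (f' := fun θ => y * (2 * Real.sin θ * Real.cos θ))
      (g := fun x => 1 / √y * Φ √(2 * (y - x)) √(2 * x) * ψ x)
      (fun θ _ => by
        have := ((Real.hasDerivAt_sin θ).pow 2).const_mul y
        simpa using this) (by fun_prop)
      ((continuous_const.mul (h.continuous.comp (by fun_prop :
        Continuous fun x : ℝ => (√(2 * (y - x)), √(2 * x))))).mul hψ)
    simp only [Real.sin_zero, Real.sin_pi_div_two, one_pow, mul_one, ne_eq, OfNat.ofNat_ne_zero,
      not_false_eq_true, zero_pow, mul_zero] at hsub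
    have hR : ∫ x in (0 : ℝ)..(y + 0), W Φ x y 0 * √x * ψ x
        = ∫ x in (0 : ℝ)..y, 1 / √y * Φ √(2 * (y - x)) √(2 * x) * ψ x := by
      rw [add_zero, intervalIntegral.integral_of_le hy.le, intervalIntegral.integral_of_le hy.le,
        integral_Ioc_eq_integral_Ioo, integral_Ioc_eq_integral_Ioo]
      refine setIntegral_congr_fun measurableSet_Ioo fun x hx => ?_
      have hpx := Real.sqrt_pos.2 hx.1
      rw [W, if_neg (by simp), if_neg (fun hc => hx.1.ne' hc.1), if_neg (fun hc => hy.ne' hc.1),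
        if_pos ⟨rfl, hx.1, hx.2⟩, Real.sqrt_mul hx.1.le]
      field_simp
    rw [hR, ← hsub]
    refine intervalIntegral.integral_congr fun θ hθ => ?_
    rw [uIcc_of_le (by positivity)] at hθ
    have hs : 0 ≤ Real.sin θ :=
      Real.sin_nonneg_of_nonneg_of_le_pi hθ.1 (by linarith [hθ.2, Real.pi_pos])
    have hc : 0 ≤ Real.cos θ :=
      Real.cos_nonneg_of_neg_pi_div_two_le_of_le (by linarith [hθ.1, Real.pi_pos]) hθ.2
    have e1 : √(2 * (y * Real.sin θ ^ 2)) = √(2 * y) * Real.sin θ := by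
      rw [← mul_assoc, Real.sqrt_mul (by positivity), Real.sqrt_sq hs]
    have e2 : √(2 * (y - y * Real.sin θ ^ 2)) = √(2 * y) * Real.cos θ := by
      rw [show 2 * (y - y * Real.sin θ ^ 2) = 2 * y * Real.cos θ ^ 2 by
        rw [Real.sin_sq]; ring, Real.sqrt_mul (by positivity), Real.sqrt_sq hc]
    have e3 : √2 * √(2 * y) = 1 / √y * (2 * y) := by
      rw [h2y, ← mul_assoc, Real.mul_self_sqrt zero_le_two]
      field_simp
      rw [Real.sq_sqrt hy.le]
    simp only [Function.comp, e1, e2, e3]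
    ring
  · intro σ σs
    simp [XB, norm_smul, -Real.sqrt_mul]
  · intro σ σs θ ϑ
    simp only [vPrimeSq, mul_zero, Real.sqrt_zero, zero_mul]
    rw [Real.sq_sqrt (by positivity)]
    ring

theorem gain_eq_integral {Φ : ℝ → ℝ → ℝ} {C : ℝ} (h : IsGlobalFactor Φ C) {ψ : ℝ → ℝ}
    (hψ : Continuous ψ) {K : ℝ} (h0 : ∀ x, 0 ≤ ψ x) (hK : ∀ x, ψ x ≤ K) {y z : ℝ} (hy : 0 ≤ y)
    (hz : 0 ≤ z) :
    4 * π * √2 * gain Φ ψ √(2 * y) √(2 * z) = ∫ x in (0 : ℝ)..(y + z), W Φ x y z * √x * ψ x := by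
  have hK' : ∀ x, |ψ x| ≤ K := fun x => by rw [abs_of_nonneg (h0 x)]; exact hK x
  rcases hy.eq_or_lt with rfl | hy'
  · rcases hz.eq_or_lt with rfl | hz'
    · rw [gain_of_axis h hψ.measurable hK' (V := 0) (w := fun _ => 0)]
      · simp
      · intro σ σs
        simp [XB]
      · intro σ σs θ ϑ
        simp [vPrimeSq]
    · exact gain_zero_left h hψ hK' hz'
  · rcases hz.eq_or_lt with rfl | hz'
    · exact gain_zero_right h hψ hK' hy'
    · exact gain_eq_integral_of_pos h hψ.measurable h0 hK hy' hz'

/-- The reflection `x ↦ y + z - x` preserves `W √x dx` up to exchanging `y` and `z`, by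
`sqrt_mul_W_reflect`: the other outgoing particle is observed instead. -/
theorem gain_swap_eq_integral {Φ : ℝ → ℝ → ℝ} {C : ℝ} (h : IsGlobalFactor Φ C) {ψ : ℝ → ℝ}
    (hψ : Continuous ψ) {K : ℝ} (h0 : ∀ x, 0 ≤ ψ x) (hK : ∀ x, ψ x ≤ K) {y z : ℝ} (hy : 0 ≤ y)
    (hz : 0 ≤ z) :
    4 * π * √2 * gain Φ ψ √(2 * z) √(2 * y)
      = ∫ x in (0 : ℝ)..(y + z), W Φ x y z * √x * ψ (xStar x y z) := by
  rw [gain_eq_integral h hψ h0 hK hz hy]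
  have e := intervalIntegral.integral_comp_sub_left (a := 0) (b := y + z)
    (fun x => W Φ x z y * √x * ψ x) (y + z)
  rw [sub_self, sub_zero] at e
  rw [add_comm z y, ← e, intervalIntegral.integral_of_le (by positivity),
    intervalIntegral.integral_of_le (by positivity), integral_Ioc_eq_integral_Ioo,
    integral_Ioc_eq_integral_Ioo]
  refine setIntegral_congr_fun measurableSet_Ioo fun x hx => ?_
  have hr := sqrt_mul_W_reflect Φ hx.1 hy hz hx.2
  rw [mul_comm (W Φ (y + z - x) z y), hr, xStar, max_eq_left (by linarith [hx.2]), mul_comm √x]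

/-! ### Symmetrized pointwise identities and uniform bounds. -/

/-- A test function extended to the whole line, with explicit bounds on it and on its second
differences. -/
structure IsGlobalTest (φ : ℝ → ℝ) (K L : ℝ) : Prop where
  continuous : Continuous φ
  abs_le : ∀ x, |φ x| ≤ K
  abs_Delta_le : ∀ x y z : ℝ, 0 ≤ x → 0 ≤ y → 0 ≤ z → x ≤ y + z →
    |Delta φ x y z| ≤ L * (|x - y| * |x - z|)

theorem measurable_Delta {φ : ℝ → ℝ} (hφ : Continuous φ) :
    Measurable fun p : ℝ × ℝ × ℝ => Delta φ p.1 p.2.1 p.2.2 := by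
  unfold Delta xStar
  have := hφ.measurable
  fun_prop

theorem measurable_calK {Φ : ℝ → ℝ → ℝ} {C : ℝ} (h : IsGlobalFactor Φ C) {φ : ℝ → ℝ}
    (hφ : Continuous φ) : Measurable fun p : ℝ × ℝ × ℝ => calK Φ φ p.1 p.2.1 p.2.2 :=
  (measurable_W h).mul (measurable_Delta hφ)

theorem measurable_calJ {Φ : ℝ → ℝ → ℝ} {C : ℝ} (h : IsGlobalFactor Φ C) {φ : ℝ → ℝ}
    (hφ : Continuous φ) : Measurable fun p : ℝ × ℝ => calJ Φ φ p.1 p.2 := by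
  refine (measurable_intervalIntegral (α := ℝ × ℝ) measurable_const (by fun_prop) ?_).const_mul _
  exact ((measurable_calK h hφ).comp (f := fun q : (ℝ × ℝ) × ℝ => (q.2, q.1.1, q.1.2))
    (by fun_prop)).mul (by fun_prop)

theorem measurable_cubicWeight {Φ : ℝ → ℝ → ℝ} {C : ℝ} (h : IsGlobalFactor Φ C) :
    Measurable fun p : ℝ × ℝ × ℝ => cubicWeight Φ p.1 p.2.1 p.2.2 := by
  have hπ : (0 : ℝ) ≤ 2 * π := by positivity
  simp only [cubicWeight, intervalIntegral.integral_of_le hπ]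
  have h0 : Measurable fun q : (((ℝ × ℝ × ℝ) × S2) × S2) × ℝ =>
      cubicIntegrand Φ q.1.1.1.1 q.1.1.1.2.1 q.1.1.1.2.2 q.1.1.2 q.1.2 q.2 :=
    measurable_cubicIntegrand_comp h (by fun_prop) (by fun_prop) (by fun_prop) (by fun_prop)
      (by fun_prop) (by fun_prop)
  have h1 : StronglyMeasurable fun q : ((ℝ × ℝ × ℝ) × S2) × S2 => ∫ ϑ in Ioc 0 (2 * π),
      cubicIntegrand Φ q.1.1.1 q.1.1.2.1 q.1.1.2.2 q.1.2 q.2 ϑ :=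
    h0.stronglyMeasurable.integral_prod_right'
  have h2 : StronglyMeasurable fun q : (ℝ × ℝ × ℝ) × S2 => ∫ σ', (∫ ϑ in Ioc 0 (2 * π),
      cubicIntegrand Φ q.1.1 q.1.2.1 q.1.2.2 q.2 σ' ϑ) ∂surf := h1.integral_prod_right'
  have h3 : StronglyMeasurable fun q : ℝ × ℝ × ℝ => ∫ σ, ∫ σ', (∫ ϑ in Ioc 0 (2 * π),
      cubicIntegrand Φ q.1 q.2.1 q.2.2 σ σ' ϑ) ∂surf ∂surf := h2.integral_prod_right'
  exact h3.measurable.const_mul _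

theorem measurable_KB {Φ : ℝ → ℝ → ℝ} {C : ℝ} (h : IsGlobalFactor Φ C) {φ : ℝ → ℝ}
    (hφ : Continuous φ) : Measurable fun p : ℝ × ℝ × ℝ => KB Φ φ p.1 p.2.1 p.2.2 := by
  have hD : Measurable fun p : ℝ × ℝ × ℝ =>
      Delta φ (p.1 ^ 2 / 2) (p.2.1 ^ 2 / 2) (p.2.2 ^ 2 / 2) :=
    (measurable_Delta hφ).comp
      (f := fun p : ℝ × ℝ × ℝ => (p.1 ^ 2 / 2, p.2.1 ^ 2 / 2, p.2.2 ^ 2 / 2)) (by fun_prop)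
  have hg : Measurable fun p : ℝ × ℝ × ℝ => (p.2.1 - p.1) * (p.2.2 - p.1) := by fun_prop
  have e : (fun p : ℝ × ℝ × ℝ => KB Φ φ p.1 p.2.1 p.2.2)
      = {p : ℝ × ℝ × ℝ | (p.2.1 - p.1) * (p.2.2 - p.1) = 0}ᶜ.indicator (fun p =>
        cubicWeight Φ p.1 p.2.1 p.2.2 *
          Delta φ (p.1 ^ 2 / 2) (p.2.1 ^ 2 / 2) (p.2.2 ^ 2 / 2)) := by
    ext p
    by_cases hp : (p.2.1 - p.1) * (p.2.2 - p.1) = 0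
    · rw [indicator_of_notMem
        (show p ∉ {p : ℝ × ℝ × ℝ | (p.2.1 - p.1) * (p.2.2 - p.1) = 0}ᶜ from not_not.2 hp), KB, if_neg (not_not.2 hp)]
    · rw [indicator_of_mem (show p ∈ {p : ℝ × ℝ × ℝ | (p.2.1 - p.1) * (p.2.2 - p.1) = 0}ᶜ from hp)]
      exact KB_eq Φ φ (fun h1 => hp (by rw [h1]; ring)) (fun h1 => hp (by rw [h1]; ring))
  rw [e]
  exact ((measurable_cubicWeight h).mul hD).indicator
    (measurableSet_eq_fun hg measurable_const).compl

theorem measurable_JB {Φ : ℝ → ℝ → ℝ} {C : ℝ} (h : IsGlobalFactor Φ C) {φ : ℝ → ℝ} {K L : ℝ}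
    (hφ : IsGlobalTest φ K L) : Measurable fun p : ℝ × ℝ => JB Φ φ p.1 p.2 := by
  have hm := hφ.continuous.measurable
  simp_rw [JB_eq_gain h hm hφ.abs_le]
  have h1 : Measurable fun p : ℝ × ℝ => φ (p.1 ^ 2 / 2) := by fun_prop
  exact (measurable_gain h hm).sub (h1.mul (measurable_gain h measurable_one))

theorem abs_calK_le {Φ : ℝ → ℝ → ℝ} {C : ℝ} (h : IsGlobalFactor Φ C) {φ : ℝ → ℝ} {K L : ℝ}
    (hφ : IsGlobalTest φ K L) {x y z : ℝ} (hx : 0 ≤ x) (hy : 0 ≤ y) (hz : 0 ≤ z) :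
    |calK Φ φ x y z| ≤ (4 * K + |L|) * C := by
  have hC := h.bound_nonneg
  have hK : 0 ≤ K := (abs_nonneg _).trans (hφ.abs_le 0)
  have hW := W_nonneg h hx hy hz
  rw [calK, abs_mul, abs_of_nonneg hW]
  rcases le_or_gt x (y + z) with hle | hlt
  · have h1 := hφ.abs_Delta_le x y z hx hy hz hle
    have h2 : |Delta φ x y z| ≤ 4 * K := by
      have a1 := abs_le.1 (hφ.abs_le x)
      have a2 := abs_le.1 (hφ.abs_le y)
      have a3 := abs_le.1 (hφ.abs_le z)
      have a4 := abs_le.1 (hφ.abs_le (xStar x y z))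
      unfold Delta
      exact abs_le.2 ⟨by linarith, by linarith⟩
    set t := |x - y| * |x - z| with ht
    have ht0 : 0 ≤ t := by positivity
    have hsq := Real.mul_self_sqrt ht0
    have hs0 := Real.sqrt_nonneg t
    -- Interpolation between the two bounds: `4K` is used when `√t ≥ 1`, and `L t ≤ |L| √t`
    -- otherwise.
    have h3 : |Delta φ x y z| ≤ (4 * K + |L|) * √t := by
      rcases le_total 1 (√t) with h4 | h4
      · nlinarith [mul_nonneg (abs_nonneg L) hs0]
      · have : L * t ≤ |L| * t := mul_le_mul_of_nonneg_right (le_abs_self L) ht0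
        have h5 : t ≤ √t := by nlinarith
        have h6 := mul_le_mul_of_nonneg_left h5 (abs_nonneg L)
        nlinarith [mul_nonneg hK hs0]
    calc _ ≤ W Φ x y z * ((4 * K + |L|) * √t) := mul_le_mul_of_nonneg_left h3 hW
      _ = (4 * K + |L|) * (W Φ x y z * √t) := by ring
      _ ≤ _ := mul_le_mul_of_nonneg_left (W_mul_sqrt_le h hx hy hz) (by positivity)
  · have hs : xStar x y z = 0 := max_eq_right (by linarith)
    have hx0 : x ≠ 0 := by linarith
    have h3 : ¬ x < z := by linarith
    have h4 : ¬ x < y := by linarith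
    have : W Φ x y z = 0 := by simp [W, hs, hx0, h3, h4]
    rw [this, zero_mul]
    positivity

theorem integral_W_le {Φ : ℝ → ℝ → ℝ} {C : ℝ} (h : IsGlobalFactor Φ C) {y z : ℝ} (hy : 0 ≤ y)
    (hz : 0 ≤ z) : ∫ x in (0 : ℝ)..(y + z), W Φ x y z * √x ≤ C * (1 + y + z) := by
  have hC := h.bound_nonneg
  rcases (add_nonneg hy hz).eq_or_lt with h0 | h0
  · rw [← h0, intervalIntegral.integral_same]
    positivity
  have hmax : 0 < max y z := by
    by_contra hc
    have h1 := le_max_left y z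
    have h2 := le_max_right y z
    linarith
  have hs := Real.sqrt_pos.2 hmax
  have hb : ‖∫ x in Ioo (0 : ℝ) (y + z), W Φ x y z * √x‖ ≤ C / √(max y z) * (y + z) := by
    have := norm_setIntegral_le_of_norm_le_const (μ := volume) (s := Ioo 0 (y + z))
      (f := fun x => W Φ x y z * √x) (C := C / √(max y z)) measure_Ioo_lt_top fun x hx => by
        have hW := sqrt_mul_W_le h hx.1 hy hz hx.2
        rw [← le_div_iff₀ hs] at hW
        rwa [Real.norm_of_nonneg (mul_nonneg (W_nonneg h hx.1.le hy hz) (Real.sqrt_nonneg _))]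
    rwa [measureReal_def, Real.volume_Ioo, sub_zero, ENNReal.toReal_ofReal h0.le] at this
  rw [intervalIntegral.integral_of_le h0.le, integral_Ioc_eq_integral_Ioo]
  refine (le_abs_self _).trans (hb.trans ?_)
  rw [div_mul_eq_mul_div, mul_div_assoc]
  refine mul_le_mul_of_nonneg_left ?_ hC
  rw [div_le_iff₀ hs]
  have hsq := Real.mul_self_sqrt hmax.le
  have h1 := le_max_left y z
  have h2 := le_max_right y z
  have h3 : max y z ≤ y + z := max_le (by linarith) (by linarith)
  -- With `m = max y z`, `(y + z)/√m ≤ 2√m ≤ 1 + m`.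
  nlinarith [sq_nonneg (√(max y z) - 1)]

/-- Permits shifting `φ` to be nonnegative, as the gain formulas require. -/
theorem JB_add_const (Φ : ℝ → ℝ → ℝ) (φ : ℝ → ℝ) (K r rs : ℝ) :
    JB Φ (fun x => φ x + K) r rs = JB Φ φ r rs := by
  simp only [JB, add_sub_add_right_eq_sub]

theorem JB_eq_integral {Φ : ℝ → ℝ → ℝ} {C : ℝ} (h : IsGlobalFactor Φ C) {φ : ℝ → ℝ} {K L : ℝ}
    (hφ : IsGlobalTest φ K L) {y z : ℝ} (hy : 0 ≤ y) (hz : 0 ≤ z) :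
    4 * π * √2 * JB Φ φ √(2 * y) √(2 * z)
      = (∫ x in (0 : ℝ)..(y + z), W Φ x y z * √x * (φ x + K))
        - (φ y + K) * ∫ x in (0 : ℝ)..(y + z), W Φ x y z * √x := by
  have h0 : ∀ x, 0 ≤ φ x + K := fun x => by linarith [(abs_le.1 (hφ.abs_le x)).1]
  have h2 : ∀ x, φ x + K ≤ 2 * K := fun x => by linarith [(abs_le.1 (hφ.abs_le x)).2]
  have hc : Continuous fun x => φ x + K := hφ.continuous.add_const K
  have e1 := gain_eq_integral h hc h0 h2 hy hz
  have e2 := gain_eq_integral (Φ := Φ) (ψ := 1) (K := 1) h continuous_one (by simp) (by simp) hy hz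
  simp only [Pi.one_apply, mul_one] at e2
  rw [← JB_add_const Φ φ K, JB_eq_gain h hc.measurable (K := 2 * K)
    (fun x => by rw [abs_of_nonneg (h0 x)]; exact h2 x), Real.sq_sqrt (by positivity), mul_sub,
    e1, ← e2]
  simp only [mul_div_cancel_left₀ y two_ne_zero]
  ring

theorem JB_swap_eq_integral {Φ : ℝ → ℝ → ℝ} {C : ℝ} (h : IsGlobalFactor Φ C) {φ : ℝ → ℝ} {K L : ℝ}
    (hφ : IsGlobalTest φ K L) {y z : ℝ} (hy : 0 ≤ y) (hz : 0 ≤ z) :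
    4 * π * √2 * JB Φ φ √(2 * z) √(2 * y)
      = (∫ x in (0 : ℝ)..(y + z), W Φ x y z * √x * (φ (xStar x y z) + K))
        - (φ z + K) * ∫ x in (0 : ℝ)..(y + z), W Φ x y z * √x := by
  have h0 : ∀ x, 0 ≤ φ x + K := fun x => by linarith [(abs_le.1 (hφ.abs_le x)).1]
  have h2 : ∀ x, φ x + K ≤ 2 * K := fun x => by linarith [(abs_le.1 (hφ.abs_le x)).2]
  have hc : Continuous fun x => φ x + K := hφ.continuous.add_const K
  have e1 := gain_swap_eq_integral h hc h0 h2 hy hz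
  have e2 := gain_swap_eq_integral (Φ := Φ) (ψ := 1) (K := 1) h continuous_one (by simp) (by simp)
    hy hz
  simp only [Pi.one_apply, mul_one] at e2
  rw [← JB_add_const Φ φ K, JB_eq_gain h hc.measurable (K := 2 * K)
    (fun x => by rw [abs_of_nonneg (h0 x)]; exact h2 x), Real.sq_sqrt (by positivity), mul_sub,
    e1, ← e2]
  simp only [mul_div_cancel_left₀ z two_ne_zero]
  ring

/-- The two gains contribute `φ(x)` and `φ(x_*)`, the two losses `φ(y)` and `φ(z)`, all against `W
√x dx`; the shifts by `K` cancel. -/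
theorem JB_add_swap {Φ : ℝ → ℝ → ℝ} {C : ℝ} (h : IsGlobalFactor Φ C) {φ : ℝ → ℝ} {K L : ℝ}
    (hφ : IsGlobalTest φ K L) {y z : ℝ} (hy : 0 ≤ y) (hz : 0 ≤ z) :
    4 * π * √2 * JB Φ φ √(2 * y) √(2 * z) + 4 * π * √2 * JB Φ φ √(2 * z) √(2 * y)
      = 2 * calJ Φ φ y z := by
  have hb : ∀ x, |φ x + K| ≤ K + |K| := fun x =>
    (abs_add_le _ _).trans (add_le_add (hφ.abs_le x) le_rfl)
  have hm := hφ.continuous.measurable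
  have hyz : 0 ≤ y + z := by positivity
  have i1 : IntervalIntegrable (fun x => W Φ x y z * √x * (φ x + K)) volume 0 (y + z) :=
    (intervalIntegrable_iff_integrableOn_Ioc_of_le hyz).2
      (integrableOn_W_mul h (hm.add_const K) hb hy hz)
  have i2 : IntervalIntegrable (fun x => W Φ x y z * √x * (φ (xStar x y z) + K))
      volume 0 (y + z) :=
    (intervalIntegrable_iff_integrableOn_Ioc_of_le hyz).2
      (integrableOn_W_mul h (ψ := fun x => φ (xStar x y z) + K)
        (by unfold xStar; fun_prop) (fun x => hb _) hy hz)
  have i3 : IntervalIntegrable (fun x => W Φ x y z * √x) volume 0 (y + z) := by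
    have := integrableOn_W_mul h (ψ := 1) measurable_one (K := 1) (by simp) hy hz
    simp only [Pi.one_apply, mul_one] at this
    exact (intervalIntegrable_iff_integrableOn_Ioc_of_le hyz).2 this
  rw [JB_eq_integral h hφ hy hz, JB_swap_eq_integral h hφ hy hz, calJ]
  have e : ∫ x in (0 : ℝ)..(y + z), calK Φ φ x y z * √x
      = ∫ x in (0 : ℝ)..(y + z), (W Φ x y z * √x * (φ x + K) +
        W Φ x y z * √x * (φ (xStar x y z) + K)) - (φ y + K + (φ z + K)) * (W Φ x y z * √x) := by
    refine intervalIntegral.integral_congr fun x _ => ?_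
    simp only [calK, Delta]
    ring
  rw [e, intervalIntegral.integral_sub (i1.add i2) (i3.const_mul _),
    intervalIntegral.integral_add i1 i2, intervalIntegral.integral_const_mul]
  ring

theorem abs_JB_le {Φ : ℝ → ℝ → ℝ} {C : ℝ} (h : IsGlobalFactor Φ C) {φ : ℝ → ℝ} {K L : ℝ}
    (hφ : IsGlobalTest φ K L) {y z : ℝ} (hy : 0 ≤ y) (hz : 0 ≤ z) :
    |4 * π * √2 * JB Φ φ √(2 * y) √(2 * z)| ≤ 2 * K * C * (1 + y + z) := by
  have h0 : ∀ x, 0 ≤ φ x + K := fun x => by linarith [(abs_le.1 (hφ.abs_le x)).1]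
  have h2 : ∀ x, φ x + K ≤ 2 * K := fun x => by linarith [(abs_le.1 (hφ.abs_le x)).2]
  have hK : 0 ≤ K := (abs_nonneg _).trans (hφ.abs_le 0)
  have hm := hφ.continuous.measurable
  have hyz : 0 ≤ y + z := by positivity
  have i1 : IntervalIntegrable (fun x => W Φ x y z * √x * (φ x + K)) volume 0 (y + z) :=
    (intervalIntegrable_iff_integrableOn_Ioc_of_le hyz).2
      (integrableOn_W_mul h (hm.add_const K) (K := 2 * K)
        (fun x => by rw [abs_of_nonneg (h0 x)]; exact h2 x) hy hz)
  have i3 : IntervalIntegrable (fun x => W Φ x y z * √x) volume 0 (y + z) := by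
    have := integrableOn_W_mul h (ψ := 1) measurable_one (K := 1) (by simp) hy hz
    simp only [Pi.one_apply, mul_one] at this
    exact (intervalIntegrable_iff_integrableOn_Ioc_of_le hyz).2 this
  have hWn : ∀ x ∈ Icc 0 (y + z), 0 ≤ W Φ x y z * √x := fun x hx =>
    mul_nonneg (W_nonneg h hx.1 hy hz) (Real.sqrt_nonneg _)
  have hG := integral_W_le h hy hz
  have hG0 : 0 ≤ ∫ x in (0 : ℝ)..(y + z), W Φ x y z * √x :=
    intervalIntegral.integral_nonneg hyz hWn
  have hA0 : 0 ≤ ∫ x in (0 : ℝ)..(y + z), W Φ x y z * √x * (φ x + K) :=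
    intervalIntegral.integral_nonneg hyz fun x hx => mul_nonneg (hWn x hx) (h0 x)
  have hA : ∫ x in (0 : ℝ)..(y + z), W Φ x y z * √x * (φ x + K)
      ≤ 2 * K * ∫ x in (0 : ℝ)..(y + z), W Φ x y z * √x := by
    rw [← intervalIntegral.integral_const_mul]
    refine intervalIntegral.integral_mono_on hyz i1 (i3.const_mul _) fun x hx => ?_
    rw [mul_comm (2 * K)]
    exact mul_le_mul_of_nonneg_left (h2 x) (hWn x hx)
  have hB := mul_le_mul_of_nonneg_right (h2 y) hG0
  have hB0 := mul_nonneg (h0 y) hG0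
  have hGK := mul_le_mul_of_nonneg_left hG (show 0 ≤ 2 * K by positivity)
  rw [JB_eq_integral h hφ hy hz]
  exact abs_le.2 ⟨by linarith, by linarith⟩

theorem abs_calJ_le {Φ : ℝ → ℝ → ℝ} {C : ℝ} (h : IsGlobalFactor Φ C) {φ : ℝ → ℝ} {K L : ℝ}
    (hφ : IsGlobalTest φ K L) {y z : ℝ} (hy : 0 ≤ y) (hz : 0 ≤ z) :
    |calJ Φ φ y z| ≤ 2 * K * C * (1 + y + z) := by
  have e := JB_add_swap h hφ hy hz
  have h1 := abs_le.1 (abs_JB_le h hφ hy hz)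
  have h2 := abs_le.1 (abs_JB_le h hφ hz hy)
  exact abs_le.2 ⟨by linarith [h1.1, h2.1], by linarith [h1.2, h2.2]⟩

theorem abs_KB_le {Φ : ℝ → ℝ → ℝ} {C : ℝ} (h : IsGlobalFactor Φ C) {φ : ℝ → ℝ} {K L : ℝ}
    (hφ : IsGlobalTest φ K L) {x y z : ℝ} (hx : 0 ≤ x) (hy : 0 ≤ y) (hz : 0 ≤ z) :
    |32 * π ^ 2 * KB Φ φ √(2 * x) √(2 * y) √(2 * z)| ≤ 2 * ((4 * K + |L|) * C) := by
  obtain ⟨v, w, hv, hw, e1, -, e3⟩ := exists_cubic_weights h φ hx hy hz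
  rw [e1, abs_mul, abs_of_nonneg hv]
  calc _ ≤ (v + w) * |Delta φ x y z| := by
        refine mul_le_mul_of_nonneg_right (by linarith) (abs_nonneg _)
    _ = 2 * |calK Φ φ x y z| := by
        rw [← abs_of_nonneg (add_nonneg hv hw), ← abs_mul, e3, abs_mul, abs_two]
    _ ≤ _ := mul_le_mul_of_nonneg_left (abs_calK_le h hφ hx hy hz) zero_le_two

theorem KB_add_swap {Φ : ℝ → ℝ → ℝ} {C : ℝ} (h : IsGlobalFactor Φ C) (φ : ℝ → ℝ)
    {x y z : ℝ} (hx : 0 ≤ x) (hy : 0 ≤ y) (hz : 0 ≤ z) :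
    32 * π ^ 2 * KB Φ φ √(2 * x) √(2 * y) √(2 * z)
      + 32 * π ^ 2 * KB Φ φ √(2 * x) √(2 * z) √(2 * y) = 2 * calK Φ φ x y z := by
  obtain ⟨v, w, -, -, e1, e2, e3⟩ := exists_cubic_weights h φ hx hy hz
  rw [e1, e2, ← e3, add_mul]

/-! ### Extending the data off the half-line and reducing to global hypotheses. -/

/-- Extension of a function on `[0, ∞)²` to the plane by its values at the positive parts. -/
def extendFactor (Φ : ℝ → ℝ → ℝ) (r ρ : ℝ) : ℝ := Φ (max r 0) (max ρ 0)

/-- Extension of a function on `[0, ∞)` to the line by its value at `0`. -/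
def extendTest (φ : ℝ → ℝ) (x : ℝ) : ℝ := φ (max x 0)

theorem extendFactor_apply (Φ : ℝ → ℝ → ℝ) {r ρ : ℝ} (hr : 0 ≤ r) (hρ : 0 ≤ ρ) :
    extendFactor Φ r ρ = Φ r ρ := by
  rw [extendFactor, max_eq_left hr, max_eq_left hρ]

theorem extendTest_apply (φ : ℝ → ℝ) {x : ℝ} (hx : 0 ≤ x) : extendTest φ x = φ x := by
  rw [extendTest, max_eq_left hx]

theorem IsKernelFactor.exists_isGlobalFactor {Φ : ℝ → ℝ → ℝ} (h : IsKernelFactor Φ) :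
    ∃ C, IsGlobalFactor (extendFactor Φ) C := by
  obtain ⟨C, hC⟩ := h.bounded
  refine ⟨C, ?_, fun r ρ => h.nonneg _ _ (le_max_right _ _) (le_max_right _ _),
    fun r ρ => hC _ _ (le_max_right _ _) (le_max_right _ _),
    fun r ρ => h.symmetric _ _ (le_max_right _ _) (le_max_right _ _)⟩
  exact h.continuousOn.comp_continuous
    (f := fun p : ℝ × ℝ => (max p.1 0, max p.2 0)) (by fun_prop)
    fun p => ⟨mem_Ici.2 (le_max_right p.1 0), mem_Ici.2 (le_max_right p.2 0)⟩

theorem W_extend (Φ : ℝ → ℝ → ℝ) {x y z : ℝ} : W (extendFactor Φ) x y z = W Φ x y z := by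
  unfold W
  have hI : ∫ s in (max |√x - √y| |√(xStar x y z) - √z|)..(min (√x + √y) (√(xStar x y z) + √z)),
        ∫ θ in (0 : ℝ)..(2 * π), extendFactor Φ (√2 * s) (√2 * YStar x y z s θ)
      = ∫ s in (max |√x - √y| |√(xStar x y z) - √z|)..(min (√x + √y) (√(xStar x y z) + √z)),
        ∫ θ in (0 : ℝ)..(2 * π), Φ (√2 * s) (√2 * YStar x y z s θ) := by
    refine intervalIntegral.integral_congr fun s hs => ?_
    have hs0 : 0 ≤ s := by
      refine le_trans (le_min ?_ ?_) hs.1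
      · exact (abs_nonneg _).trans (le_max_left _ _)
      · exact le_min (by positivity) (by positivity)
    refine intervalIntegral.integral_congr fun θ _ => ?_
    exact extendFactor_apply Φ (by positivity) (mul_nonneg (by positivity) (YStar_nonneg _ _ _ _ _))
  rw [hI]
  simp only [extendFactor_apply Φ (Real.sqrt_nonneg _) (Real.sqrt_nonneg _)]

theorem Delta_extend (φ : ℝ → ℝ) {x y z : ℝ} (hx : 0 ≤ x) (hy : 0 ≤ y) (hz : 0 ≤ z) :
    Delta (extendTest φ) x y z = Delta φ x y z := by
  unfold Delta
  rw [extendTest_apply φ hx, extendTest_apply φ hy, extendTest_apply φ hz,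
    extendTest_apply φ (show 0 ≤ xStar x y z from le_max_right _ _)]

theorem calK_extend (Φ : ℝ → ℝ → ℝ) (φ : ℝ → ℝ) {x y z : ℝ} (hx : 0 ≤ x) (hy : 0 ≤ y)
    (hz : 0 ≤ z) : calK (extendFactor Φ) (extendTest φ) x y z = calK Φ φ x y z := by
  rw [calK, calK, W_extend, Delta_extend φ hx hy hz]

theorem calJ_extend (Φ : ℝ → ℝ → ℝ) (φ : ℝ → ℝ) {y z : ℝ} (hy : 0 ≤ y) (hz : 0 ≤ z) :
    calJ (extendFactor Φ) (extendTest φ) y z = calJ Φ φ y z := by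
  rw [calJ, calJ]
  congr 1
  refine intervalIntegral.integral_congr fun x hx => ?_
  rw [uIcc_of_le (by positivity)] at hx
  rw [calK_extend Φ φ hx.1 hy hz]

/-- Completing the square suffices, since `|√(1 - ⟪σ, σ_*⟫²) cos ϑ| ≤ 1`. It guarantees that the
test function is only evaluated on `[0, ∞)`. -/
theorem vPrimeSq_nonneg (r rs : ℝ) (σ σs : S2) (θ ϑ : ℝ) : 0 ≤ vPrimeSq r rs σ σs θ ϑ := by
  have hw : √(1 - ⟪(σ : R3), (σs : R3)⟫_ℝ ^ 2) ≤ 1 := by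
    refine Real.sqrt_le_iff.2 ⟨zero_le_one, ?_⟩
    linarith [sq_nonneg ⟪(σ : R3), (σs : R3)⟫_ℝ]
  have hw0 := Real.sqrt_nonneg (1 - ⟪(σ : R3), (σs : R3)⟫_ℝ ^ 2)
  unfold vPrimeSq
  set w := √(1 - ⟪(σ : R3), (σs : R3)⟫_ℝ ^ 2)
  have hk : (w * Real.cos ϑ) ^ 2 ≤ 1 := by
    rw [mul_pow]
    exact mul_le_one₀ (pow_le_one₀ hw0 hw) (sq_nonneg _) (Real.cos_sq_le_one ϑ)
  have e : r ^ 2 * Real.sin θ ^ 2 + rs ^ 2 * Real.cos θ ^ 2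
      - 2 * r * rs * Real.sin θ * Real.cos θ * w * Real.cos ϑ
      = (r * Real.sin θ - rs * Real.cos θ * (w * Real.cos ϑ)) ^ 2
        + (rs * Real.cos θ) ^ 2 * (1 - (w * Real.cos ϑ) ^ 2) := by ring
  rw [e]
  have := sub_nonneg.2 hk
  positivity

theorem JB_extend (Φ : ℝ → ℝ → ℝ) (φ : ℝ → ℝ) (r rs : ℝ) :
    JB (extendFactor Φ) (extendTest φ) r rs = JB Φ φ r rs := by
  have hφ : ∀ σ σs θ ϑ, extendTest φ (vPrimeSq r rs σ σs θ ϑ / 2) = φ (vPrimeSq r rs σ σs θ ϑ / 2) :=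
    fun σ σs θ ϑ => extendTest_apply φ (div_nonneg (vPrimeSq_nonneg _ _ _ _ _ _) zero_le_two)
  have hφ' : extendTest φ (r ^ 2 / 2) = φ (r ^ 2 / 2) := extendTest_apply φ (by positivity)
  unfold JB
  simp only [hφ, hφ']
  congr 1
  refine integral_congr_ae (ae_of_all _ fun σ => integral_congr_ae (ae_of_all _ fun σs => ?_))
  refine intervalIntegral.integral_congr fun θ hθ => ?_
  rw [uIcc_of_le (by positivity)] at hθ
  have hs : 0 ≤ Real.sin θ :=
    Real.sin_nonneg_of_nonneg_of_le_pi hθ.1 (by linarith [hθ.2, Real.pi_pos])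
  have hc : 0 ≤ Real.cos θ :=
    Real.cos_nonneg_of_neg_pi_div_two_le_of_le (by linarith [hθ.1, Real.pi_pos]) hθ.2
  simp only [kernelB]
  rw [extendFactor_apply Φ (mul_nonneg (norm_nonneg _) hc) (mul_nonneg (norm_nonneg _) hs)]

theorem KB_extend (Φ : ℝ → ℝ → ℝ) (φ : ℝ → ℝ) (r r' rs' : ℝ) :
    KB (extendFactor Φ) (extendTest φ) r r' rs' = KB Φ φ r r' rs' := by
  unfold KB
  have hX : ∀ σ σ' : S2, 0 ≤ XB r r' σ σ' := fun σ σ' => norm_nonneg _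
  simp only [Delta_extend φ (show 0 ≤ r ^ 2 / 2 by positivity)
    (show 0 ≤ r' ^ 2 / 2 by positivity) (show 0 ≤ rs' ^ 2 / 2 by positivity),
    extendFactor_apply Φ (hX _ _) (YB_nonneg _ _ _ _ _ _)]

/-- With `d = y - x`, `Δφ` is the increment of `t ↦ φ(t + d) - φ(t)` from `x` to `z`, and the
derivative of this function is at most `L|d|`. The base point `max 0 (-d)` keeps both `t` and `t +
d` nonnegative. -/
theorem abs_Delta_le_of_deriv {φ φ' : ℝ → ℝ} {L : ℝ}
    (h1 : ∀ x ∈ Ici (0 : ℝ), HasDerivWithinAt φ (φ' x) (Ici 0) x)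
    (h2 : ∀ x ∈ Ici (0 : ℝ), ∀ y ∈ Ici (0 : ℝ), |φ' y - φ' x| ≤ L * |y - x|)
    {x y z : ℝ} (hx : 0 ≤ x) (hy : 0 ≤ y) (hz : 0 ≤ z) (hxyz : x ≤ y + z) :
    |Delta φ x y z| ≤ L * (|x - y| * |x - z|) := by
  set d := y - x with hd
  have hmaps : MapsTo (fun t => t + d) (Ici (max 0 (-d))) (Ici 0) := fun t ht => by
    have : max 0 (-d) ≤ t := ht
    have := (le_max_right _ _).trans this
    simp only [mem_Ici]
    linarith
  have hsub : Ici (max 0 (-d)) ⊆ Ici (0 : ℝ) := Ici_subset_Ici.2 (le_max_left _ _)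
  have hderiv : ∀ t ∈ Ici (max 0 (-d)), HasDerivWithinAt (fun t => φ (t + d) - φ t)
      (φ' (t + d) - φ' t) (Ici (max 0 (-d))) t := fun t ht => by
    have a := (h1 (t + d) (hmaps ht)).comp t
      (((hasDerivAt_id' t).add_const d).hasDerivWithinAt (s := Ici (max 0 (-d)))) hmaps
    rw [mul_one] at a
    exact a.sub ((h1 t (hsub ht)).mono hsub)
  have hxm : x ∈ Ici (max 0 (-d)) := max_le hx (by rw [hd]; linarith)
  have hzm : z ∈ Ici (max 0 (-d)) := max_le hz (by rw [hd]; linarith)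
  have key := (convex_Ici (max 0 (-d))).norm_image_sub_le_of_norm_hasDerivWithin_le
    (C := L * |d|) hderiv (fun t ht => by
      have := h2 t (hsub ht) (t + d) (hmaps ht)
      rwa [add_sub_cancel_left] at this) hxm hzm
  rw [Real.norm_eq_abs, Real.norm_eq_abs] at key
  have e : Delta φ x y z = φ (z + d) - φ z - (φ (x + d) - φ x) := by
    unfold Delta xStar
    rw [max_eq_left (by linarith), hd, show z + (y - x) = y + z - x by ring,
      show x + (y - x) = y by ring]
    ring
  rw [e, abs_sub_comm x y, abs_sub_comm x z, ← mul_assoc]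
  exact key

theorem MemCb.exists_isGlobalTest {φ : ℝ → ℝ} (h : MemCb 2 φ) :
    ∃ K L, IsGlobalTest (extendTest φ) K L := by
  obtain ⟨hd, hb⟩ := h
  obtain ⟨K, hK⟩ := hb 0 (by norm_num)
  obtain ⟨L, hL⟩ := hb 2 le_rfl
  simp only [iteratedDerivWithin_zero] at hK
  have hu : UniqueDiffOn ℝ (Ici (0 : ℝ)) := uniqueDiffOn_Ici 0
  have d0 : DifferentiableOn ℝ φ (Ici 0) := hd.differentiableOn (by norm_num)
  have d1 : DifferentiableOn ℝ (derivWithin φ (Ici 0)) (Ici 0) := by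
    have := hd.differentiableOn_iteratedDerivWithin (m := 1) (by norm_num) hu
    rwa [iteratedDerivWithin_one] at this
  have hL' : ∀ x ∈ Ici (0 : ℝ), ‖derivWithin (derivWithin φ (Ici 0)) (Ici 0) x‖ ≤ L := by
    intro x hx
    have := hL x hx
    rw [iteratedDerivWithin_succ, iteratedDerivWithin_one] at this
    exact this
  refine ⟨K, L, ?_, fun x => hK _ (mem_Ici.2 (le_max_right x 0)), fun x y z hx hy hz hxyz => ?_⟩
  · exact hd.continuousOn.comp_continuous (f := fun x : ℝ => max x 0) (by fun_prop)
      fun x => mem_Ici.2 (le_max_right x 0)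
  · rw [Delta_extend φ hx hy hz]
    refine abs_Delta_le_of_deriv (φ' := derivWithin φ (Ici 0))
      (fun x hx => (d0 x hx).hasDerivWithinAt) (fun x hx y hy => ?_) hx hy hz hxyz
    exact (convex_Ici 0).norm_image_sub_le_of_norm_hasDerivWithin_le
      (fun t ht => (d1 t ht).hasDerivWithinAt) hL' hx hy

/-! ### Corresponding measures and their products. -/

/-- The change of variables `x ↦ √(2x)` from energy to speed. -/
def speedEquiv : ℝ≥0 ≃ᵐ ℝ≥0 where
  toFun x := NNReal.sqrt (2 * x)
  invFun r := r ^ 2 / 2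
  left_inv x := by
    simp only [NNReal.sq_sqrt]
    exact mul_div_cancel_left₀ x two_ne_zero
  right_inv r := by
    simp only
    rw [mul_div_cancel₀ _ two_ne_zero, NNReal.sqrt_sq]
  measurable_toFun := (NNReal.continuous_sqrt.comp (by fun_prop)).measurable
  measurable_invFun := by
    change Measurable fun r : ℝ≥0 => r ^ 2 / 2
    fun_prop

theorem coe_speedEquiv (x : ℝ≥0) : ((speedEquiv x : ℝ≥0) : ℝ) = √(2 * (x : ℝ)) := by
  change ((NNReal.sqrt (2 * x) : ℝ≥0) : ℝ) = _
  rw [Real.coe_sqrt]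
  simp

theorem coe_speedEquiv_sq (x : ℝ≥0) : ((speedEquiv x : ℝ≥0) : ℝ) ^ 2 = 2 * x := by
  rw [coe_speedEquiv, Real.sq_sqrt (by positivity)]

/-- Since `x ↦ √(2x)` is a measurable bijection, either equality can be inverted; afterwards only
this pushforward formula is used. -/
theorem speed_eq_of_correspond {F G : Measure ℝ≥0}
    (h : EnergyFromSpeed F G ∨ SpeedFromEnergy F G) :
    G = ENNReal.ofReal (4 * π * √2) • F.map speedEquiv := by
  have hc : (0 : ℝ) < 4 * π * √2 := by positivity
  have hind : ∀ {T : ℝ≥0 → ℝ≥0} (_ : Measurable T) {A : Set ℝ≥0} (_ : MeasurableSet A)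
      (μ : Measure ℝ≥0), ∫⁻ x, A.indicator (1 : ℝ≥0 → ℝ≥0∞) (T x) ∂μ = μ (T ⁻¹' A) := by
    intro T hT A hA μ
    rw [← lintegral_indicator_one (hT hA)]
    rfl
  rcases h with h | h
  · have hF : F = ENNReal.ofReal (1 / (4 * π * √2)) • G.map speedEquiv.symm := by
      ext A hA
      rw [h A hA, Measure.smul_apply, MeasurableEquiv.map_apply, smul_eq_mul,
        hind (T := fun r : ℝ≥0 => r ^ 2 / 2) speedEquiv.symm.measurable hA]
      rfl
    rw [hF, Measure.map_smul, MeasurableEquiv.map_map_symm, smul_smul,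
      ← ENNReal.ofReal_mul hc.le, mul_one_div_cancel hc.ne', ENNReal.ofReal_one, one_smul]
  · ext A hA
    rw [h A hA, Measure.smul_apply, MeasurableEquiv.map_apply, smul_eq_mul,
      hind (T := fun x : ℝ≥0 => NNReal.sqrt (2 * x)) speedEquiv.measurable hA]
    rfl

theorem MemBPlus.isFiniteMeasure {F : Measure ℝ≥0} (h : MemBPlus 1 F) : IsFiniteMeasure F := by
  refine ⟨lt_of_le_of_lt ?_ h⟩
  rw [← lintegral_one]
  exact lintegral_mono fun x => by simp

theorem MemBPlus.integrable_coe {F : Measure ℝ≥0} (h : MemBPlus 1 F) :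
    Integrable (fun x : ℝ≥0 => (x : ℝ)) F := by
  refine ⟨by fun_prop, ?_⟩
  refine lt_of_le_of_lt (lintegral_mono fun x => ?_) h
  rw [pow_one]
  refine le_add_left (le_of_eq ?_)
  rw [enorm_eq_nnnorm]
  simp

theorem integral_smul_map {α β : Type*} [MeasurableSpace α] [MeasurableSpace β] (e : α ≃ᵐ β)
    (μ : Measure α) {c : ℝ} (hc : 0 ≤ c) (f : β → ℝ) :
    ∫ y, f y ∂(ENNReal.ofReal c • μ.map e) = c * ∫ x, f (e x) ∂μ := by
  rw [integral_smul_measure, integral_map_equiv, ENNReal.toReal_ofReal hc, smul_eq_mul]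

section Correspondence

variable {F : Measure ℝ≥0} [IsFiniteMeasure F] {c : ℝ}

theorem prod_smul_map (hc : 0 ≤ c) (e : ℝ≥0 ≃ᵐ ℝ≥0) :
    (ENNReal.ofReal c • F.map e).prod (ENNReal.ofReal c • F.map e)
      = ENNReal.ofReal (c ^ 2) • (F.prod F).map (e.prodCongr e) := by
  have : (F.prod F).map (e.prodCongr e) = (F.map e).prod (F.map e) :=
    (Measure.map_prod_map F F e.measurable e.measurable).symm
  rw [this, Measure.prod_smul_left, Measure.prod_smul_right, smul_smul, ← ENNReal.ofReal_mul hc,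
    sq]

theorem prod_prod_smul_map (hc : 0 ≤ c) (e : ℝ≥0 ≃ᵐ ℝ≥0) :
    (ENNReal.ofReal c • F.map e).prod
        ((ENNReal.ofReal c • F.map e).prod (ENNReal.ofReal c • F.map e))
      = ENNReal.ofReal (c ^ 3) • (F.prod (F.prod F)).map (e.prodCongr (e.prodCongr e)) := by
  have : (F.prod (F.prod F)).map (e.prodCongr (e.prodCongr e))
      = (F.map e).prod ((F.prod F).map (e.prodCongr e)) :=
    (Measure.map_prod_map F (F.prod F) e.measurable (e.prodCongr e).measurable).symm
  rw [this, prod_smul_map hc, Measure.prod_smul_left, Measure.prod_smul_right, smul_smul,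
    ← ENNReal.ofReal_mul hc]
  congr 2
  ring

/-- The symmetrization principle: functions with the same average over the swap have the same
integral under an invariant measure. -/
theorem integral_eq_of_add_swap {α : Type*} [MeasurableSpace α] {μ : Measure α} (e : α ≃ᵐ α)
    (he : MeasurePreserving e μ μ) {f g : α → ℝ} (hf : Integrable f μ)
    (hfg : ∀ p, f p + f (e p) = 2 * g p) : ∫ p, f p ∂μ = ∫ p, g p ∂μ := by
  have h1 : ∫ p, f (e p) ∂μ = ∫ p, f p ∂μ := he.integral_comp' f
  have h2 : Integrable (fun p => f (e p)) μ := he.integrable_comp_of_integrable hf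
  have h3 := integral_add hf h2
  simp only [hfg, integral_const_mul, h1] at h3
  linarith

end Correspondence

/-! ### Correspondence of the collision integrals and of the solutions. -/

theorem quadratic_correspondence {Φ : ℝ → ℝ → ℝ} {C : ℝ} (h : IsGlobalFactor Φ C) {φ : ℝ → ℝ}
    {K L : ℝ} (hφ : IsGlobalTest φ K L) {F : Measure ℝ≥0} (hF : MemBPlus 1 F) {G : Measure ℝ≥0}
    (hG : G = ENNReal.ofReal (4 * π * √2) • F.map speedEquiv) :
    Integrable (fun p : ℝ≥0 × ℝ≥0 => JB Φ φ p.1 p.2) (G.prod G) ∧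
      Integrable (fun p : ℝ≥0 × ℝ≥0 => calJ Φ φ p.1 p.2) (F.prod F) ∧
      ∫ p : ℝ≥0 × ℝ≥0, JB Φ φ p.1 p.2 ∂(G.prod G) =
        4 * π * √2 * ∫ p : ℝ≥0 × ℝ≥0, calJ Φ φ p.1 p.2 ∂(F.prod F) := by
  have := hF.isFiniteMeasure
  have hc : (0 : ℝ) < 4 * π * √2 := by positivity
  have hdom : Integrable (fun p : ℝ≥0 × ℝ≥0 => 2 * K * C * (1 + (p.1 : ℝ) + (p.2 : ℝ)))
      (F.prod F) := by
    have hx := hF.integrable_coe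
    exact (((integrable_const 1).add (hx.comp_fst F)).add (hx.comp_snd F)).const_mul _
  have hmJ : Measurable fun p : ℝ≥0 × ℝ≥0 => calJ Φ φ p.1 p.2 :=
    (measurable_calJ h hφ.continuous).comp
      (f := fun p : ℝ≥0 × ℝ≥0 => ((p.1 : ℝ), (p.2 : ℝ))) (by fun_prop)
  have hmB : Measurable fun p : ℝ≥0 × ℝ≥0 =>
      4 * π * √2 * JB Φ φ √(2 * (p.1 : ℝ)) √(2 * (p.2 : ℝ)) :=
    ((measurable_JB h hφ).comp (f := fun p : ℝ≥0 × ℝ≥0 =>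
      (√(2 * (p.1 : ℝ)), √(2 * (p.2 : ℝ)))) (by fun_prop)).const_mul _
  have iJ : Integrable (fun p : ℝ≥0 × ℝ≥0 => calJ Φ φ p.1 p.2) (F.prod F) :=
    hdom.mono' hmJ.aestronglyMeasurable
      (ae_of_all _ fun p => abs_calJ_le h hφ p.1.2 p.2.2)
  have iB : Integrable (fun p : ℝ≥0 × ℝ≥0 =>
      4 * π * √2 * JB Φ φ √(2 * (p.1 : ℝ)) √(2 * (p.2 : ℝ))) (F.prod F) :=
    hdom.mono' hmB.aestronglyMeasurable
      (ae_of_all _ fun p => abs_JB_le h hφ p.1.2 p.2.2)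
  have hpres : MeasurePreserving (MeasurableEquiv.prodComm (α := ℝ≥0) (β := ℝ≥0))
      (F.prod F) (F.prod F) := Measure.measurePreserving_swap
  have hsym := integral_eq_of_add_swap _ hpres iB
    (g := fun p => calJ Φ φ p.1 p.2) fun p => JB_add_swap h hφ p.1.2 p.2.2
  have hcomp : ∀ p : ℝ≥0 × ℝ≥0, JB Φ φ (speedEquiv.prodCongr speedEquiv p).1
      (speedEquiv.prodCongr speedEquiv p).2 = JB Φ φ √(2 * (p.1 : ℝ)) √(2 * (p.2 : ℝ)) := fun p => by
    rw [← coe_speedEquiv, ← coe_speedEquiv]; rfl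
  refine ⟨?_, iJ, ?_⟩
  · rw [hG, prod_smul_map hc.le]
    refine Integrable.smul_measure ?_ ENNReal.ofReal_ne_top
    rw [integrable_map_equiv]
    refine ((integrable_const_mul_iff (IsUnit.mk0 _ hc.ne') _).1 iB).congr (ae_of_all _ fun p => ?_)
    exact (hcomp p).symm
  -- Of the factor `(4π√2)²` from the product measure, one copy is consumed by the symmetrized
  -- identity.
  · rw [hG, prod_smul_map hc.le, integral_smul_map _ _ (by positivity), ← hsym]
    simp_rw [hcomp]
    rw [integral_const_mul, sq, mul_assoc]

theorem cubic_correspondence {Φ : ℝ → ℝ → ℝ} {C : ℝ} (h : IsGlobalFactor Φ C) {φ : ℝ → ℝ}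
    {K L : ℝ} (hφ : IsGlobalTest φ K L) {F : Measure ℝ≥0} (hF : MemBPlus 1 F) {G : Measure ℝ≥0}
    (hG : G = ENNReal.ofReal (4 * π * √2) • F.map speedEquiv) :
    Integrable (fun p : ℝ≥0 × ℝ≥0 × ℝ≥0 => KB Φ φ p.1 p.2.1 p.2.2) (G.prod (G.prod G)) ∧
      Integrable (fun p : ℝ≥0 × ℝ≥0 × ℝ≥0 => calK Φ φ p.1 p.2.1 p.2.2) (F.prod (F.prod F)) ∧
      ∫ p : ℝ≥0 × ℝ≥0 × ℝ≥0, KB Φ φ p.1 p.2.1 p.2.2 ∂(G.prod (G.prod G)) =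
        4 * π * √2 * ∫ p : ℝ≥0 × ℝ≥0 × ℝ≥0, calK Φ φ p.1 p.2.1 p.2.2 ∂(F.prod (F.prod F)) := by
  have := hF.isFiniteMeasure
  have hc : (0 : ℝ) < 4 * π * √2 := by positivity
  have hc2 : (0 : ℝ) < 32 * π ^ 2 := by positivity
  have hmK : Measurable fun p : ℝ≥0 × ℝ≥0 × ℝ≥0 => calK Φ φ p.1 p.2.1 p.2.2 :=
    (measurable_calK h hφ.continuous).comp
      (f := fun p : ℝ≥0 × ℝ≥0 × ℝ≥0 => ((p.1 : ℝ), (p.2.1 : ℝ), (p.2.2 : ℝ))) (by fun_prop)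
  have hmB : Measurable fun p : ℝ≥0 × ℝ≥0 × ℝ≥0 =>
      32 * π ^ 2 * KB Φ φ √(2 * (p.1 : ℝ)) √(2 * (p.2.1 : ℝ)) √(2 * (p.2.2 : ℝ)) :=
    ((measurable_KB h hφ.continuous).comp (f := fun p : ℝ≥0 × ℝ≥0 × ℝ≥0 =>
      (√(2 * (p.1 : ℝ)), √(2 * (p.2.1 : ℝ)), √(2 * (p.2.2 : ℝ)))) (by fun_prop)).const_mul _
  have iK : Integrable (fun p : ℝ≥0 × ℝ≥0 × ℝ≥0 => calK Φ φ p.1 p.2.1 p.2.2)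
      (F.prod (F.prod F)) :=
    Integrable.of_bound hmK.aestronglyMeasurable ((4 * K + |L|) * C)
      (ae_of_all _ fun p => abs_calK_le h hφ p.1.2 p.2.1.2 p.2.2.2)
  have iB : Integrable (fun p : ℝ≥0 × ℝ≥0 × ℝ≥0 =>
      32 * π ^ 2 * KB Φ φ √(2 * (p.1 : ℝ)) √(2 * (p.2.1 : ℝ)) √(2 * (p.2.2 : ℝ)))
      (F.prod (F.prod F)) :=
    Integrable.of_bound hmB.aestronglyMeasurable (2 * ((4 * K + |L|) * C))
      (ae_of_all _ fun p => abs_KB_le h hφ p.1.2 p.2.1.2 p.2.2.2)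
  have hpres : MeasurePreserving
      ((MeasurableEquiv.refl ℝ≥0).prodCongr (MeasurableEquiv.prodComm (α := ℝ≥0) (β := ℝ≥0)))
      (F.prod (F.prod F)) (F.prod (F.prod F)) :=
    (MeasurePreserving.id F).prod Measure.measurePreserving_swap
  have hsym := integral_eq_of_add_swap _ hpres iB
    (g := fun p => calK Φ φ p.1 p.2.1 p.2.2) fun p => KB_add_swap h φ p.1.2 p.2.1.2 p.2.2.2
  have hcomp : ∀ p : ℝ≥0 × ℝ≥0 × ℝ≥0,
      KB Φ φ (speedEquiv.prodCongr (speedEquiv.prodCongr speedEquiv) p).1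
        (speedEquiv.prodCongr (speedEquiv.prodCongr speedEquiv) p).2.1
        (speedEquiv.prodCongr (speedEquiv.prodCongr speedEquiv) p).2.2
      = KB Φ φ √(2 * (p.1 : ℝ)) √(2 * (p.2.1 : ℝ)) √(2 * (p.2.2 : ℝ)) := fun p => by
    rw [← coe_speedEquiv, ← coe_speedEquiv, ← coe_speedEquiv]; rfl
  refine ⟨?_, iK, ?_⟩
  · rw [hG, prod_prod_smul_map hc.le]
    refine Integrable.smul_measure ?_ ENNReal.ofReal_ne_top
    rw [integrable_map_equiv]
    refine ((integrable_const_mul_iff (IsUnit.mk0 _ hc2.ne') _).1 iB).congr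
      (ae_of_all _ fun p => ?_)
    exact (hcomp p).symm
  · rw [hG, prod_prod_smul_map hc.le, integral_smul_map _ _ (by positivity), ← hsym]
    simp_rw [hcomp]
    rw [integral_const_mul]
    -- Two of the three copies of `4π√2` form the constant of the symmetrized cubic identity.
    have : (4 * π * √2) ^ 3 = 4 * π * √2 * (32 * π ^ 2) := by
      linear_combination (64 * π ^ 3 * √2) * Real.sq_sqrt (zero_le_two (α := ℝ))
    rw [this, mul_assoc]

theorem collision_correspondence {Φ : ℝ → ℝ → ℝ} (hΦ : IsKernelFactor Φ) {F G : Measure ℝ≥0}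
    (hF : MemBPlus 1 F) (hFG : EnergyFromSpeed F G ∨ SpeedFromEnergy F G) {φ : ℝ → ℝ}
    (hφ : MemCb 2 φ) :
    (Integrable (fun p : ℝ≥0 × ℝ≥0 => JB Φ φ p.1 p.2) (G.prod G) ∧
      Integrable (fun p : ℝ≥0 × ℝ≥0 => calJ Φ φ p.1 p.2) (F.prod F) ∧
      ∫ p : ℝ≥0 × ℝ≥0, JB Φ φ p.1 p.2 ∂(G.prod G) =
        4 * π * √2 * ∫ p : ℝ≥0 × ℝ≥0, calJ Φ φ p.1 p.2 ∂(F.prod F)) ∧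
    (Integrable (fun p : ℝ≥0 × ℝ≥0 × ℝ≥0 => KB Φ φ p.1 p.2.1 p.2.2) (G.prod (G.prod G)) ∧
      Integrable (fun p : ℝ≥0 × ℝ≥0 × ℝ≥0 => calK Φ φ p.1 p.2.1 p.2.2) (F.prod (F.prod F)) ∧
      ∫ p : ℝ≥0 × ℝ≥0 × ℝ≥0, KB Φ φ p.1 p.2.1 p.2.2 ∂(G.prod (G.prod G)) =
        4 * π * √2 *
          ∫ p : ℝ≥0 × ℝ≥0 × ℝ≥0, calK Φ φ p.1 p.2.1 p.2.2 ∂(F.prod (F.prod F))) := by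
  obtain ⟨C, hC⟩ := hΦ.exists_isGlobalFactor
  obtain ⟨K, L, hKL⟩ := hφ.exists_isGlobalTest
  have hG := speed_eq_of_correspond hFG
  have h1 := quadratic_correspondence hC hKL hF hG
  have h2 := cubic_correspondence hC hKL hF hG
  simp only [JB_extend, calJ_extend Φ φ (NNReal.coe_nonneg _) (NNReal.coe_nonneg _)] at h1
  simp only [KB_extend, calK_extend Φ φ (NNReal.coe_nonneg _) (NNReal.coe_nonneg _)
    (NNReal.coe_nonneg _)] at h2
  exact ⟨h1, h2⟩

/-- No regularity or integrability of `φ` is needed, because the change of variables is a measurable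
equivalence; the unbounded choice `φ(x) = x` therefore also yields the energy. -/
theorem integral_test_speed {F G : Measure ℝ≥0}
    (h : EnergyFromSpeed F G ∨ SpeedFromEnergy F G) (φ : ℝ → ℝ) :
    ∫ r : ℝ≥0, φ ((r : ℝ) ^ 2 / 2) ∂G = 4 * π * √2 * ∫ x : ℝ≥0, φ x ∂F := by
  rw [speed_eq_of_correspond h, integral_smul_map _ _ (by positivity)]
  congr 1
  refine integral_congr_ae (ae_of_all _ fun x => ?_)
  simp only [coe_speedEquiv_sq, mul_div_cancel_left₀ _ (two_ne_zero (α := ℝ))]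

theorem moment_zero_speed {F G : Measure ℝ≥0}
    (h : EnergyFromSpeed F G ∨ SpeedFromEnergy F G) :
    moment 0 G = 4 * π * √2 * moment 0 F := by
  simpa [moment] using integral_test_speed h (fun _ => 1)

theorem moment_two_speed {F G : Measure ℝ≥0}
    (h : EnergyFromSpeed F G ∨ SpeedFromEnergy F G) :
    moment 2 G = 4 * π * √2 * (2 * moment 1 F) := by
  have := integral_test_speed h (fun x => x)
  rw [integral_div, div_eq_iff two_ne_zero] at this
  simp only [moment, pow_one]
  rw [this]
  ring

theorem isSpeedSolution_of_isSolution {Φ : ℝ → ℝ → ℝ} (hΦ : IsKernelFactor Φ)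
    {F G : ℝ → Measure ℝ≥0} (hG : ∀ t : ℝ, 0 ≤ t → MemBPlus 2 (G t))
    (hFG : ∀ t : ℝ, 0 ≤ t → EnergyFromSpeed (F t) (G t) ∨ SpeedFromEnergy (F t) (G t))
    (h : IsSolution Φ F) : IsSpeedSolution Φ G where
  mem := hG
  mass t ht := by
    rw [moment_zero_speed (hFG t ht), moment_zero_speed (hFG 0 le_rfl), h.mass t ht]
  energy t ht := by
    rw [moment_two_speed (hFG t ht), moment_two_speed (hFG 0 le_rfl), h.energy t ht]
  contDiff φ hφ := ((contDiffOn_const (c := 4 * π * √2)).mul (h.contDiff φ hφ)).congr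
    fun t ht => integral_test_speed (hFG t ht) φ
  equation φ hφ t ht := by
    obtain ⟨⟨-, -, e1⟩, -, -, e2⟩ := collision_correspondence hΦ (h.mem t ht) (hFG t ht) hφ
    rw [e1, e2, ← mul_add]
    exact ((h.equation φ hφ t ht).const_mul (4 * π * √2)).congr
      (fun s hs => integral_test_speed (hFG s hs) φ) (integral_test_speed (hFG t ht) φ)

theorem isSolution_of_isSpeedSolution {Φ : ℝ → ℝ → ℝ} (hΦ : IsKernelFactor Φ)
    {F G : ℝ → Measure ℝ≥0} (hF : ∀ t : ℝ, 0 ≤ t → MemBPlus 1 (F t))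
    (hFG : ∀ t : ℝ, 0 ≤ t → EnergyFromSpeed (F t) (G t) ∨ SpeedFromEnergy (F t) (G t))
    (h : IsSpeedSolution Φ G) : IsSolution Φ F := by
  have hc : (4 * π * √2 : ℝ) ≠ 0 := by positivity
  have hφF : ∀ φ : ℝ → ℝ, ∀ t ∈ Ici (0 : ℝ), ∫ x : ℝ≥0, φ x ∂(F t)
      = (4 * π * √2)⁻¹ * ∫ r : ℝ≥0, φ ((r : ℝ) ^ 2 / 2) ∂(G t) := fun φ t ht => by
    rw [integral_test_speed (hFG t ht), inv_mul_cancel_left₀ hc]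
  refine ⟨hF, fun t ht => ?_, fun t ht => ?_, fun φ hφ => ?_, fun φ hφ t ht => ?_⟩
  · have := h.mass t ht
    rw [moment_zero_speed (hFG t ht), moment_zero_speed (hFG 0 le_rfl)] at this
    exact mul_left_cancel₀ hc this
  · have := h.energy t ht
    rw [moment_two_speed (hFG t ht), moment_two_speed (hFG 0 le_rfl)] at this
    exact mul_left_cancel₀ two_ne_zero (mul_left_cancel₀ hc this)
  · exact ((contDiffOn_const (c := (4 * π * √2)⁻¹)).mul (h.contDiff φ hφ)).congr (hφF φ)
  · obtain ⟨⟨-, -, e1⟩, -, -, e2⟩ := collision_correspondence hΦ (hF t ht) (hFG t ht) hφ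
    have hd := ((h.equation φ hφ t ht).const_mul (4 * π * √2)⁻¹).congr (hφF φ) (hφF φ t ht)
    rwa [e1, e2, ← mul_add, inv_mul_cancel_left₀ hc] at hd

end BoseEinstein

end

theorem proposition6 (Φ : ℝ → ℝ → ℝ) (hΦ : BoseEinstein.IsKernelFactor Φ) :
    -- the collision integrals correspond
    (∀ F G : Measure ℝ≥0, BoseEinstein.MemBPlus 1 F → BoseEinstein.MemBPlus 2 G →
      (BoseEinstein.EnergyFromSpeed F G ∨ BoseEinstein.SpeedFromEnergy F G) →
      ∀ φ : ℝ → ℝ, BoseEinstein.MemCb 2 φ →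
        (Integrable (fun p : ℝ≥0 × ℝ≥0 => BoseEinstein.JB Φ φ p.1 p.2) (G.prod G) ∧
          Integrable (fun p : ℝ≥0 × ℝ≥0 => BoseEinstein.calJ Φ φ p.1 p.2) (F.prod F) ∧
          ∫ p : ℝ≥0 × ℝ≥0, BoseEinstein.JB Φ φ p.1 p.2 ∂(G.prod G) =
            4 * π * √2 * ∫ p : ℝ≥0 × ℝ≥0, BoseEinstein.calJ Φ φ p.1 p.2 ∂(F.prod F)) ∧
        (Integrable (fun p : ℝ≥0 × ℝ≥0 × ℝ≥0 => BoseEinstein.KB Φ φ p.1 p.2.1 p.2.2)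
            (G.prod (G.prod G)) ∧
          Integrable (fun p : ℝ≥0 × ℝ≥0 × ℝ≥0 => BoseEinstein.calK Φ φ p.1 p.2.1 p.2.2)
            (F.prod (F.prod F)) ∧
          ∫ p : ℝ≥0 × ℝ≥0 × ℝ≥0, BoseEinstein.KB Φ φ p.1 p.2.1 p.2.2 ∂(G.prod (G.prod G)) =
            4 * π * √2 *
              ∫ p : ℝ≥0 × ℝ≥0 × ℝ≥0, BoseEinstein.calK Φ φ p.1 p.2.1 p.2.2
                ∂(F.prod (F.prod F)))) ∧
    -- the two notions of solution are equivalent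
    (∀ F G : ℝ → Measure ℝ≥0,
      (∀ t : ℝ, 0 ≤ t → BoseEinstein.MemBPlus 1 (F t)) →
      (∀ t : ℝ, 0 ≤ t → BoseEinstein.MemBPlus 2 (G t)) →
      (∀ t : ℝ, 0 ≤ t →
        BoseEinstein.EnergyFromSpeed (F t) (G t) ∨ BoseEinstein.SpeedFromEnergy (F t) (G t)) →
      (BoseEinstein.IsSolution Φ F ↔ BoseEinstein.IsSpeedSolution Φ G)) := by
  refine ⟨fun F G hF _ hFG φ hφ => BoseEinstein.collision_correspondence hΦ hF hFG hφ,
    fun F G hF hG hFG => ⟨BoseEinstein.isSpeedSolution_of_isSolution hΦ hG hFG,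
      BoseEinstein.isSolution_of_isSpeedSolution hΦ hF hFG⟩⟩
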